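/- Norms $\|\cdot\|$ are Euclidean norms for vectors and operator norms for matrices, $\|\cdot\|_F$ is the Frobenius norm, and $\sigma_k$ is the $k$-th largest singular value. **Setting.** Let $Y\in\mathbb R^{m\times n}$ have rank $r\ge 1$, with a compact singular value decomposition $Y=P\,\mathrm{diag}(s_1,\dots,s_r)\,Q^\top$, where $P\in\mathbb R^{m\times r}$ and $Q\in\mathbb R^{n\times r}$ have orthonormal columns and $s_1\ge\dots\ge s_r>0$. (If $Y$ is itself diagonal with decreasing nonnegative diagonal, one may take for $P,Q$ the first $r$ columns of the identity matrices.) Put $\kappa=\|Y\|/\sigma_r(Y)$ and $\gamma=\min(m,n)/r$. Let $\mathcal A:\mathbb R^{m\times n}\to\mathbb R^{d}$ be linear with adjoint $\mathcal A^*$ (for the Frobenius inner product), $\eta>0$, $U_0\in\mathbb R^{m\times h}$, $V_0\in\mathbb R^{n\times h}$. Gradient descent on $\frac12\|\mathcal A(Y-UV^\top)\|^2$ is the iteration $$U^{(k+1)}=U^{(k)}+\eta\,\mathcal A^*\mathcal A(Y-U^{(k)}V^{(k)\top})V^{(k)},\qquad V^{(k+1)}=V^{(k)}+\eta\,\big(\mathcal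 A^*\mathcal A(Y-U^{(k)}V^{(k)\top})\big)^{\top}U^{(k)},$$ with $U^{(0)}=U_0$, $V^{(0)}=V_0$. For $X\in\mathbb R^{m\times n}$ let $\widehat X=\begin{pmatrix}0&X\\X^\top&0\end{pmatrix}$. A *perturbed gradient flow* is a continuous curve $W_t=\begin{pmatrix}U_t\\V_t\end{pmatrix}$, $t\ge0$, starting at $W_0=\begin{pmatrix}U_0\\V_0\end{pmatrix}$, whose right derivative is $\frac{d}{dt}W_t=(R_t+E_t)W_t$ for all $t\ge 0$, where $R_t=\widehat{Y-U_tV_t^\top}$ and, with $k=\lfloor t/\eta\rfloor$, $$E_t=\tfrac1\eta\ln\!\big(I+\eta R_{k\eta}+\eta \hat E^{\mathcal A}_{k\eta}\big)-R_t,\qquad \hat E^{\mathcal A}_{t}=\widehat{(\mathcal A^*\mathcal A-I)(Y-U_tV_t^\top)}.$$ Here $\ln$ of a symmetric matrix is obtained by applying $x\mapsto\ln|x|$ (and $0\mapsto 0$) to its eigenvalues; it is the usual logarithm when the matrix is positive definite. **Assumptions.** Let $\alpha\ge1$, $\delta\le\frac1{64\alpha\kappa}$, $A_0=\frac1{\sqrt2}(P^\top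 U_0+Q^\top V_0)\in\mathbb R^{r\times h}$, and suppose $$\|W_0\|\le\epsilon,\qquad \sigma_r(A_0)\ge\frac{\epsilon}{\alpha^2},\qquad 0<\epsilon\le\min\Big(\frac{\sqrt\kappa}{\alpha\gamma},\frac{\delta}{3\alpha}\Big)\sqrt{\|Y\|}.$$ Let $T=\frac5{\sigma_r(Y)}\ln\frac{\sigma_r(Y)}{\epsilon^2}$. Suppose $(1-\rho)\|X\|_F^2\le\|\mathcal A(X)\|^2\le(1+\rho)\|X\|_F^2$ for all $X\in\mathbb R^{m\times n}$ of rank at most $r+1$, where $\rho\le\frac{\delta^2}{16\sqrt r\,T\|Y\|}$, and suppose $\eta\le\frac{\delta^2}{80\,T\|Y\|^2}$. **Theorem.** A perturbed gradient flow exists. Every perturbed gradient flow interpolates gradient descent up to time $T$, that is, $U_{k\eta}=U^{(k)}$ and $V_{k\eta}=V^{(k)}$ for all integers $k\ge0$ with $k\eta\le T$, and satisfies $$\|Y-U_TV_T^\top\|\le 64\epsilon^2\big(\delta^2\gamma\kappa+\sqrt\kappa\big)\Big(\frac{\sigma_r(Y)}{\epsilon^2}\Big)^{32\alpha\kappa\delta}.$$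 Moreover, the right-hand side is at most $64\big(\delta^2\gamma\kappa+\sqrt\kappa\big)\sqrt{\sigma_r(Y)}\;\epsilon$, so the guaranteed error becomes arbitrarily small as $\epsilon$ shrinks. -/

import Mathlib

open scoped Matrix Matrix.Norms.L2Operator

noncomputable section

namespace MatrixSensing

/-! Throughout, `‖X‖` for a matrix `X` is the operator norm induced by the Euclidean norms
(the scoped instances of `Matrix.Norms.L2Operator`). -/

/-- `sv k X` is the `k`-th largest singular value of `X`, counted from `k = 1`
(Mathlib's sequence of singular values counts from `0`). -/
def sv {p q : Type*} [Fintype p] [Fintype q] [DecidableEq q] (k : ℕ) (X : Matrix p q ℝ) : ℝ :=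
  (Matrix.toEuclideanLin X).singularValues (k - 1)

/-- The squared Frobenius norm. -/
def frobSq {p q : Type*} [Fintype p] [Fintype q] (X : Matrix p q ℝ) : ℝ :=
  ∑ i, ∑ j, X i j ^ 2

/-- The adjoint of a linear measurement operator, with respect to the Frobenius inner product
`⟨X, Z⟩ = tr (Xᵀ Z)` on matrices and the Euclidean inner product on the measurements. -/
def adj {m n d : ℕ} (𝒜 : Matrix (Fin m) (Fin n) ℝ →ₗ[ℝ] EuclideanSpace ℝ (Fin d))
    (y : EuclideanSpace ℝ (Fin d)) : Matrix (Fin m) (Fin n) ℝ :=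
  Matrix.of fun i j => inner ℝ (𝒜 (Matrix.single i j 1)) y

/-- The defining property of the adjoint. -/
theorem trace_transpose_mul_adj {m n d : ℕ}
    (𝒜 : Matrix (Fin m) (Fin n) ℝ →ₗ[ℝ] EuclideanSpace ℝ (Fin d))
    (X : Matrix (Fin m) (Fin n) ℝ) (y : EuclideanSpace ℝ (Fin d)) :
    (Xᵀ * adj 𝒜 y).trace = inner ℝ (𝒜 X) y := by
  conv_rhs => rw [Matrix.matrix_eq_sum_single X]
  have h : ∀ i j, Matrix.single i j (X i j) = X i j • Matrix.single i j (1 : ℝ) := by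
    intro i j
    simp [Matrix.smul_single]
  simp only [h, map_sum, map_smul, sum_inner, real_inner_smul_left]
  simp only [Matrix.trace, Matrix.diag_apply, Matrix.mul_apply, Matrix.transpose_apply, adj,
    Matrix.of_apply]
  exact Finset.sum_comm

/-- Restricted isometry property with rank `r` and constant `ρ`. -/
def RIP {m n d : ℕ} (𝒜 : Matrix (Fin m) (Fin n) ℝ →ₗ[ℝ] EuclideanSpace ℝ (Fin d))
    (r : ℕ) (ρ : ℝ) : Prop :=
  ∀ X : Matrix (Fin m) (Fin n) ℝ, X.rank ≤ r →
    (1 - ρ) * frobSq X ≤ ‖𝒜 X‖ ^ 2 ∧ ‖𝒜 X‖ ^ 2 ≤ (1 + ρ) * frobSq X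

/-- One step of gradient descent with learning rate `η` on
`L (U, V) = ‖𝒜 (Y - U Vᵀ)‖ ^ 2 / 2`, started at `(U, V) = p`. -/
def gdStep {m n h d : ℕ} (𝒜 : Matrix (Fin m) (Fin n) ℝ →ₗ[ℝ] EuclideanSpace ℝ (Fin d))
    (Y : Matrix (Fin m) (Fin n) ℝ) (η : ℝ)
    (p : Matrix (Fin m) (Fin h) ℝ × Matrix (Fin n) (Fin h) ℝ) :
    Matrix (Fin m) (Fin h) ℝ × Matrix (Fin n) (Fin h) ℝ :=
  (p.1 + η • (adj 𝒜 (𝒜 (Y - p.1 * p.2ᵀ)) * p.2),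
   p.2 + η • ((adj 𝒜 (𝒜 (Y - p.1 * p.2ᵀ)))ᵀ * p.1))

/-- The pair `(U, V)` after `k` steps of gradient descent from `(U₀, V₀)`. -/
def gd {m n h d : ℕ} (𝒜 : Matrix (Fin m) (Fin n) ℝ →ₗ[ℝ] EuclideanSpace ℝ (Fin d))
    (Y : Matrix (Fin m) (Fin n) ℝ) (η : ℝ) (U₀ : Matrix (Fin m) (Fin h) ℝ)
    (V₀ : Matrix (Fin n) (Fin h) ℝ) :
    ℕ → Matrix (Fin m) (Fin h) ℝ × Matrix (Fin n) (Fin h) ℝ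
  | 0 => (U₀, V₀)
  | k + 1 => gdStep 𝒜 Y η (gd 𝒜 Y η U₀ V₀ k)

/-- The self-adjoint dilation `(0, X; Xᵀ, 0)`. -/
def dilation {m n : ℕ} (X : Matrix (Fin m) (Fin n) ℝ) :
    Matrix (Fin m ⊕ Fin n) (Fin m ⊕ Fin n) ℝ :=
  Matrix.fromBlocks 0 X Xᵀ 0

/-- `Y - U Vᵀ`, where `W = (U; V)`. -/
def resid {m n h : ℕ} (Y : Matrix (Fin m) (Fin n) ℝ)
    (W : Matrix (Fin m ⊕ Fin n) (Fin h) ℝ) : Matrix (Fin m) (Fin n) ℝ :=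
  Y - W.toRows₁ * W.toRows₂ᵀ

/-- The measurement error `(𝒜* 𝒜 - I) (Y - U Vᵀ)`, where `W = (U; V)`. -/
def measError {m n h d : ℕ} (𝒜 : Matrix (Fin m) (Fin n) ℝ →ₗ[ℝ] EuclideanSpace ℝ (Fin d))
    (Y : Matrix (Fin m) (Fin n) ℝ) (W : Matrix (Fin m ⊕ Fin n) (Fin h) ℝ) :
    Matrix (Fin m) (Fin n) ℝ :=
  adj 𝒜 (𝒜 (resid Y W)) - resid Y W

/-- The perturbation at time `t` along a curve `W`:
`E t = (1/η) ln (I + η R(kη) + η Ê(kη)) - R(t)` with `k = ⌊t/η⌋`, where `R` and `Ê` are the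
dilations of the residual and of the measurement error, and `ln` is the logarithm of a symmetric
matrix (functional calculus). -/
def perturbation {m n h d : ℕ} (𝒜 : Matrix (Fin m) (Fin n) ℝ →ₗ[ℝ] EuclideanSpace ℝ (Fin d))
    (Y : Matrix (Fin m) (Fin n) ℝ) (η : ℝ) (W : ℝ → Matrix (Fin m ⊕ Fin n) (Fin h) ℝ) (t : ℝ) :
    Matrix (Fin m ⊕ Fin n) (Fin m ⊕ Fin n) ℝ :=
  (1 / η) • CFC.log (1 + η • dilation (resid Y (W (⌊t / η⌋₊ * η)))
      + η • dilation (measError 𝒜 Y (W (⌊t / η⌋₊ * η))))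
    - dilation (resid Y (W t))

/-- `W` solves the perturbed gradient flow `dW/dt = (R + E) W` for `t ≥ 0` from `(U₀; V₀)`.
The right-hand side is only piecewise smooth, so `d/dt` is the right derivative. -/
structure IsPerturbedGradientFlow {m n h d : ℕ}
    (𝒜 : Matrix (Fin m) (Fin n) ℝ →ₗ[ℝ] EuclideanSpace ℝ (Fin d))
    (Y : Matrix (Fin m) (Fin n) ℝ) (η : ℝ) (U₀ : Matrix (Fin m) (Fin h) ℝ)
    (V₀ : Matrix (Fin n) (Fin h) ℝ) (W : ℝ → Matrix (Fin m ⊕ Fin n) (Fin h) ℝ) : Prop where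
  init : W 0 = Matrix.fromRows U₀ V₀
  cont : ContinuousOn W (Set.Ici 0)
  deriv : ∀ t, 0 ≤ t →
    HasDerivWithinAt W ((dilation (resid Y (W t)) + perturbation 𝒜 Y η W t) * W t)
      (Set.Ici t) t

/-- A compact singular value decomposition `Y = P diag(s) Qᵀ`, with `r` positive singular values
in decreasing order. If `Y` is itself diagonal with decreasing nonnegative diagonal and rank `r`,
then `P` and `Q` may be taken to be the first `r` columns of the identity matrices. -/
structure IsCompactSVD {m n r : ℕ} (Y : Matrix (Fin m) (Fin n) ℝ)
    (P : Matrix (Fin m) (Fin r) ℝ) (s : Fin r → ℝ) (Q : Matrix (Fin n) (Fin r) ℝ) : Prop where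
  left : Pᵀ * P = 1
  right : Qᵀ * Q = 1
  pos : ∀ i, 0 < s i
  anti : Antitone s
  eq : Y = P * Matrix.diagonal s * Qᵀ

/-- The condition number `κ = ‖Y‖ / σ_r(Y)`. -/
def kappa {m n : ℕ} (r : ℕ) (Y : Matrix (Fin m) (Fin n) ℝ) : ℝ := ‖Y‖ / sv r Y

/-- `γ = min(m, n) / r`. -/
def gamma (m n r : ℕ) : ℝ := (min m n : ℕ) / (r : ℝ)

/-- The end time `T = (5 / σ_r(Y)) ln (σ_r(Y) / ε²)`. -/
def endTime {m n : ℕ} (r : ℕ) (Y : Matrix (Fin m) (Fin n) ℝ) (ε : ℝ) : ℝ :=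
  5 / sv r Y * Real.log (sv r Y / ε ^ 2)

/-- The part of the weights aligned with `Y`: `A = (Pᵀ U + Qᵀ V) / √2`. When `P` and `Q` are the
first `r` columns of the identity matrices, these are the first `r` rows of `U + V`, over `√2`. -/
def aligned {m n h r : ℕ} (P : Matrix (Fin m) (Fin r) ℝ) (Q : Matrix (Fin n) (Fin r) ℝ)
    (U : Matrix (Fin m) (Fin h) ℝ) (V : Matrix (Fin n) (Fin h) ℝ) : Matrix (Fin r) (Fin h) ℝ :=
  (1 / Real.sqrt 2) • (Pᵀ * U + Qᵀ * V)

/-- The assumption on the initialization. -/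
structure InitAssumption {m n h r : ℕ} (Y : Matrix (Fin m) (Fin n) ℝ)
    (P : Matrix (Fin m) (Fin r) ℝ) (Q : Matrix (Fin n) (Fin r) ℝ)
    (U₀ : Matrix (Fin m) (Fin h) ℝ) (V₀ : Matrix (Fin n) (Fin h) ℝ) (α δ ε : ℝ) : Prop where
  one_le_alpha : 1 ≤ α
  delta_le : δ ≤ 1 / (64 * α * kappa r Y)
  eps_pos : 0 < ε
  eps_le : ε ≤ min (Real.sqrt (kappa r Y) / (α * gamma m n r)) (δ / (3 * α)) * Real.sqrt ‖Y‖
  norm_le : ‖Matrix.fromRows U₀ V₀‖ ≤ ε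
  le_sv : ε / α ^ 2 ≤ sv r (aligned P Q U₀ V₀)

/-- The assumption on the measurement operator and the learning rate, for an end time `T`. -/
structure RIPAssumption {m n d : ℕ} (r : ℕ) (Y : Matrix (Fin m) (Fin n) ℝ)
    (𝒜 : Matrix (Fin m) (Fin n) ℝ →ₗ[ℝ] EuclideanSpace ℝ (Fin d)) (δ ρ η T : ℝ) : Prop where
  rip : RIP 𝒜 (r + 1) ρ
  rho_le : ρ ≤ δ ^ 2 / (16 * Real.sqrt r * T * ‖Y‖)
  eta_pos : 0 < η
  eta_le : η ≤ δ ^ 2 / (80 * T * ‖Y‖ ^ 2)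

/-- The error bound `64 ε² (δ² γ κ + √κ) (σ_r(Y) / ε²) ^ (32 α κ δ)`. -/
def errorBound {m n : ℕ} (r : ℕ) (Y : Matrix (Fin m) (Fin n) ℝ) (α δ ε : ℝ) : ℝ :=
  64 * ε ^ 2 * (δ ^ 2 * gamma m n r * kappa r Y + Real.sqrt (kappa r Y)) *
    (sv r Y / ε ^ 2) ^ (32 * α * kappa r Y * δ)

end MatrixSensing

end

/-!
Gradient descent from a small initialization first amplifies the part of the weights that is aligned
with `Y`, and then contracts the residual, while everything else stays small. The proof follows the
perturbed flow on `[0, T]` in an eigenbasis of the dilation of `Y`.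

*The flow.* On each time step the generator is the constant matrix `(1/η) ln (I + η X̂)`, where `X`
is the gradient `𝒜* 𝒜 (Y - U Vᵀ)` at the start of the step. Hence flows exist by concatenation
(`exists_isPerturbedGradientFlow`), and a step multiplies the weights by `I + η X̂`, which is a step
of gradient descent, once `η ‖X‖ < 1` (`IsPerturbedGradientFlow.eq_gd`).

*The perturbation.* The residual has rank at most `2 r` up to a remainder of size `ψ²`, if the
weights have size at most `ψ` on the kernel of the aligned part. The restricted isometry property,
applied to blocks of rank `r`, therefore bounds the measurement error (`norm_measError_le`); adding
the error of the logarithm and the motion within a step gives `Scales.perturbation_le`.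

*The eigenbasis.* With `J = diag(1, -1)` and `N = Wᵀ J W` the equation reads
`W' = Ŷ W - ½ W Wᵀ W + ½ J W N + E W`. Let `A` and `C` be the parts of `W` along the eigenvectors
of `Ŷ` with eigenvalues `s` and `-s`, and `D` the part in the kernel of `Ŷ`. The imbalance `N` is
conserved up to the perturbation, `C` decays, and `D` is limited by the damping and by `N`; moreover
`A Aᵀ` stays below `2 diag(s)`, up to a small error. Finally the cone condition
`‖C x‖² + ‖D x‖² ≤ ¼ ‖A x‖² + ψ² ‖x‖²` persists while `ψ²` grows at the slow rate `6.4 δ ‖Y‖`,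
so the weights that do not take part in fitting `Y` stay of size `ψ`. Each of these bounds is a
matrix inequality between quadratic forms, and such an inequality persists if the derivative has the
right sign in the directions of equality (`posSemidef_eventually`). Those signs are the lemmas
`q_contact`, `ker_contact`, `p_upper_contact` and `cone_contact` in the namespace `Frame`. The
bounds hold together, and make each other and the bound for the perturbation true
(`Trapped`, `trapped_of_velocity`).

*Growth.* The smallest singular value of `A` obeys a Riccati inequality `f' ≥ 1.9 σ f - f²` for its
square `f` (`Frame.p_lower_contact`), so that `f ≥ 1.8 σ` after time `0.3 T`
(`growth_le_of_trapped`, `Params.le_growth`).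

*Contraction.* From then on the residual, as long as it exceeds `9 ψ²`, contracts at a rate of more
than `σ / 2`, up to the perturbation (`resid_contact`), so it decays at rate `0.45 σ` to the level
`9 ψ² + ν / 5`, where `ν = δ² γ ψ²` accounts for the measurement error
(`norm_resid_le_residBound`). Evaluating `ψ²` at time `T` gives the error bound
(`IsPerturbedGradientFlow.norm_resid_le_errorBound`), and `32 α κ δ ≤ 1/2` its simplified form
(`errorBound_le`).
-/

noncomputable section

namespace MatrixSensing

open Filter Topology Set

set_option linter.unusedSectionVars false

/-! ### Euclidean norms of coordinate vectors -/

section Euclid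

variable {p q l : Type*} [Fintype p] [Fintype q] [Fintype l]

/-- The Euclidean norm of a coordinate vector (the norm instance on `p → ℝ` is the sup norm). -/
def vnorm (x : p → ℝ) : ℝ := ‖WithLp.toLp 2 x‖

theorem vnorm_nonneg (x : p → ℝ) : 0 ≤ vnorm x := norm_nonneg _

theorem vnorm_sq (x : p → ℝ) : vnorm x ^ 2 = x ⬝ᵥ x := by
  rw [vnorm, ← real_inner_self_eq_norm_sq, EuclideanSpace.inner_toLp_toLp]
  simp

theorem vnorm_mul_self (x : p → ℝ) : vnorm x * vnorm x = x ⬝ᵥ x := by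
  rw [← sq, vnorm_sq]

theorem abs_dotProduct_le (x y : p → ℝ) : |x ⬝ᵥ y| ≤ vnorm x * vnorm y := by
  have := abs_real_inner_le_norm (WithLp.toLp 2 x) (WithLp.toLp 2 y)
  rw [EuclideanSpace.inner_toLp_toLp] at this
  simpa [dotProduct_comm, vnorm] using this

theorem dotProduct_le (x y : p → ℝ) : x ⬝ᵥ y ≤ vnorm x * vnorm y :=
  (le_abs_self _).trans (abs_dotProduct_le x y)

theorem neg_le_dotProduct (x y : p → ℝ) : -(vnorm x * vnorm y) ≤ x ⬝ᵥ y :=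
  (abs_le.mp (abs_dotProduct_le x y)).1

theorem vnorm_add_le (x y : p → ℝ) : vnorm (x + y) ≤ vnorm x + vnorm y := by
  simpa [vnorm] using norm_add_le (WithLp.toLp 2 x) (WithLp.toLp 2 y)

theorem vnorm_smul (c : ℝ) (x : p → ℝ) : vnorm (c • x) = |c| * vnorm x := by
  simp [vnorm, norm_smul]

theorem vnorm_neg (x : p → ℝ) : vnorm (-x) = vnorm x := by
  simp [vnorm]

theorem vnorm_sub_le (x y : p → ℝ) : vnorm (x - y) ≤ vnorm x + vnorm y := by
  simpa [vnorm] using norm_sub_le (WithLp.toLp 2 x) (WithLp.toLp 2 y)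

theorem vnorm_zero : vnorm (0 : p → ℝ) = 0 := by simp [vnorm]

theorem vnorm_eq_zero {x : p → ℝ} (h : vnorm x = 0) : x = 0 := by
  simpa [vnorm] using h

variable [DecidableEq q] [DecidableEq p] [DecidableEq l]

theorem vnorm_mulVec_le (A : Matrix p q ℝ) (x : q → ℝ) : vnorm (A *ᵥ x) ≤ ‖A‖ * vnorm x :=
  Matrix.l2_opNorm_mulVec A (WithLp.toLp 2 x)

theorem opNorm_le {A : Matrix p q ℝ} {c : ℝ} (hc : 0 ≤ c)
    (h : ∀ x, vnorm (A *ᵥ x) ≤ c * vnorm x) : ‖A‖ ≤ c := by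
  rw [Matrix.l2_opNorm_def]
  refine ContinuousLinearMap.opNorm_le_bound _ hc fun x => ?_
  exact h x.ofLp

theorem opNorm_transpose (A : Matrix p q ℝ) : ‖Aᵀ‖ = ‖A‖ := by
  rw [← Matrix.conjTranspose_eq_transpose_of_trivial, Matrix.l2_opNorm_conjTranspose]

theorem opNorm_mul_le (A : Matrix p q ℝ) (B : Matrix q l ℝ) : ‖A * B‖ ≤ ‖A‖ * ‖B‖ :=
  Matrix.l2_opNorm_mul A B

theorem dotProduct_transpose_mulVec (A : Matrix p q ℝ) (x : q → ℝ) (y : p → ℝ) :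
    x ⬝ᵥ (Aᵀ *ᵥ y) = (A *ᵥ x) ⬝ᵥ y := by
  rw [Matrix.dotProduct_mulVec, Matrix.vecMul_transpose]

theorem dotProduct_mulVec_eq (A : Matrix p q ℝ) (x : p → ℝ) (y : q → ℝ) :
    x ⬝ᵥ (A *ᵥ y) = (Aᵀ *ᵥ x) ⬝ᵥ y := by
  rw [← dotProduct_transpose_mulVec, Matrix.transpose_transpose]

/-- The operator norm through bilinear forms. -/
theorem opNorm_le_of_bilinear {A : Matrix p q ℝ} {c : ℝ} (hc : 0 ≤ c)
    (h : ∀ x y, vnorm x = 1 → vnorm y = 1 → x ⬝ᵥ (A *ᵥ y) ≤ c) : ‖A‖ ≤ c := by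
  refine opNorm_le hc fun y => ?_
  rcases (vnorm_nonneg y).eq_or_lt' with hy | hy
  · rw [vnorm_eq_zero hy]; simp [vnorm_zero]
  rcases (vnorm_nonneg (A *ᵥ y)).eq_or_lt' with hx | hx
  · rw [hx]; positivity
  have h1 := h ((vnorm (A *ᵥ y))⁻¹ • (A *ᵥ y)) ((vnorm y)⁻¹ • y)
    (by rw [vnorm_smul, abs_of_pos (inv_pos.2 hx), inv_mul_cancel₀ hx.ne'])
    (by rw [vnorm_smul, abs_of_pos (inv_pos.2 hy), inv_mul_cancel₀ hy.ne'])
  rw [Matrix.mulVec_smul, smul_dotProduct, dotProduct_smul, ← vnorm_mul_self] at h1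
  simp only [smul_eq_mul] at h1
  field_simp at h1
  linarith

/-- `x ↦ ‖A x‖²` as a quadratic form. -/
theorem dotProduct_gram (A : Matrix p q ℝ) (x : q → ℝ) :
    x ⬝ᵥ ((Aᵀ * A) *ᵥ x) = vnorm (A *ᵥ x) ^ 2 := by
  rw [← Matrix.mulVec_mulVec, dotProduct_transpose_mulVec, vnorm_sq]

end Euclid

/-! ### Derivatives of matrix products -/

section Deriv

variable {p q l : Type*} [Fintype p] [Fintype q] [Fintype l]
  [DecidableEq q] [DecidableEq p] [DecidableEq l]

/-- Matrix multiplication as a continuous bilinear map. -/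
def mulCLM : Matrix p q ℝ →L[ℝ] Matrix q l ℝ →L[ℝ] Matrix p l ℝ :=
  LinearMap.mkContinuous₂
    (LinearMap.mk₂ ℝ (fun (A : Matrix p q ℝ) (B : Matrix q l ℝ) => A * B)
      Matrix.add_mul (fun c A B => Matrix.smul_mul c A B) Matrix.mul_add
      (fun c A B => Matrix.mul_smul A c B)) 1
    (fun A B => by simpa using opNorm_mul_le A B)

theorem hasDerivWithinAt_matrix_mul {A : ℝ → Matrix p q ℝ} {B : ℝ → Matrix q l ℝ}
    {A' : Matrix p q ℝ} {B' : Matrix q l ℝ} {s : Set ℝ} {t : ℝ}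
    (hA : HasDerivWithinAt A A' s t) (hB : HasDerivWithinAt B B' s t) :
    HasDerivWithinAt (fun u => A u * B u) (A' * B t + A t * B') s t := by
  have h := mulCLM.hasDerivWithinAt_of_bilinear hA hB
  rw [add_comm]
  exact h

/-- Transposition as a continuous linear map. -/
def transposeCLM : Matrix p q ℝ →L[ℝ] Matrix q p ℝ :=
  LinearMap.mkContinuous (Matrix.transposeLinearEquiv p q ℝ ℝ).toLinearMap 1
    (fun A => by simpa using (opNorm_transpose A).le)

theorem hasDerivWithinAt_transpose {A : ℝ → Matrix p q ℝ} {A' : Matrix p q ℝ} {s : Set ℝ} {t : ℝ}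
    (hA : HasDerivWithinAt A A' s t) : HasDerivWithinAt (fun u => (A u)ᵀ) A'ᵀ s t :=
  (transposeCLM (p := p) (q := q)).hasFDerivAt.comp_hasDerivWithinAt t hA

theorem hasDerivWithinAt_gram {A : ℝ → Matrix p q ℝ} {A' : Matrix p q ℝ} {s : Set ℝ} {t : ℝ}
    (hA : HasDerivWithinAt A A' s t) :
    HasDerivWithinAt (fun u => (A u)ᵀ * A u) (A'ᵀ * A t + (A t)ᵀ * A') s t :=
  hasDerivWithinAt_matrix_mul (hasDerivWithinAt_transpose hA) hA

theorem dotProduct_deriv_gram (A A' : Matrix p q ℝ) (x : q → ℝ) :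
    x ⬝ᵥ ((A'ᵀ * A + Aᵀ * A') *ᵥ x) = 2 * ((A *ᵥ x) ⬝ᵥ (A' *ᵥ x)) := by
  rw [Matrix.add_mulVec, dotProduct_add, ← Matrix.mulVec_mulVec, ← Matrix.mulVec_mulVec,
    dotProduct_transpose_mulVec, dotProduct_transpose_mulVec, dotProduct_comm (A' *ᵥ x)]
  ring

end Deriv

/-! ### Barriers -/

section Barrier

variable {p : Type*} [Fintype p] [DecidableEq p]

/-- A curve of symmetric matrices that is positive semidefinite at time `t` stays so for a short
time, provided that its right derivative is positive on the unit vectors of its kernel. This is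
what keeps quadratic forms below their barriers: only the contact directions matter. -/
theorem posSemidef_eventually {M : ℝ → Matrix p p ℝ} {M' : Matrix p p ℝ} {t : ℝ}
    (hsym : ∀ s, (M s).IsHermitian) (hderiv : HasDerivWithinAt M M' (Ici t) t)
    (hpsd : (M t).PosSemidef)
    (hpos : ∀ x : p → ℝ, vnorm x = 1 → M t *ᵥ x = 0 → 0 < x ⬝ᵥ (M' *ᵥ x)) :
    ∀ᶠ s in 𝓝[>] t, (M s).PosSemidef := by
  by_contra hcon
  rw [not_eventually] at hcon
  have hcon2 : ∃ᶠ s in 𝓝[>] t, ∃ y : EuclideanSpace ℝ p, y ∈ Metric.sphere 0 1 ∧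
      y.ofLp ⬝ᵥ (M s *ᵥ y.ofLp) < 0 := by
    refine hcon.mono fun s hs => ?_
    by_contra! h
    refine hs (Matrix.PosSemidef.of_dotProduct_mulVec_nonneg (hsym s) fun x => ?_)
    rcases eq_or_ne (vnorm x) 0 with hx | hx
    · rw [vnorm_eq_zero hx]; simp
    have hx0 : 0 < vnorm x := lt_of_le_of_ne (vnorm_nonneg x) hx.symm
    have h1 := h (WithLp.toLp 2 ((vnorm x)⁻¹ • x)) (by
      rw [mem_sphere_zero_iff_norm]
      change vnorm ((vnorm x)⁻¹ • x) = 1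
      rw [vnorm_smul, abs_of_pos (inv_pos.2 hx0), inv_mul_cancel₀ hx])
    simp only [Matrix.mulVec_smul, smul_dotProduct, dotProduct_smul, smul_eq_mul] at h1
    rw [← mul_assoc] at h1
    simpa using nonneg_of_mul_nonneg_right h1 (by positivity)
  -- Unit vectors `y k` on which the form is negative at times `u k ↓ t` accumulate at some `x`. The
  -- form vanishes at `x` at time `t`, and its difference quotients there are negative, against
  -- `hpos`.
  obtain ⟨u, hu, hu2⟩ := exists_seq_forall_of_frequently hcon2
  choose y hy hyneg using hu2
  obtain ⟨x, hx, φ, hφ, hlim⟩ := (isCompact_sphere (0 : EuclideanSpace ℝ p) 1).tendsto_subseq hy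
  have hslope : Tendsto (slope M t) (𝓝[>] t) (𝓝 M') := by
    have := hasDerivWithinAt_iff_tendsto_slope.1 hderiv
    simpa using this
  have hM : Tendsto M (𝓝[>] t) (𝓝 (M t)) :=
    (hderiv.continuousWithinAt.mono Ioi_subset_Ici_self).tendsto
  have hsub : Tendsto (u ∘ φ) atTop (𝓝[>] t) := hu.comp hφ.tendsto_atTop
  have hcont : Continuous fun z : Matrix p p ℝ × EuclideanSpace ℝ p =>
      z.2.ofLp ⬝ᵥ (z.1 *ᵥ z.2.ofLp) := by fun_prop
  have h1 := (hcont.tendsto (M t, x)).comp ((hM.comp hsub).prodMk_nhds hlim)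
  have h2 := (hcont.tendsto (M', x)).comp ((hslope.comp hsub).prodMk_nhds hlim)
  have h3 : x.ofLp ⬝ᵥ (M t *ᵥ x.ofLp) ≤ 0 :=
    le_of_tendsto h1 (Eventually.of_forall fun n => (hyneg (φ n)).le)
  have hge : ∀ z : p → ℝ, 0 ≤ z ⬝ᵥ (M t *ᵥ z) := fun z => by
    simpa using hpsd.dotProduct_mulVec_nonneg z
  have h4 : M t *ᵥ x.ofLp = 0 :=
    (hpsd.dotProduct_mulVec_zero_iff _).1 (by simpa using le_antisymm h3 (hge _))
  have h5 := hpos x.ofLp (by simpa [vnorm] using hx) h4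
  have h6 : x.ofLp ⬝ᵥ (M' *ᵥ x.ofLp) ≤ 0 := by
    refine le_of_tendsto h2 ((hsub.eventually self_mem_nhdsWithin).mono fun n hn => ?_)
    have hn' : 0 < u (φ n) - t := sub_pos.2 hn
    simp only [Function.comp_apply, slope_def_module, Matrix.smul_mulVec, dotProduct_smul,
      Matrix.sub_mulVec, dotProduct_sub, smul_eq_mul]
    have := hyneg (φ n)
    have := hge (y (φ n)).ofLp
    exact mul_nonpos_of_nonneg_of_nonpos (inv_pos.2 hn').le (by linarith)
  linarith

/-- The scalar analogue of `posSemidef_eventually`, for norms: no contact analysis is needed when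
the speed of the curve is below that of the barrier. -/
theorem norm_le_eventually {E : Type*} [NormedAddCommGroup E] [NormedSpace ℝ E] {f : ℝ → E}
    {f' : E} {a b t : ℝ} (hf : HasDerivWithinAt f f' (Ici t) t) (h : ‖f t‖ ≤ a + b * t)
    (hlt : ‖f'‖ < b) : ∀ᶠ s in 𝓝[>] t, ‖f s‖ ≤ a + b * s := by
  have hslope : Tendsto (slope f t) (𝓝[>] t) (𝓝 f') := by
    have := hasDerivWithinAt_iff_tendsto_slope.1 hf
    simpa using this
  filter_upwards [hslope.norm.eventually_lt_const hlt, self_mem_nhdsWithin] with s hs hts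
  have hts' : 0 < s - t := sub_pos.2 hts
  rw [slope_def_module, norm_smul, norm_inv, Real.norm_of_nonneg hts'.le,
    inv_mul_lt_iff₀ hts'] at hs
  have := norm_le_insert' (f s) (f t)
  nlinarith

/-- Continuous induction on `[a, b]` for conditions that persist to the right. -/
theorem forall_Icc_of_eventually {a b : ℝ} {G : ℝ → Prop}
    (hclosed : IsClosed {t | t ∈ Icc a b ∧ G t}) (h0 : G a)
    (hstep : ∀ t ∈ Ico a b, (∀ s ∈ Icc a t, G s) → ∀ᶠ s in 𝓝[>] t, G s) :
    ∀ t ∈ Icc a b, G t := by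
  have hsub : Icc a b ⊆ {t | ∀ s ∈ Icc a b, s ≤ t → G s} := by
    refine IsClosed.Icc_subset_of_forall_mem_nhdsWithin ?_ ?_ ?_
    · refine isClosed_of_closure_subset fun t ht => ?_
      have htI : t ∈ Icc a b := closure_minimal inter_subset_right isClosed_Icc ht
      refine ⟨fun s hs hst => ?_, htI⟩
      rcases hst.lt_or_eq with hlt | rfl
      · obtain ⟨u, hu1, hu2⟩ := mem_closure_iff_nhds.1 ht (Ioi s) (Ioi_mem_nhds hlt)
        exact hu2.1 s hs (le_of_lt hu1)
      · have : s ∈ closure {t | t ∈ Icc a b ∧ G t} :=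
          closure_mono (show {t | ∀ s ∈ Icc a b, s ≤ t → G s} ∩ Icc a b ⊆ {t | t ∈ Icc a b ∧ G t}
            from fun u hu => ⟨hu.2, hu.1 u hu.2 le_rfl⟩) ht
        rw [hclosed.closure_eq] at this
        exact this.2
    · intro s hs hsa
      rwa [le_antisymm hsa hs.1]
    · intro t ht0
      have ht : ∀ s ∈ Icc a b, s ≤ t → G s := ht0.1
      have htI := ht0.2
      have h1 := hstep t htI fun s hs => ht s ⟨hs.1, hs.2.trans htI.2.le⟩ hs.2
      obtain ⟨u, hu, hu2⟩ := mem_nhdsGT_iff_exists_Ioo_subset.1 (show {s | G s} ∈ 𝓝[>] t from h1)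
      refine mem_nhdsGT_iff_exists_Ioo_subset.2 ⟨u, hu, fun v hv s hs hsv => ?_⟩
      rcases le_or_gt s t with h | h
      · exact ht s hs h
      · exact hu2 ⟨h, hsv.trans_lt hv.2⟩
  exact fun t ht => hsub ht t ht le_rfl

end Barrier

/-! ### The matrix logarithm near the identity -/

section Log

variable {ι : Type*} [Fintype ι] [DecidableEq ι] [Nonempty ι]

theorem abs_log_one_add_sub_le {x : ℝ} (hx : |x| ≤ 1 / 4) : |Real.log (1 + x) - x| ≤ x ^ 2 := by
  have h := Real.abs_log_sub_add_sum_range_le (x := -x) (by rw [abs_neg]; linarith) 2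
  simp only [Finset.sum_range_succ, Finset.sum_range_zero, abs_neg, sub_neg_eq_add] at h
  have h2 : |x| ^ (2 + 1) / (1 - |x|) ≤ x ^ 2 / 3 := by
    rw [div_le_iff₀ (by linarith), ← sq_abs x]
    nlinarith [mul_nonneg (sq_nonneg |x|) (sub_nonneg.2 hx)]
  have h3 := h.trans h2
  push_cast at h3
  rw [abs_le] at h3 ⊢
  constructor <;> nlinarith [sq_nonneg x]

theorem abs_sub_one_le_of_mem_spectrum {H : Matrix ι ι ℝ} {z : ℝ}
    (hz : z ∈ spectrum ℝ (1 + H)) : |z - 1| ≤ ‖H‖ := by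
  have h : z - 1 ∈ spectrum ℝ H := by
    rw [spectrum.mem_iff] at hz ⊢
    rwa [map_sub, map_one, sub_sub]
  have := spectrum.norm_le_norm_of_mem h
  rwa [Real.norm_eq_abs] at this

/-- The eigenvalues of `1 + H` are positive, so there the real logarithm inverts the exponential. -/
theorem exp_log_one_add {H : Matrix ι ι ℝ} (hH : H.IsHermitian) (h : ‖H‖ < 1) :
    NormedSpace.exp (CFC.log (1 + H)) = 1 + H := by
  have hs : IsSelfAdjoint (1 + H) := (Matrix.isHermitian_one.add hH)
  have hpos : ∀ z ∈ spectrum ℝ (1 + H), 0 < z := fun z hz => by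
    have := abs_le.1 (abs_sub_one_le_of_mem_spectrum hz)
    linarith
  have hcont : ContinuousOn Real.log (spectrum ℝ (1 + H)) :=
    Real.continuousOn_log.mono fun z hz => (hpos z hz).ne'
  rw [CFC.log, ← CFC.real_exp_eq_normedSpace_exp (cfc_predicate _ _),
    ← cfc_comp Real.exp Real.log (1 + H) hs Real.continuous_exp.continuousOn hcont]
  conv_rhs => rw [← cfc_id ℝ (1 + H) hs]
  exact cfc_congr fun z hz => Real.exp_log (hpos z hz)

/-- The scalar estimate `abs_log_one_add_sub_le`, applied to the eigenvalues of `H`. -/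
theorem norm_log_one_add_sub_le {H : Matrix ι ι ℝ} (hH : H.IsHermitian) (h : ‖H‖ ≤ 1 / 4) :
    ‖CFC.log (1 + H) - H‖ ≤ ‖H‖ ^ 2 := by
  have hs : IsSelfAdjoint (1 + H) := (Matrix.isHermitian_one.add hH)
  have hcont : ContinuousOn Real.log (spectrum ℝ (1 + H)) :=
    Real.continuousOn_log.mono fun z hz hz0 => by
      have := abs_le.1 (abs_sub_one_le_of_mem_spectrum hz)
      simp only [mem_singleton_iff] at hz0
      linarith
  have hH2 : CFC.log (1 + H) - H = cfc (fun z => Real.log z - (z - 1)) (1 + H) := by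
    rw [cfc_sub (fun z => Real.log z) (fun z => z - 1) (1 + H) hcont (by fun_prop),
      cfc_sub (fun z : ℝ => z) (fun _ => (1 : ℝ)) (1 + H) (by fun_prop) (by fun_prop),
      cfc_id' ℝ (1 + H) hs, cfc_const_one ℝ (1 + H) hs, CFC.log, add_sub_cancel_left]
  rw [hH2]
  refine norm_cfc_le (by positivity) fun z hz => ?_
  have hz1 := abs_sub_one_le_of_mem_spectrum hz
  have := abs_log_one_add_sub_le (x := z - 1) (hz1.trans h)
  rw [add_sub_cancel] at this
  rw [Real.norm_eq_abs]
  refine this.trans ?_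
  rw [← sq_abs (z - 1)]
  gcongr

end Log

/-! ### Piecewise linear flows -/

section LinearFlow

variable {ι h : Type*} [Fintype ι] [DecidableEq ι] [Fintype h] [DecidableEq h]

theorem hasDerivAt_exp_mul (M : Matrix ι ι ℝ) (Z : Matrix ι h ℝ) (a t : ℝ) :
    HasDerivAt (fun u => NormedSpace.exp ((u - a) • M) * Z)
      (M * (NormedSpace.exp ((t - a) • M) * Z)) t := by
  have h1 : HasDerivAt (fun u : ℝ => NormedSpace.exp ((u - a) • M))
      (M * NormedSpace.exp ((t - a) • M)) t := by
    have := (hasDerivAt_exp_smul_const' M (t - a)).scomp t ((hasDerivAt_id t).sub_const a)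
    rw [one_smul] at this
    exact this
  have h2 := hasDerivWithinAt_matrix_mul h1.hasDerivWithinAt (hasDerivWithinAt_const t univ Z)
  rw [hasDerivWithinAt_univ] at h2
  simpa [Matrix.mul_assoc] using h2

/-- A curve with right derivative `M * W` is an exponential: `exp (-(t - a) M) W` is constant. Only
one-sided derivatives are available, since the generator of the flow jumps between time steps. -/
theorem eq_exp_mul_of_hasDerivWithinAt {M : Matrix ι ι ℝ} {W : ℝ → Matrix ι h ℝ} {a b : ℝ}
    (hcont : ContinuousOn W (Icc a b))
    (hderiv : ∀ t ∈ Ico a b, HasDerivWithinAt W (M * W t) (Ici t) t) :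
    ∀ t ∈ Icc a b, W t = NormedSpace.exp ((t - a) • M) * W a := by
  intro t ht
  have hexp : ∀ u : ℝ, HasDerivAt (fun u => NormedSpace.exp ((u - a) • (-M)))
      (NormedSpace.exp ((u - a) • (-M)) * (-M)) u := fun u => by
    have := (hasDerivAt_exp_smul_const (-M) (u - a)).scomp u ((hasDerivAt_id u).sub_const a)
    rw [one_smul] at this
    exact this
  have hc : ContinuousOn (fun u => NormedSpace.exp ((u - a) • (-M)) * W u) (Icc a b) := by
    have h1 : Continuous (fun u : ℝ => NormedSpace.exp ((u - a) • (-M))) :=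
      continuous_iff_continuousAt.2 fun u => (hexp u).continuousAt
    have h2 : Continuous fun z : Matrix ι ι ℝ × Matrix ι h ℝ => z.1 * z.2 := by fun_prop
    exact h2.comp_continuousOn (h1.continuousOn.prodMk hcont)
  have h0 := constant_of_has_deriv_right_zero hc (fun u hu => by
    have := hasDerivWithinAt_matrix_mul (hexp u).hasDerivWithinAt (hderiv u hu)
    rw [← Matrix.mul_assoc, ← Matrix.add_mul, Matrix.mul_neg, neg_add_cancel,
      Matrix.zero_mul] at this
    exact this) t ht
  simp only [sub_self, zero_smul, NormedSpace.exp_zero, Matrix.one_mul] at h0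
  have hcomm : Commute ((t - a) • M) (-((t - a) • M)) := (Commute.refl _).neg_right
  rw [← h0, ← Matrix.mul_assoc, smul_neg, ← Matrix.exp_add_of_commute _ _ hcomm,
    add_neg_cancel, NormedSpace.exp_zero, Matrix.one_mul]

/-- The knots of the flow whose generator is `F (W (k η))` on `[k η, (k + 1) η)`. -/
def knot (F : Matrix ι h ℝ → Matrix ι ι ℝ) (η : ℝ) (W₀ : Matrix ι h ℝ) : ℕ → Matrix ι h ℝ
  | 0 => W₀
  | k + 1 => NormedSpace.exp (η • F (knot F η W₀ k)) * knot F η W₀ k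

/-- The flow whose generator is `F (W (k η))` on `[k η, (k + 1) η)`. -/
def stepFlow (F : Matrix ι h ℝ → Matrix ι ι ℝ) (η : ℝ) (W₀ : Matrix ι h ℝ) (t : ℝ) :
    Matrix ι h ℝ :=
  NormedSpace.exp ((t - ⌊t / η⌋₊ * η) • F (knot F η W₀ ⌊t / η⌋₊)) * knot F η W₀ ⌊t / η⌋₊

variable {F : Matrix ι h ℝ → Matrix ι ι ℝ} {η : ℝ} {W₀ : Matrix ι h ℝ}

theorem floor_div_eq (hη : 0 < η) {k : ℕ} {t : ℝ} (h1 : k * η ≤ t) (h2 : t < (k + 1) * η) :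
    ⌊t / η⌋₊ = k := by
  rw [Nat.floor_eq_iff (div_nonneg (le_trans (by positivity) h1) hη.le), le_div_iff₀ hη,
    div_lt_iff₀ hη]
  exact ⟨h1, h2⟩

theorem floor_mul_div (hη : 0 < η) (k : ℕ) : ⌊k * η / η⌋₊ = k := by
  rw [mul_div_cancel_right₀ _ hη.ne', Nat.floor_natCast]

theorem floor_div_mul_le (hη : 0 < η) {t : ℝ} (ht : 0 ≤ t) : ⌊t / η⌋₊ * η ≤ t :=
  (le_div_iff₀ hη).1 (Nat.floor_le (div_nonneg ht hη.le))

theorem lt_floor_div_add_one_mul (hη : 0 < η) (t : ℝ) : t < (⌊t / η⌋₊ + 1) * η :=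
  (div_lt_iff₀ hη).1 (Nat.lt_floor_add_one _)

theorem stepFlow_knot (hη : 0 < η) (k : ℕ) : stepFlow F η W₀ (k * η) = knot F η W₀ k := by
  rw [stepFlow, floor_mul_div hη]
  simp

theorem stepFlow_eq (hη : 0 < η) (k : ℕ) {t : ℝ} (ht : t ∈ Icc (k * η) ((k + 1) * η)) :
    stepFlow F η W₀ t =
      NormedSpace.exp ((t - k * η) • F (knot F η W₀ k)) * knot F η W₀ k := by
  rcases ht.2.lt_or_eq with h | h
  · rw [stepFlow, floor_div_eq hη ht.1 h]
  · have := stepFlow_knot (F := F) (W₀ := W₀) hη (k + 1)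
    push_cast at this
    rw [h, this, knot, add_mul, one_mul, add_sub_cancel_left]

theorem hasDerivWithinAt_stepFlow (hη : 0 < η) {t : ℝ} (ht : 0 ≤ t) :
    HasDerivWithinAt (stepFlow F η W₀) (F (stepFlow F η W₀ (⌊t / η⌋₊ * η)) * stepFlow F η W₀ t)
      (Ici t) t := by
  set k := ⌊t / η⌋₊ with hk
  have h1 := floor_div_mul_le hη ht
  have h2 := lt_floor_div_add_one_mul hη t
  rw [← hk] at h1 h2
  rw [stepFlow_knot hη, stepFlow_eq hη k ⟨h1, h2.le⟩]
  refine (hasDerivAt_exp_mul _ _ _ t).hasDerivWithinAt.congr_of_eventuallyEq ?_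
    (stepFlow_eq hη k ⟨h1, h2.le⟩)
  filter_upwards [Icc_mem_nhdsGE h2] with s hs
  exact stepFlow_eq hη k ⟨h1.trans hs.1, hs.2⟩

theorem continuousOn_stepFlow (hη : 0 < η) : ContinuousOn (stepFlow F η W₀) (Ici 0) := by
  have hpiece : ∀ k : ℕ, ContinuousOn (stepFlow F η W₀) (Icc (k * η) ((k + 1) * η)) := fun k =>
    ContinuousOn.congr (f := fun t => NormedSpace.exp ((t - k * η) • F (knot F η W₀ k)) *
      knot F η W₀ k)
      (fun t _ => (hasDerivAt_exp_mul _ _ _ t).continuousAt.continuousWithinAt)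
      (fun t ht => stepFlow_eq hη k ht)
  have hind : ∀ k : ℕ, ContinuousOn (stepFlow F η W₀) (Icc 0 (k * η)) := fun k => by
    induction k with
    | zero => simp
    | succ k ih =>
      have := ih.union_of_isClosed (hpiece k) isClosed_Icc isClosed_Icc
      push_cast
      rwa [Icc_union_Icc_eq_Icc (by positivity) (by nlinarith)] at this
  intro t ht
  obtain ⟨k, hk⟩ := exists_nat_gt (t / η)
  have hk' : t < k * η := (div_lt_iff₀ hη).1 hk
  refine (hind k t ⟨ht, hk'.le⟩).mono_of_mem_nhdsWithin ?_
  filter_upwards [self_mem_nhdsWithin, mem_nhdsWithin_of_mem_nhds (Iic_mem_nhds hk')] with u h1 h2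
  exact ⟨h1, h2⟩

end LinearFlow

/-! ### Singular values -/

section SingularValues

open Module

/-- The first half of the min-max principle: on the span of the first `r` right singular vectors,
parametrized isometrically by `φ`, the operator stretches by at least the `r`-th singular value. -/
theorem exists_isometry_singularValues {E F : Type*} [NormedAddCommGroup E] [InnerProductSpace ℝ E]
    [FiniteDimensional ℝ E] [NormedAddCommGroup F] [InnerProductSpace ℝ F] [FiniteDimensional ℝ F]
    (S : E →ₗ[ℝ] F) {r : ℕ} (hr : r ≤ finrank ℝ E) (hr1 : 1 ≤ r) :
    ∃ φ : EuclideanSpace ℝ (Fin r) →ₗ[ℝ] E, (∀ z, ‖φ z‖ = ‖z‖) ∧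
      ∀ z, S.singularValues (r - 1) * ‖z‖ ≤ ‖S (φ z)‖ := by
  set hT := S.isSymmetric_adjoint_comp_self with hTdef
  let b := hT.eigenvectorBasis rfl
  let e : Fin r → E := fun j => b (Fin.castLE hr j)
  have he : Orthonormal ℝ e := b.orthonormal.comp _ (Fin.castLE_injective hr)
  let φ : EuclideanSpace ℝ (Fin r) →ₗ[ℝ] E :=
    (Fintype.linearCombination ℝ e).comp (WithLp.linearEquiv 2 ℝ (Fin r → ℝ)).toLinearMap
  have hφ : ∀ z, φ z = ∑ j, z.ofLp j • e j := fun z => by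
    simp [φ, Fintype.linearCombination_apply]
  have hnorm : ∀ z, ‖φ z‖ ^ 2 = ∑ j, z.ofLp j ^ 2 := fun z => by
    rw [hφ, ← real_inner_self_eq_norm_sq, he.inner_sum]
    simp [sq]
  have hμ : ∀ j : Fin r, S.singularValues (r - 1) ^ 2 ≤
      hT.eigenvalues rfl (Fin.castLE hr j) := fun j => by
    rw [S.sq_singularValues_of_lt rfl (by omega)]
    exact hT.eigenvalues_antitone rfl (by rw [Fin.le_def]; simp; omega)
  have hS : ∀ z, ‖S (φ z)‖ ^ 2 = ∑ j, hT.eigenvalues rfl (Fin.castLE hr j) * z.ofLp j ^ 2 :=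
    fun z => by
    have h1 : (LinearMap.adjoint S ∘ₗ S) (φ z) =
        ∑ j, (hT.eigenvalues rfl (Fin.castLE hr j) * z.ofLp j) • e j := by
      rw [hφ, map_sum]
      refine Finset.sum_congr rfl fun j _ => ?_
      rw [map_smul]
      have := hT.apply_eigenvectorBasis rfl (Fin.castLE hr j)
      simp only [e, b]
      rw [this]
      simp [smul_smul, mul_comm]
    rw [← real_inner_self_eq_norm_sq, ← LinearMap.adjoint_inner_right,
      ← LinearMap.comp_apply, h1, hφ, he.inner_sum]
    simp only [conj_trivial]
    exact Finset.sum_congr rfl fun j _ => by ring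
  have hz : ∀ z : EuclideanSpace ℝ (Fin r), ‖z‖ ^ 2 = ∑ j, z.ofLp j ^ 2 := fun z => by
    simp [EuclideanSpace.norm_sq_eq]
  refine ⟨φ, fun z => ?_, fun z => ?_⟩
  · rw [← sq_eq_sq₀ (norm_nonneg _) (norm_nonneg _), hnorm, hz]
  · rw [← sq_le_sq₀ (mul_nonneg (S.singularValues_nonneg _) (norm_nonneg _)) (norm_nonneg _),
      mul_pow, hS, hz, Finset.mul_sum]
    exact Finset.sum_le_sum fun j _ => mul_le_mul_of_nonneg_right (hμ j) (sq_nonneg _)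

/-- A matrix with `r` rows whose `r`-th singular value is positive has a transpose that is bounded
below. -/
theorem sv_mul_vnorm_le {r h : ℕ} (hr : 1 ≤ r) (A : Matrix (Fin r) (Fin h) ℝ)
    (hpos : 0 < sv r A) (u : Fin r → ℝ) : sv r A * vnorm u ≤ vnorm (Aᵀ *ᵥ u) := by
  have hrh : r ≤ finrank ℝ (EuclideanSpace ℝ (Fin h)) := by
    by_contra! hlt
    rw [sv, LinearMap.singularValues_of_finrank_le _ (by omega)] at hpos
    exact lt_irrefl _ hpos
  obtain ⟨φ, h1, h2⟩ := exists_isometry_singularValues (Matrix.toEuclideanLin A) hrh hr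
  have hinj : Function.Injective ((Matrix.toEuclideanLin A).comp φ) := by
    rw [← LinearMap.ker_eq_bot, LinearMap.ker_eq_bot']
    intro z hz
    have := h2 z
    rw [← LinearMap.comp_apply, hz, norm_zero] at this
    exact norm_eq_zero.1 (le_antisymm (nonpos_of_mul_nonpos_right this hpos) (norm_nonneg _))
  obtain ⟨z, hz⟩ := LinearMap.surjective_of_injective hinj (WithLp.toLp 2 u)
  have hz' : A *ᵥ (φ z).ofLp = u := congrArg WithLp.ofLp hz
  have h3 := h2 z
  rw [← LinearMap.comp_apply, hz] at h3
  have h4 : vnorm u * vnorm u ≤ vnorm (Aᵀ *ᵥ u) * ‖z‖ := by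
    have := dotProduct_le (Aᵀ *ᵥ u) (φ z).ofLp
    rw [← dotProduct_mulVec_eq, hz', ← vnorm_mul_self] at this
    rwa [show vnorm (φ z).ofLp = ‖z‖ from h1 z] at this
  have h5 : sv r A * ‖z‖ ≤ vnorm u := h3
  rcases (vnorm_nonneg u).eq_or_lt' with hu | hu
  · rw [hu, mul_zero]; exact vnorm_nonneg _
  · refine le_of_mul_le_mul_right ?_ hu
    calc sv r A * vnorm u * vnorm u = sv r A * (vnorm u * vnorm u) := by ring
      _ ≤ sv r A * (vnorm (Aᵀ *ᵥ u) * ‖z‖) := by gcongr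
      _ = vnorm (Aᵀ *ᵥ u) * (sv r A * ‖z‖) := by ring
      _ ≤ vnorm (Aᵀ *ᵥ u) * vnorm u := by
        gcongr
        exact vnorm_nonneg _

theorem vnorm_mulVec_of_orthonormal {p q : Type*} [Fintype p] [Fintype q] [DecidableEq p]
    [DecidableEq q] {P : Matrix p q ℝ} (hP : Pᵀ * P = 1) (x : q → ℝ) : vnorm (P *ᵥ x) = vnorm x := by
  rw [← sq_eq_sq₀ (vnorm_nonneg _) (vnorm_nonneg _), ← dotProduct_gram, hP, Matrix.one_mulVec,
    vnorm_sq]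

theorem vnorm_transpose_mulVec_le {p q : Type*} [Fintype p] [Fintype q] [DecidableEq q]
    [DecidableEq p] {P : Matrix p q ℝ} (hP : Pᵀ * P = 1) (x : p → ℝ) :
    vnorm (Pᵀ *ᵥ x) ≤ vnorm x := by
  refine (vnorm_mulVec_le _ _).trans ?_
  have : ‖Pᵀ‖ ≤ 1 := by
    rw [opNorm_transpose]
    exact opNorm_le zero_le_one fun y => by rw [vnorm_mulVec_of_orthonormal hP, one_mul]
  nlinarith [vnorm_nonneg x]

theorem vnorm_single {q : Type*} [Fintype q] [DecidableEq q] (i : q) :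
    vnorm (Pi.single i 1 : q → ℝ) = 1 := by
  rw [← sq_eq_sq₀ (vnorm_nonneg _) zero_le_one, vnorm_sq]
  simp

variable {m n r : ℕ} {Y : Matrix (Fin m) (Fin n) ℝ} {P : Matrix (Fin m) (Fin r) ℝ}
  {s : Fin r → ℝ} {Q : Matrix (Fin n) (Fin r) ℝ}

theorem IsCompactSVD.mulVec (hY : IsCompactSVD Y P s Q) (x : Fin n → ℝ) :
    Y *ᵥ x = P *ᵥ (Matrix.diagonal s *ᵥ (Qᵀ *ᵥ x)) := by
  rw [hY.eq]; simp [Matrix.mulVec_mulVec, Matrix.mul_assoc]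

theorem card_le_of_orthonormal {p q : ℕ} {P : Matrix (Fin p) (Fin q) ℝ} (hP : Pᵀ * P = 1) :
    q ≤ p := by
  have h1 := Matrix.rank_mul_le_right Pᵀ P
  rw [hP, Matrix.rank_one] at h1
  simpa using h1.trans (Matrix.rank_le_height P)

theorem IsCompactSVD.rank_le (hY : IsCompactSVD Y P s Q) : Y.rank ≤ r := by
  rw [hY.eq]
  exact (Matrix.rank_mul_le_left _ _).trans
    ((Matrix.rank_mul_le_left _ _).trans (by simpa using Matrix.rank_le_width P))

/-- A singular value decomposition exhibits singular values: at most `s i` on the right singular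
vector with index `i`. -/
theorem IsCompactSVD.sv_le (hY : IsCompactSVD Y P s Q) (hr : 1 ≤ r) (i : Fin r) :
    sv r Y ≤ s i := by
  rcases (show 0 ≤ sv r Y from LinearMap.singularValues_nonneg _ _).eq_or_lt with h0 | h0
  · rw [← h0]; exact (hY.pos i).le
  have hrn : r ≤ finrank ℝ (EuclideanSpace ℝ (Fin n)) := by
    simpa using card_le_of_orthonormal hY.right
  obtain ⟨φ, h1, h2⟩ := exists_isometry_singularValues (Matrix.toEuclideanLin Y) hrn hr
  have hYn : ∀ x : EuclideanSpace ℝ (Fin n), ‖Matrix.toEuclideanLin Y x‖ =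
      vnorm (Matrix.diagonal s *ᵥ (Qᵀ *ᵥ x.ofLp)) := fun x => by
    change vnorm (Y *ᵥ x.ofLp) = _
    rw [hY.mulVec, vnorm_mulVec_of_orthonormal hY.left]
  have hinj : Function.Injective ((Matrix.toEuclideanLin Qᵀ).comp φ) := by
    rw [← LinearMap.ker_eq_bot, LinearMap.ker_eq_bot']
    intro z hz
    have hz' : Qᵀ *ᵥ (φ z).ofLp = 0 := congrArg WithLp.ofLp hz
    have := h2 z
    rw [hYn, hz', Matrix.mulVec_zero, vnorm_zero] at this
    exact norm_eq_zero.1 (le_antisymm (nonpos_of_mul_nonpos_right this h0) (norm_nonneg _))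
  obtain ⟨z, hz⟩ := LinearMap.surjective_of_injective hinj (WithLp.toLp 2 (Pi.single i 1))
  have hz' : Qᵀ *ᵥ (φ z).ofLp = Pi.single i 1 := congrArg WithLp.ofLp hz
  have h3 := h2 z
  have h4 : Matrix.diagonal s *ᵥ (Pi.single i 1) = s i • (Pi.single i 1 : Fin r → ℝ) := by
    ext j
    rcases eq_or_ne j i with rfl | hj <;> simp [*]
  rw [hYn, hz', h4, vnorm_smul, abs_of_pos (hY.pos i), vnorm_single, mul_one] at h3
  have h5 : 1 ≤ ‖z‖ := by
    have := vnorm_transpose_mulVec_le hY.right (φ z).ofLp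
    rw [hz', vnorm_single] at this
    exact this.trans_eq (h1 z)
  exact le_trans (le_mul_of_one_le_right h0.le h5) h3

theorem IsCompactSVD.sv_pos (hY : IsCompactSVD Y P s Q) (hr : 1 ≤ r) : 0 < sv r Y := by
  rw [sv, LinearMap.singularValues_pos_iff_lt_finrank_range]
  have hinj : Function.Injective ((Matrix.toEuclideanLin Y).comp (Matrix.toEuclideanLin Q)) := by
    rw [← LinearMap.ker_eq_bot, LinearMap.ker_eq_bot']
    intro z hz
    have hz' : Y *ᵥ (Q *ᵥ z.ofLp) = 0 := congrArg WithLp.ofLp hz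
    have h1 : vnorm (Y *ᵥ (Q *ᵥ z.ofLp)) = 0 := by rw [hz', vnorm_zero]
    rw [hY.mulVec, vnorm_mulVec_of_orthonormal hY.left, Matrix.mulVec_mulVec z.ofLp, hY.right,
      Matrix.one_mulVec] at h1
    ext j
    have h2 := congrFun (vnorm_eq_zero h1) j
    rw [Matrix.mulVec_diagonal] at h2
    simpa [(hY.pos j).ne'] using h2
  have h1 := LinearMap.finrank_range_of_inj hinj
  rw [finrank_euclideanSpace_fin] at h1
  have h2 := Submodule.finrank_mono (LinearMap.range_comp_le_range (Matrix.toEuclideanLin Q)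
    (Matrix.toEuclideanLin Y))
  omega

theorem IsCompactSVD.le_opNorm (hY : IsCompactSVD Y P s Q) (i : Fin r) : s i ≤ ‖Y‖ := by
  have h := vnorm_mulVec_le Y (Q *ᵥ Pi.single i 1)
  have h4 : Matrix.diagonal s *ᵥ (Pi.single i 1) = s i • (Pi.single i 1 : Fin r → ℝ) := by
    ext j
    rcases eq_or_ne j i with rfl | hj <;> simp [*]
  rwa [hY.mulVec, vnorm_mulVec_of_orthonormal hY.left, Matrix.mulVec_mulVec (Pi.single i 1),
    hY.right, Matrix.one_mulVec, vnorm_mulVec_of_orthonormal hY.right, h4, vnorm_smul,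
    abs_of_pos (hY.pos i), vnorm_single, mul_one, mul_one] at h

end SingularValues

/-! ### Rank splittings and the Frobenius norm -/

section Rank

variable {p q : Type*} [Fintype p] [Fintype q] [DecidableEq p] [DecidableEq q]

theorem rank_add_le (A B : Matrix p q ℝ) : (A + B).rank ≤ A.rank + B.rank := by
  unfold Matrix.rank
  refine le_trans (Submodule.finrank_mono ?_) (Submodule.finrank_add_le_finrank_add_finrank _ _)
  rintro _ ⟨x, rfl⟩
  rw [Matrix.mulVecLin_add, LinearMap.add_apply]
  exact Submodule.add_mem_sup ⟨x, rfl⟩ ⟨x, rfl⟩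

/-- Orthogonal projections onto spans of right singular vectors: the set `N` collects those with
nonzero singular value. -/
theorem exists_spectral_projections (X : Matrix p q ℝ) :
    ∃ (proj : Finset q → Matrix q q ℝ) (N : Finset q), N.card = X.rank ∧
      (∀ S, ‖proj S‖ ≤ 1) ∧ (∀ S, (proj S).rank ≤ S.card) ∧ (∀ S, (proj S)ᵀ = proj S) ∧
      (∀ S, proj S * proj S = proj S) ∧ (∀ S, proj S + proj Sᶜ = 1) ∧
      (∀ S T, Disjoint S T → proj (S ∪ T) = proj S + proj T) ∧ X * proj Nᶜ = 0 := by
  obtain ⟨U, lam, hUU, hspec, hcard⟩ : ∃ (U : Matrix q q ℝ) (lam : q → ℝ), Uᵀ * U = 1 ∧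
      Xᵀ * X = U * Matrix.diagonal lam * Uᵀ ∧
      X.rank = (Finset.univ.filter fun i => lam i ≠ 0).card := by
    have hH : (Xᵀ * X).IsHermitian := by
      have := Matrix.isHermitian_conjTranspose_mul_self X
      rwa [Matrix.conjTranspose_eq_transpose_of_trivial] at this
    refine ⟨hH.eigenvectorUnitary.1, hH.eigenvalues, ?_, ?_, ?_⟩
    · have := Unitary.coe_star_mul_self hH.eigenvectorUnitary
      rwa [Matrix.star_eq_conjTranspose, Matrix.conjTranspose_eq_transpose_of_trivial] at this
    · have := hH.spectral_theorem
      rw [Unitary.conjStarAlgAut_apply, Matrix.star_eq_conjTranspose,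
        Matrix.conjTranspose_eq_transpose_of_trivial] at this
      exact this
    · have h1 := hH.rank_eq_card_non_zero_eigs
      rw [Fintype.card_subtype] at h1
      rw [← h1, ← Matrix.conjTranspose_eq_transpose_of_trivial,
        Matrix.rank_conjTranspose_mul_self]
  have hUU' : U * Uᵀ = 1 := mul_eq_one_comm.1 hUU
  let d : Finset q → Matrix q q ℝ := fun S => Matrix.diagonal fun i => if i ∈ S then 1 else 0
  have hd : ∀ S, d S * d S = d S := fun S => by simp [d, Matrix.diagonal_mul_diagonal]
  have hid : ∀ S, U * d S * Uᵀ * (U * d S * Uᵀ) = U * d S * Uᵀ := fun S => by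
    calc U * d S * Uᵀ * (U * d S * Uᵀ) = U * d S * (Uᵀ * U) * d S * Uᵀ := by
          simp only [Matrix.mul_assoc]
      _ = U * d S * Uᵀ := by rw [hUU, Matrix.mul_one, Matrix.mul_assoc U, hd]
  have htr : ∀ S, (U * d S * Uᵀ)ᵀ = U * d S * Uᵀ := fun S => by
    simp [d, Matrix.transpose_mul, Matrix.mul_assoc]
  have hker : ∀ S, Matrix.diagonal lam * d S = 0 → X * (U * d S * Uᵀ) = 0 := by
    intro S h0
    rw [← Matrix.conjTranspose_mul_self_eq_zero, Matrix.conjTranspose_eq_transpose_of_trivial,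
      Matrix.transpose_mul, htr]
    calc U * d S * Uᵀ * Xᵀ * (X * (U * d S * Uᵀ))
        = U * d S * Uᵀ * (Xᵀ * X) * (U * d S * Uᵀ) := by simp only [Matrix.mul_assoc]
      _ = U * d S * (Uᵀ * U) * Matrix.diagonal lam * (Uᵀ * U) * d S * Uᵀ := by
        rw [hspec]; simp only [Matrix.mul_assoc]
      _ = 0 := by
        rw [hUU, Matrix.mul_one, Matrix.mul_one, Matrix.mul_assoc (U * d S), h0]
        simp
  refine ⟨fun S => U * d S * Uᵀ, Finset.univ.filter fun i => lam i ≠ 0, hcard.symm, ?_, ?_,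
    htr, hid, ?_, ?_, ?_⟩
  · intro S
    refine opNorm_le zero_le_one fun x => ?_
    rw [one_mul]
    have h1 : vnorm ((U * d S * Uᵀ) *ᵥ x) ^ 2 ≤ vnorm ((U * d S * Uᵀ) *ᵥ x) * vnorm x := by
      rw [← dotProduct_gram, htr, hid, mul_comm]
      exact dotProduct_le _ _
    rcases (vnorm_nonneg ((U * d S * Uᵀ) *ᵥ x)).eq_or_lt' with h0 | h0
    · rw [h0]; exact vnorm_nonneg x
    · exact le_of_mul_le_mul_left (by rwa [← sq]) h0
  · intro S
    refine (Matrix.rank_mul_le_left _ _).trans ((Matrix.rank_mul_le_right _ _).trans ?_)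
    simp only [d, Matrix.rank_diagonal]
    rw [Fintype.card_subtype]
    simp
  · intro S
    rw [← Matrix.add_mul, ← Matrix.mul_add]
    have : d S + d Sᶜ = 1 := by
      rw [← Matrix.diagonal_one, Matrix.diagonal_add]
      congr 1; ext i
      by_cases hi : i ∈ S <;> simp [hi]
    rw [this, Matrix.mul_one, hUU']
  · intro S T hST
    have : d (S ∪ T) = d S + d T := by
      simp only [d, Matrix.diagonal_add]
      congr 1; ext i
      by_cases hi : i ∈ S
      · simp [hi, Finset.disjoint_left.1 hST hi]
      · simp [hi]
    rw [← Matrix.add_mul, ← Matrix.mul_add, ← this]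
  · refine hker _ ?_
    have : (fun i => lam i * if i ∈ (Finset.univ.filter fun i => lam i ≠ 0)ᶜ then 1 else 0) = 0 := by
      ext i
      by_cases hi : lam i = 0 <;> simp [hi]
    rw [Matrix.diagonal_mul_diagonal, this]
    exact Matrix.diagonal_zero

/-- A matrix of rank at most `a + b` is a sum of matrices of rank at most `a` and `b`, neither of
them larger in operator norm: distribute the right singular vectors. -/
theorem exists_rank_split (X : Matrix p q ℝ) {a b : ℕ} (h : X.rank ≤ a + b) :
    ∃ X₁ X₂ : Matrix p q ℝ, X = X₁ + X₂ ∧ X₁.rank ≤ a ∧ X₂.rank ≤ b ∧ ‖X₁‖ ≤ ‖X‖ ∧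
      ‖X₂‖ ≤ ‖X‖ := by
  obtain ⟨proj, N, hN, hnorm, hrank, -, -, hcompl, hunion, hker⟩ := exists_spectral_projections X
  obtain ⟨S, hSN, hS⟩ := Finset.exists_subset_card_eq (min_le_right a N.card)
  have hn : ∀ S, ‖X * proj S‖ ≤ ‖X‖ := fun S =>
    (opNorm_mul_le _ _).trans (mul_le_of_le_one_right (norm_nonneg _) (hnorm S))
  refine ⟨X * proj S, X * proj (N \ S), ?_, ?_, ?_, hn _, hn _⟩
  · rw [← Matrix.mul_add, ← hunion _ _ Finset.disjoint_sdiff, Finset.union_sdiff_of_subset hSN]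
    have := congrArg (X * ·) (hcompl N)
    simp only [Matrix.mul_add, hker, add_zero, Matrix.mul_one] at this
    exact this.symm
  · exact (Matrix.rank_mul_le_right _ _).trans ((hrank S).trans (by omega))
  · refine (Matrix.rank_mul_le_right _ _).trans ((hrank _).trans ?_)
    rw [Finset.card_sdiff_of_subset hSN]
    omega

theorem frobSq_eq_trace (X : Matrix p q ℝ) : frobSq X = (Xᵀ * X).trace := by
  simp only [frobSq, Matrix.trace, Matrix.diag_apply, Matrix.mul_apply, Matrix.transpose_apply]
  rw [Finset.sum_comm]
  simp [sq]

theorem frobSq_nonneg (X : Matrix p q ℝ) : 0 ≤ frobSq X :=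
  Finset.sum_nonneg fun _ _ => Finset.sum_nonneg fun _ _ => sq_nonneg _

theorem eq_zero_of_frobSq_eq_zero {X : Matrix p q ℝ} (h : frobSq X = 0) : X = 0 := by
  rw [frobSq_eq_trace] at h
  have := Matrix.trace_conjTranspose_mul_self_eq_zero_iff (A := X)
  rw [Matrix.conjTranspose_eq_transpose_of_trivial] at this
  exact this.1 h

/-- The squared Frobenius norm is the sum of the eigenvalues of `Xᵀ X`, of which `X.rank` are
nonzero. -/
theorem frobSq_le (X : Matrix p q ℝ) : frobSq X ≤ X.rank * ‖X‖ ^ 2 := by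
  have hH : (Xᵀ * X).IsHermitian := by
    have := Matrix.isHermitian_conjTranspose_mul_self X
    rwa [Matrix.conjTranspose_eq_transpose_of_trivial] at this
  have h1 : X.rank = Fintype.card {i // hH.eigenvalues i ≠ 0} := by
    have h1 := hH.rank_eq_card_non_zero_eigs
    rw [← h1, ← Matrix.conjTranspose_eq_transpose_of_trivial, Matrix.rank_conjTranspose_mul_self]
  have h2 : ∀ i, hH.eigenvalues i ≤ ‖X‖ ^ 2 := fun i => by
    have : Nonempty q := ⟨i⟩
    have := spectrum.norm_le_norm_of_mem (hH.eigenvalues_mem_spectrum_real i)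
    refine (le_abs_self _).trans (this.trans ((opNorm_mul_le _ _).trans ?_))
    rw [opNorm_transpose, sq]
  have htr : frobSq X = ∑ i, hH.eigenvalues i := by
    rw [frobSq_eq_trace, hH.trace_eq_sum_eigenvalues]
    simp
  rw [htr, h1, Fintype.card_subtype, ← Finset.sum_filter_ne_zero]
  calc _ ≤ ∑ i ∈ Finset.univ.filter (fun i => hH.eigenvalues i ≠ 0), ‖X‖ ^ 2 :=
        Finset.sum_le_sum fun i _ => h2 i
    _ = _ := by simp

end Rank

/-! ### Consequences of the restricted isometry property -/

section RIP

variable {m n d : ℕ} {𝒜 : Matrix (Fin m) (Fin n) ℝ →ₗ[ℝ] EuclideanSpace ℝ (Fin d)}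

theorem adj_zero : adj 𝒜 0 = 0 := by
  ext i j
  simp [adj]

/-- On a nonzero matrix the two inequalities of the restricted isometry property contradict each
other unless `0 ≤ ρ`; a matrix unit has rank one. -/
theorem RIP.nonneg {r : ℕ} {ρ : ℝ} (h : RIP 𝒜 (r + 1) ρ) (hm : 0 < m) (hn : 0 < n) : 0 ≤ ρ := by
  have h1 := h (Matrix.vecMulVec (Pi.single ⟨0, hm⟩ 1) (Pi.single ⟨0, hn⟩ 1))
    ((Matrix.rank_vecMulVec_le _ _).trans (by omega))
  have h2 : frobSq (Matrix.vecMulVec (Pi.single (⟨0, hm⟩ : Fin m) (1 : ℝ))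
      (Pi.single (⟨0, hn⟩ : Fin n) (1 : ℝ))) = 1 := by
    simp [frobSq, Matrix.vecMulVec_apply, Pi.single_apply, ite_pow]
  rw [h2] at h1
  linarith [h1.1.trans h1.2]

theorem trace_vecMulVec_transpose_mul (x : Fin m → ℝ) (y : Fin n → ℝ)
    (X : Matrix (Fin m) (Fin n) ℝ) : ((Matrix.vecMulVec x y)ᵀ * X).trace = x ⬝ᵥ (X *ᵥ y) := by
  rw [Matrix.transpose_vecMulVec, Matrix.vecMulVec_mul, Matrix.trace_vecMulVec,
    dotProduct_comm, Matrix.dotProduct_mulVec]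

theorem frobSq_add_vecMulVec (X : Matrix (Fin m) (Fin n) ℝ) {x : Fin m → ℝ} {y : Fin n → ℝ}
    (hx : vnorm x = 1) (hy : vnorm y = 1) (c : ℝ) :
    frobSq (X + c • Matrix.vecMulVec x y) = frobSq X + 2 * c * (x ⬝ᵥ (X *ᵥ y)) + c ^ 2 := by
  have h1 : ((Matrix.vecMulVec x y)ᵀ * X).trace = x ⬝ᵥ (X *ᵥ y) :=
    trace_vecMulVec_transpose_mul x y X
  have h2 : (Xᵀ * Matrix.vecMulVec x y).trace = x ⬝ᵥ (X *ᵥ y) := by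
    rw [← h1, ← Matrix.trace_transpose]; simp [Matrix.transpose_mul]
  have h3 : ((Matrix.vecMulVec x y)ᵀ * Matrix.vecMulVec x y).trace = 1 := by
    rw [trace_vecMulVec_transpose_mul, Matrix.vecMulVec_mulVec, ← vnorm_mul_self y, hy]
    simp [← vnorm_mul_self, hx]
  simp only [frobSq_eq_trace, Matrix.transpose_add, Matrix.transpose_smul, Matrix.add_mul,
    Matrix.mul_add, Matrix.smul_mul, Matrix.mul_smul, Matrix.trace_add, Matrix.trace_smul,
    smul_eq_mul, h1, h2, h3]
  ring

/-- On matrices of rank at most `r`, the operator `𝒜* 𝒜` is close to the identity in operator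
norm: test against rank-one matrices and polarize. -/
theorem RIP.opNorm_le_frob {r : ℕ} {ρ : ℝ} (h : RIP 𝒜 (r + 1) ρ) (hρ : 0 ≤ ρ)
    {X : Matrix (Fin m) (Fin n) ℝ} (hX : X.rank ≤ r) :
    ‖adj 𝒜 (𝒜 X) - X‖ ≤ ρ * Real.sqrt (frobSq X) := by
  refine opNorm_le_of_bilinear (by positivity) fun x y hx hy => ?_
  obtain ⟨f, hf⟩ : ∃ f, Real.sqrt (frobSq X) = f := ⟨_, rfl⟩
  have hf0 : 0 ≤ f := hf ▸ Real.sqrt_nonneg _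
  have hf2 : frobSq X = f ^ 2 := by rw [← hf, Real.sq_sqrt (frobSq_nonneg X)]
  rw [hf, Matrix.sub_mulVec, dotProduct_sub]
  rcases hf0.eq_or_lt with h0 | h0
  · have : X = 0 := eq_zero_of_frobSq_eq_zero (by rw [hf2, ← h0]; simp)
    subst this
    simp [adj_zero, ← h0]
  have hrank : ∀ c : ℝ, (X + c • Matrix.vecMulVec x y).rank ≤ r + 1 := fun c => by
    refine (rank_add_le _ _).trans (add_le_add hX ?_)
    rw [← Matrix.smul_vecMulVec]
    exact Matrix.rank_vecMulVec_le _ _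
  have hin : inner ℝ (𝒜 (Matrix.vecMulVec x y)) (𝒜 X) = x ⬝ᵥ (adj 𝒜 (𝒜 X) *ᵥ y) := by
    rw [← trace_transpose_mul_adj, trace_vecMulVec_transpose_mul]
  have hA : ∀ c : ℝ, ‖𝒜 (X + c • Matrix.vecMulVec x y)‖ ^ 2 = ‖𝒜 X‖ ^ 2 +
      2 * c * (x ⬝ᵥ (adj 𝒜 (𝒜 X) *ᵥ y)) + c ^ 2 * ‖𝒜 (Matrix.vecMulVec x y)‖ ^ 2 := fun c => by
    rw [map_add, map_smul, norm_add_sq_real, real_inner_smul_right, real_inner_comm, hin, norm_smul,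
      mul_pow, Real.norm_eq_abs, sq_abs]
    ring
  -- The weights `± ‖X‖_F` of `x yᵀ` balance the two terms of the polarized inequality.
  have h1 := (h _ (hrank f)).2
  have h2 := (h _ (hrank (-f))).1
  rw [hA, frobSq_add_vecMulVec X hx hy, hf2] at h1 h2
  have h3 : f * (x ⬝ᵥ (adj 𝒜 (𝒜 X) *ᵥ y) - x ⬝ᵥ (X *ᵥ y)) ≤ f * (ρ * f) := by nlinarith
  exact le_of_mul_le_mul_left h3 h0

theorem adj_sub_add (X₁ X₂ : Matrix (Fin m) (Fin n) ℝ) :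
    adj 𝒜 (𝒜 (X₁ + X₂)) - (X₁ + X₂) = (adj 𝒜 (𝒜 X₁) - X₁) + (adj 𝒜 (𝒜 X₂) - X₂) := by
  ext i j
  simp [adj, inner_add_right]
  ring

/-- The restricted isometry property for matrices of larger rank, with a loss that is linear in
the number of blocks of rank `r`. -/
theorem RIP.opNorm_le_of_rank_le {r : ℕ} {ρ : ℝ} (h : RIP 𝒜 (r + 1) ρ) (hρ : 0 ≤ ρ) (k : ℕ)
    {X : Matrix (Fin m) (Fin n) ℝ} (hX : X.rank ≤ k * r) :
    ‖adj 𝒜 (𝒜 X) - X‖ ≤ k * (ρ * Real.sqrt r) * ‖X‖ := by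
  induction k generalizing X with
  | zero =>
    have h1 := frobSq_le X
    have h0 : X.rank = 0 := by simpa using hX
    rw [h0] at h1
    have : X = 0 := eq_zero_of_frobSq_eq_zero
      (le_antisymm (by simpa using h1) (frobSq_nonneg X))
    subst this
    simp [adj_zero]
  | succ k ih =>
    obtain ⟨X₁, X₂, rfl, h1, h2, h3, h4⟩ := exists_rank_split X (a := k * r) (b := r)
      (by rw [add_mul, one_mul] at hX; exact hX)
    rw [adj_sub_add]
    refine (norm_add_le _ _).trans ?_
    have h5 := ih h1
    have h6 := h.opNorm_le_frob hρ h2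
    have h7 : Real.sqrt (frobSq X₂) ≤ Real.sqrt r * ‖X₂‖ := by
      refine Real.sqrt_le_iff.2 ⟨by positivity, ?_⟩
      rw [mul_pow, Real.sq_sqrt (by positivity)]
      refine (frobSq_le X₂).trans ?_
      gcongr
    have h8 : ρ * Real.sqrt (frobSq X₂) ≤ ρ * Real.sqrt r * ‖X₁ + X₂‖ := by
      rw [mul_assoc]
      exact mul_le_mul_of_nonneg_left (h7.trans (by gcongr)) hρ
    have h9 : k * (ρ * Real.sqrt r) * ‖X₁‖ ≤ k * (ρ * Real.sqrt r) * ‖X₁ + X₂‖ := by gcongr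
    push_cast
    linarith

end RIP

/-! ### The self-adjoint dilation -/

section Dilation

variable {m n h : ℕ}

theorem isHermitian_dilation (X : Matrix (Fin m) (Fin n) ℝ) : (dilation X).IsHermitian := by
  rw [Matrix.IsHermitian, Matrix.conjTranspose_eq_transpose_of_trivial, dilation,
    Matrix.fromBlocks_transpose]
  simp

theorem vnorm_sumElim_sq (u : Fin m → ℝ) (v : Fin n → ℝ) :
    vnorm (Sum.elim u v) ^ 2 = vnorm u ^ 2 + vnorm v ^ 2 := by
  simp only [vnorm_sq, sumElim_dotProduct_sumElim]

theorem dilation_mulVec (X : Matrix (Fin m) (Fin n) ℝ) (u : Fin m → ℝ) (v : Fin n → ℝ) :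
    dilation X *ᵥ Sum.elim u v = Sum.elim (X *ᵥ v) (Xᵀ *ᵥ u) := by
  rw [dilation, Matrix.fromBlocks_mulVec]
  simp

theorem sumElim_eta (w : Fin m ⊕ Fin n → ℝ) : Sum.elim (w ∘ Sum.inl) (w ∘ Sum.inr) = w :=
  Sum.elim_comp_inl_inr w

theorem opNorm_dilation (X : Matrix (Fin m) (Fin n) ℝ) : ‖dilation X‖ = ‖X‖ := by
  refine le_antisymm (opNorm_le (norm_nonneg _) fun w => ?_) (opNorm_le (norm_nonneg _) fun v => ?_)
  · rw [← sumElim_eta w, dilation_mulVec, ← sq_le_sq₀ (vnorm_nonneg _)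
      (mul_nonneg (norm_nonneg _) (vnorm_nonneg _)), mul_pow, vnorm_sumElim_sq, vnorm_sumElim_sq]
    have h1 := vnorm_mulVec_le X (w ∘ Sum.inr)
    have h2 := vnorm_mulVec_le Xᵀ (w ∘ Sum.inl)
    rw [opNorm_transpose] at h2
    have h3 := pow_le_pow_left₀ (vnorm_nonneg _) h1 2
    have h4 := pow_le_pow_left₀ (vnorm_nonneg _) h2 2
    nlinarith
  · have h1 := vnorm_mulVec_le (dilation X) (Sum.elim 0 v)
    have h2 := vnorm_sumElim_sq (X *ᵥ v) (Xᵀ *ᵥ 0)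
    have h3 := vnorm_sumElim_sq (0 : Fin m → ℝ) v
    rw [vnorm_zero, zero_pow two_ne_zero, zero_add,
      sq_eq_sq₀ (vnorm_nonneg _) (vnorm_nonneg _)] at h3
    rw [dilation_mulVec, h3] at h1
    refine le_trans ?_ h1
    rw [← sq_le_sq₀ (vnorm_nonneg _) (vnorm_nonneg _), h2]
    nlinarith [sq_nonneg (vnorm (Xᵀ *ᵥ (0 : Fin m → ℝ)))]

theorem dilation_add (X Z : Matrix (Fin m) (Fin n) ℝ) :
    dilation (X + Z) = dilation X + dilation Z := by
  simp [dilation, Matrix.fromBlocks_add]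

theorem dilation_sub (X Z : Matrix (Fin m) (Fin n) ℝ) :
    dilation (X - Z) = dilation X - dilation Z := by
  simp [dilation, sub_eq_add_neg, Matrix.fromBlocks_add, Matrix.fromBlocks_neg]

theorem toRows_mulVec (W : Matrix (Fin m ⊕ Fin n) (Fin h) ℝ) (x : Fin h → ℝ) :
    W *ᵥ x = Sum.elim (W.toRows₁ *ᵥ x) (W.toRows₂ *ᵥ x) := by
  conv_lhs => rw [← Matrix.fromRows_toRows W]
  rw [Matrix.fromRows_mulVec]

theorem vnorm_mulVec_sq_toRows (W : Matrix (Fin m ⊕ Fin n) (Fin h) ℝ) (x : Fin h → ℝ) :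
    vnorm (W *ᵥ x) ^ 2 = vnorm (W.toRows₁ *ᵥ x) ^ 2 + vnorm (W.toRows₂ *ᵥ x) ^ 2 := by
  rw [toRows_mulVec, vnorm_sumElim_sq]

theorem transpose_mulVec_sumElim (W : Matrix (Fin m ⊕ Fin n) (Fin h) ℝ) (u : Fin m → ℝ)
    (v : Fin n → ℝ) : Wᵀ *ᵥ Sum.elim u v = W.toRows₁ᵀ *ᵥ u + W.toRows₂ᵀ *ᵥ v := by
  conv_lhs => rw [← Matrix.fromRows_toRows W]
  rw [Matrix.transpose_fromRows, Matrix.fromCols_mulVec_sumElim]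

/-- The product of the two halves of a matrix is half as large as its Gram matrix: this is
polarization. -/
theorem opNorm_toRows_mul_le (W : Matrix (Fin m ⊕ Fin n) (Fin h) ℝ) :
    ‖W.toRows₁ * W.toRows₂ᵀ‖ ≤ ‖W‖ ^ 2 / 2 := by
  refine opNorm_le_of_bilinear (by positivity) fun u v hu hv => ?_
  rw [← Matrix.mulVec_mulVec, dotProduct_mulVec_eq]
  set a := W.toRows₁ᵀ *ᵥ u
  set b := W.toRows₂ᵀ *ᵥ v
  have h1 := vnorm_mulVec_le Wᵀ (Sum.elim u v)
  have h2 : 2 = vnorm (Sum.elim u v) ^ 2 := by rw [vnorm_sumElim_sq, hu, hv]; norm_num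
  rw [opNorm_transpose, transpose_mulVec_sumElim] at h1
  have h3 := pow_le_pow_left₀ (vnorm_nonneg _) h1 2
  rw [mul_pow, ← h2, vnorm_sq] at h3
  have h4 : 0 ≤ (a - b) ⬝ᵥ (a - b) := by rw [← vnorm_sq]; positivity
  simp only [add_dotProduct, dotProduct_add, sub_dotProduct, dotProduct_sub] at h3 h4
  rw [dotProduct_comm b a] at h3 h4
  linarith

/-- The reflection `diag(1, -1)`, which exchanges the positive and negative eigenvectors of a
dilation. -/
def refl (m n : ℕ) : Matrix (Fin m ⊕ Fin n) (Fin m ⊕ Fin n) ℝ := Matrix.fromBlocks 1 0 0 (-1)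

theorem refl_mul_self : refl m n * refl m n = 1 := by
  simp [refl, Matrix.fromBlocks_multiply]

theorem refl_transpose : (refl m n)ᵀ = refl m n := by
  simp [refl, Matrix.fromBlocks_transpose]

/-- The residual is quadratic in the weights through `W Wᵀ` alone: conjugation by `diag(1, -1)`
changes the sign of the off-diagonal blocks, so the difference cancels the diagonal ones. -/
theorem dilation_resid (Y : Matrix (Fin m) (Fin n) ℝ) (W : Matrix (Fin m ⊕ Fin n) (Fin h) ℝ) :
    dilation (resid Y W) = dilation Y - (1 / 2 : ℝ) • (W * Wᵀ) +
      (1 / 2 : ℝ) • (refl m n * (W * Wᵀ) * refl m n) := by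
  have hW : W * Wᵀ = Matrix.fromBlocks (W.toRows₁ * W.toRows₁ᵀ) (W.toRows₁ * W.toRows₂ᵀ)
      (W.toRows₂ * W.toRows₁ᵀ) (W.toRows₂ * W.toRows₂ᵀ) := by
    conv_lhs => rw [← Matrix.fromRows_toRows W]
    rw [Matrix.transpose_fromRows, Matrix.fromRows_mul_fromCols]
  rw [hW]
  simp only [dilation, resid, refl, Matrix.fromBlocks_multiply, Matrix.fromBlocks_smul,
    sub_eq_add_neg, Matrix.fromBlocks_neg, Matrix.fromBlocks_add]
  have e : ∀ {p q : ℕ} (X : Matrix (Fin p) (Fin q) ℝ), -((1 / 2 : ℝ) • X) + (1 / 2 : ℝ) • (-X) = -X :=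
    fun X => by rw [smul_neg, ← neg_add, ← add_smul]; norm_num
  congr 1 <;> simp [Matrix.transpose_add, Matrix.transpose_mul, add_assoc, ← add_smul, ← neg_add] <;>
    norm_num

end Dilation

/-! ### Size of the perturbation -/

section Perturbation

variable {m n h r d : ℕ} {𝒜 : Matrix (Fin m) (Fin n) ℝ →ₗ[ℝ] EuclideanSpace ℝ (Fin d)}
  {Y : Matrix (Fin m) (Fin n) ℝ}

theorem toRows₁_mul (W : Matrix (Fin m ⊕ Fin n) (Fin h) ℝ) {l : ℕ} (Z : Matrix (Fin h) (Fin l) ℝ) :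
    (W * Z).toRows₁ = W.toRows₁ * Z := by
  ext i j; simp [Matrix.toRows₁, Matrix.mul_apply]

theorem toRows₂_mul (W : Matrix (Fin m ⊕ Fin n) (Fin h) ℝ) {l : ℕ} (Z : Matrix (Fin h) (Fin l) ℝ) :
    (W * Z).toRows₂ = W.toRows₂ * Z := by
  ext i j; simp [Matrix.toRows₂, Matrix.mul_apply]

theorem opNorm_toRows₁_le (W : Matrix (Fin m ⊕ Fin n) (Fin h) ℝ) : ‖W.toRows₁‖ ≤ ‖W‖ :=
  opNorm_le (norm_nonneg _) fun x => by
    refine le_trans ?_ (vnorm_mulVec_le W x)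
    rw [← sq_le_sq₀ (vnorm_nonneg _) (vnorm_nonneg _), vnorm_mulVec_sq_toRows]
    nlinarith [sq_nonneg (vnorm (W.toRows₂ *ᵥ x))]

theorem opNorm_toRows₂_le (W : Matrix (Fin m ⊕ Fin n) (Fin h) ℝ) : ‖W.toRows₂‖ ≤ ‖W‖ :=
  opNorm_le (norm_nonneg _) fun x => by
    refine le_trans ?_ (vnorm_mulVec_le W x)
    rw [← sq_le_sq₀ (vnorm_nonneg _) (vnorm_nonneg _), vnorm_mulVec_sq_toRows]
    nlinarith [sq_nonneg (vnorm (W.toRows₁ *ᵥ x))]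

/-- The measurement error, when the weights have norm at most `ψ` on the kernel of an `r`-row matrix
`A`: up to a remainder of size `ψ² / 2` the residual has rank at most `2 r`, and the remainder is
split into `k` blocks of rank `r`. -/
theorem norm_measError_le {ρ ψ : ℝ} (hrip : RIP 𝒜 (r + 1) ρ) (hρ : 0 ≤ ρ) (hY : Y.rank ≤ r)
    {k : ℕ} (hk : min m n ≤ k * r) {W : Matrix (Fin m ⊕ Fin n) (Fin h) ℝ}
    {A : Matrix (Fin r) (Fin h) ℝ} (hψ : 0 ≤ ψ)
    (hker : ∀ x, A *ᵥ x = 0 → vnorm (W *ᵥ x) ≤ ψ * vnorm x) :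
    ‖measError 𝒜 Y W‖ ≤ ρ * Real.sqrt r * (2 * ‖resid Y W‖ + (k + 2) * (ψ ^ 2 / 2)) := by
  obtain ⟨proj, N, hN, hnorm, hrank, hsymm, hidem, hcompl, -, hAker⟩ :=
    exists_spectral_projections A
  have hWk : ‖W * proj Nᶜ‖ ≤ ψ := opNorm_le hψ fun x => by
    rw [← Matrix.mulVec_mulVec]
    refine (hker _ (by rw [Matrix.mulVec_mulVec, hAker, Matrix.zero_mulVec])).trans ?_
    have := vnorm_mulVec_le (proj Nᶜ) x
    have := hnorm Nᶜ
    have := vnorm_nonneg x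
    gcongr
    nlinarith
  set Z : Matrix (Fin m) (Fin n) ℝ := (W * proj Nᶜ).toRows₁ * (W * proj Nᶜ).toRows₂ᵀ with hZ
  have hZn : ‖Z‖ ≤ ψ ^ 2 / 2 := (opNorm_toRows_mul_le _).trans (by gcongr)
  have hsplit : resid Y W = (Y - W.toRows₁ * proj N * W.toRows₂ᵀ) + (-Z) := by
    have h1 : Z = W.toRows₁ * proj Nᶜ * W.toRows₂ᵀ := by
      rw [hZ, toRows₁_mul, toRows₂_mul, Matrix.transpose_mul, hsymm, ← Matrix.mul_assoc,
        Matrix.mul_assoc W.toRows₁, hidem]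
    have h2 : W.toRows₁ * W.toRows₂ᵀ =
        W.toRows₁ * proj N * W.toRows₂ᵀ + W.toRows₁ * proj Nᶜ * W.toRows₂ᵀ := by
      rw [← Matrix.add_mul, ← Matrix.mul_add, hcompl, Matrix.mul_one]
    rw [resid, h1, h2]
    abel
  -- `proj N` projects onto the row space of `A`, so `X` has rank at most `2 r`, while `Z` only
  -- involves the weights on the kernel of `A`.
  set X := Y - W.toRows₁ * proj N * W.toRows₂ᵀ with hX
  have hXr : X.rank ≤ 2 * r := by
    rw [hX, sub_eq_add_neg, two_mul]
    refine (rank_add_le _ _).trans (add_le_add hY ?_)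
    rw [← Matrix.neg_mul, ← Matrix.mul_neg]
    refine (Matrix.rank_mul_le_left _ _).trans ((Matrix.rank_mul_le_right _ _).trans ?_)
    have h1 : (-proj N).rank ≤ (proj N).rank := by
      have := Matrix.rank_mul_le_left (proj N) (-1 : Matrix (Fin h) (Fin h) ℝ)
      rwa [Matrix.mul_neg, Matrix.mul_one] at this
    exact h1.trans ((hrank N).trans (hN.le.trans (by simpa using Matrix.rank_le_height A)))
  have hZr : (-Z).rank ≤ k * r := le_trans
    (le_min (by simpa using Matrix.rank_le_height (-Z)) (by simpa using Matrix.rank_le_width (-Z)))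
    hk
  have hXn : ‖X‖ ≤ ‖resid Y W‖ + ψ ^ 2 / 2 := by
    have : X = resid Y W + Z := by rw [hsplit]; abel
    rw [this]
    exact (norm_add_le _ _).trans (by gcongr)
  rw [measError, hsplit, adj_sub_add, ← hsplit]
  refine (norm_add_le _ _).trans ?_
  have h1 := hrip.opNorm_le_of_rank_le hρ 2 hXr
  have h2 := hrip.opNorm_le_of_rank_le hρ k hZr
  rw [norm_neg] at h2
  have hc : 0 ≤ ρ * Real.sqrt r := by positivity
  have h3 : (2 : ℕ) * (ρ * Real.sqrt r) * ‖X‖ ≤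
      (2 : ℕ) * (ρ * Real.sqrt r) * (‖resid Y W‖ + ψ ^ 2 / 2) := by gcongr
  have h4 : k * (ρ * Real.sqrt r) * ‖Z‖ ≤ k * (ρ * Real.sqrt r) * (ψ ^ 2 / 2) := by gcongr
  push_cast at *
  linarith

/-- The generator of the flow on a time step that starts at `W`. -/
def generator (𝒜 : Matrix (Fin m) (Fin n) ℝ →ₗ[ℝ] EuclideanSpace ℝ (Fin d))
    (Y : Matrix (Fin m) (Fin n) ℝ) (η : ℝ) (W : Matrix (Fin m ⊕ Fin n) (Fin h) ℝ) :
    Matrix (Fin m ⊕ Fin n) (Fin m ⊕ Fin n) ℝ :=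
  (1 / η) • CFC.log (1 + η • dilation (resid Y W) + η • dilation (measError 𝒜 Y W))

theorem resid_add_measError (W : Matrix (Fin m ⊕ Fin n) (Fin h) ℝ) :
    resid Y W + measError 𝒜 Y W = adj 𝒜 (𝒜 (resid Y W)) := by
  rw [measError]; abel

theorem generator_eq (η : ℝ) (W : Matrix (Fin m ⊕ Fin n) (Fin h) ℝ) :
    generator 𝒜 Y η W = (1 / η) • CFC.log (1 + η • dilation (adj 𝒜 (𝒜 (resid Y W)))) := by
  rw [generator, ← resid_add_measError, dilation_add, smul_add, add_assoc]

theorem isHermitian_smul_dilation (η : ℝ) (X : Matrix (Fin m) (Fin n) ℝ) :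
    (η • dilation X).IsHermitian := by
  have h := isHermitian_dilation X
  rw [Matrix.IsHermitian] at h ⊢
  rw [Matrix.conjTranspose_smul, h]
  simp

/-- The generator agrees to first order in `η` with the gradient `𝒜* 𝒜 (Y - U Vᵀ)`. -/
theorem norm_generator_sub_le (hm : 0 < m) {η : ℝ} (hη : 0 < η)
    {W : Matrix (Fin m ⊕ Fin n) (Fin h) ℝ} (hX : η * ‖adj 𝒜 (𝒜 (resid Y W))‖ ≤ 1 / 4) :
    ‖generator 𝒜 Y η W - dilation (adj 𝒜 (𝒜 (resid Y W)))‖ ≤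
      η * ‖adj 𝒜 (𝒜 (resid Y W))‖ ^ 2 := by
  have : Nonempty (Fin m ⊕ Fin n) := ⟨Sum.inl ⟨0, hm⟩⟩
  set X := adj 𝒜 (𝒜 (resid Y W))
  have hn : ‖η • dilation X‖ = η * ‖X‖ := by
    rw [norm_smul, opNorm_dilation, Real.norm_of_nonneg hη.le]
  have h1 := norm_log_one_add_sub_le (isHermitian_smul_dilation η X) (by rwa [hn])
  have h2 : generator 𝒜 Y η W - dilation X =
      (1 / η) • (CFC.log (1 + η • dilation X) - η • dilation X) := by
    rw [generator_eq, smul_sub, smul_smul, one_div_mul_cancel hη.ne', one_smul]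
  rw [h2, norm_smul, Real.norm_of_nonneg (by positivity)]
  rw [hn] at h1
  calc 1 / η * ‖CFC.log (1 + η • dilation X) - η • dilation X‖ ≤ 1 / η * (η * ‖X‖) ^ 2 := by gcongr
    _ = η * ‖X‖ ^ 2 := by field_simp

/-- One step of the flow is one step of gradient descent. -/
theorem exp_generator_mul (hm : 0 < m) {η : ℝ} (hη : 0 < η)
    {W : Matrix (Fin m ⊕ Fin n) (Fin h) ℝ} (hX : η * ‖adj 𝒜 (𝒜 (resid Y W))‖ < 1) :
    NormedSpace.exp (η • generator 𝒜 Y η W) * W =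
      Matrix.fromRows (gdStep 𝒜 Y η (W.toRows₁, W.toRows₂)).1
        (gdStep 𝒜 Y η (W.toRows₁, W.toRows₂)).2 := by
  have : Nonempty (Fin m ⊕ Fin n) := ⟨Sum.inl ⟨0, hm⟩⟩
  rw [generator_eq, smul_smul, mul_one_div_cancel hη.ne', one_smul,
    exp_log_one_add (isHermitian_smul_dilation η _)
      (by rwa [norm_smul, opNorm_dilation, Real.norm_of_nonneg hη.le])]
  conv_lhs => rw [← Matrix.fromRows_toRows W]
  rw [Matrix.add_mul, Matrix.one_mul, Matrix.smul_mul, dilation, Matrix.fromBlocks_mul_fromRows]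
  simp only [gdStep, resid, Matrix.zero_mul, zero_add, add_zero, Matrix.toRows₁_fromRows,
    Matrix.toRows₂_fromRows]
  ext (i | i) j <;> simp

theorem resid_sub_resid (W W' : Matrix (Fin m ⊕ Fin n) (Fin h) ℝ) :
    ‖resid Y W - resid Y W'‖ ≤ ‖W' - W‖ * (‖W'‖ + ‖W‖) := by
  have h1 : resid Y W - resid Y W' = (W' - W).toRows₁ * W'.toRows₂ᵀ +
      W.toRows₁ * (W' - W).toRows₂ᵀ := by
    have e1 : (W' - W).toRows₁ = W'.toRows₁ - W.toRows₁ := rfl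
    have e2 : (W' - W).toRows₂ = W'.toRows₂ - W.toRows₂ := rfl
    rw [e1, e2, resid, resid, Matrix.transpose_sub, Matrix.sub_mul, Matrix.mul_sub]
    abel
  rw [h1]
  refine (norm_add_le _ _).trans ?_
  have h2 := opNorm_mul_le (W' - W).toRows₁ W'.toRows₂ᵀ
  have h3 := opNorm_mul_le W.toRows₁ (W' - W).toRows₂ᵀ
  rw [opNorm_transpose] at h2 h3
  have h4 := mul_le_mul (opNorm_toRows₁_le (W' - W)) (opNorm_toRows₂_le W') (norm_nonneg _)
    (norm_nonneg _)
  have h5 := mul_le_mul (opNorm_toRows₁_le W) (opNorm_toRows₂_le (W' - W)) (norm_nonneg _)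
    (norm_nonneg _)
  linarith

/-- The scales of the problem, with the smallness relations between them: `y = ‖Y‖`, the end time
`T`, the learning rate `η`, the number `k` of blocks of rank `r` in an `m × n` matrix, and a bound
`Ψ` for the square of the weights that do not take part in fitting `Y`. -/
structure Scales (𝒜 : Matrix (Fin m) (Fin n) ℝ →ₗ[ℝ] EuclideanSpace ℝ (Fin d))
    (Y : Matrix (Fin m) (Fin n) ℝ) (r : ℕ) (y T δ ρ η γ Ψ : ℝ) (k : ℕ) : Prop where
  pos_m : 0 < m
  pos_y : 0 < y
  norm_eq : ‖Y‖ = y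
  rank_le : Y.rank ≤ r
  pos_T : 0 < T
  le_Ty : 50 ≤ T * y
  pos_delta : 0 < δ
  delta_le : δ ≤ 1 / 64
  pos_eta : 0 < η
  eta_le : η ≤ δ ^ 2 / (80 * T * y ^ 2)
  rho_nonneg : 0 ≤ ρ
  rho_le : ρ * Real.sqrt r ≤ δ ^ 2 / (16 * T * y)
  rip : RIP 𝒜 (r + 1) ρ
  min_le : min m n ≤ k * r
  k_le : k + 2 ≤ 4 * γ
  pos_gamma : 0 < γ
  Psi_nonneg : 0 ≤ Ψ
  gamma_Psi_le : γ * Ψ ≤ y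

variable {y T δ ρ η γ Ψ : ℝ} {k : ℕ}

theorem norm_resid_le (hY : ‖Y‖ = y) {W : Matrix (Fin m ⊕ Fin n) (Fin h) ℝ}
    (hW : ‖W‖ ^ 2 ≤ 9 / 4 * y) : ‖resid Y W‖ ≤ 17 / 8 * y := by
  refine (norm_sub_le _ _).trans ?_
  have := opNorm_toRows_mul_le W
  rw [hY]
  linarith

theorem Scales.ratio_le (hs : Scales 𝒜 Y r y T δ ρ η γ Ψ k) :
    0 < δ ^ 2 / (T * y) ∧ δ ^ 2 / (T * y) ≤ 1 / 100000 := by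
  have := hs.pos_T
  have := hs.pos_y
  have h1 := hs.pos_delta
  refine ⟨by positivity, ?_⟩
  rw [div_le_iff₀ (by positivity)]
  have h2 : δ ^ 2 ≤ (1 / 64) ^ 2 := by have := hs.delta_le; gcongr
  have := hs.le_Ty
  linarith

theorem Scales.eta_le' (hs : Scales 𝒜 Y r y T δ ρ η γ Ψ k) :
    η * (80 * y) ≤ δ ^ 2 / (T * y) := by
  have := hs.pos_T
  have := hs.pos_y
  have h := hs.eta_le
  rw [le_div_iff₀ (by positivity)] at h ⊢
  linarith

/-- The remainder in `norm_measError_le` costs `k + 2 ≤ 4 γ` blocks of size `Ψ / 2`. -/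
theorem Scales.measError_le (hs : Scales 𝒜 Y r y T δ ρ η γ Ψ k)
    {W : Matrix (Fin m ⊕ Fin n) (Fin h) ℝ} {A : Matrix (Fin r) (Fin h) ℝ} {ψ : ℝ} (hψ : 0 ≤ ψ)
    (hψΨ : ψ ^ 2 ≤ Ψ) (hker : ∀ x, A *ᵥ x = 0 → vnorm (W *ᵥ x) ≤ ψ * vnorm x) :
    ‖measError 𝒜 Y W‖ ≤ δ ^ 2 / (T * y) / 8 * (‖resid Y W‖ + γ * Ψ) := by
  have h1 := norm_measError_le hs.rip hs.rho_nonneg hs.rank_le hs.min_le hψ hker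
  have hT := hs.pos_T
  have hy := hs.pos_y
  have h2 : (k + 2) * (ψ ^ 2 / 2) ≤ 2 * (γ * Ψ) := by
    have := mul_le_mul hs.k_le hψΨ (sq_nonneg _) (by have := hs.pos_gamma; positivity)
    linarith
  have h3 : 0 ≤ 2 * ‖resid Y W‖ + (k + 2) * (ψ ^ 2 / 2) := by positivity
  refine h1.trans ((mul_le_mul_of_nonneg_right hs.rho_le h3).trans ?_)
  have h4 : δ ^ 2 / (16 * T * y) = δ ^ 2 / (T * y) / 16 := by field_simp
  rw [h4]
  have := hs.ratio_le.1
  nlinarith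

/-- The gradient exceeds the residual by at most the measurement error, which is below one percent.
-/
theorem Scales.gradient_le (hs : Scales 𝒜 Y r y T δ ρ η γ Ψ k)
    {W : Matrix (Fin m ⊕ Fin n) (Fin h) ℝ} {A : Matrix (Fin r) (Fin h) ℝ} {ψ : ℝ} (hψ : 0 ≤ ψ)
    (hψΨ : ψ ^ 2 ≤ Ψ) (hker : ∀ x, A *ᵥ x = 0 → vnorm (W *ᵥ x) ≤ ψ * vnorm x) :
    ‖adj 𝒜 (𝒜 (resid Y W))‖ ≤ 101 / 100 * (‖resid Y W‖ + γ * Ψ) := by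
  rw [← resid_add_measError]
  refine (norm_add_le _ _).trans ?_
  have h1 := hs.measError_le hψ hψΨ hker
  have h2 : 0 ≤ γ * Ψ := mul_nonneg hs.pos_gamma.le hs.Psi_nonneg
  have h3 := norm_nonneg (resid Y W)
  have h4 := hs.ratio_le
  nlinarith [mul_nonneg (sub_nonneg.2 h4.2) (add_nonneg h3 h2)]

theorem Scales.eta_mul_gradient_le (hs : Scales 𝒜 Y r y T δ ρ η γ Ψ k)
    {W : Matrix (Fin m ⊕ Fin n) (Fin h) ℝ} {A : Matrix (Fin r) (Fin h) ℝ} {ψ : ℝ} (hψ : 0 ≤ ψ)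
    (hψΨ : ψ ^ 2 ≤ Ψ) (hker : ∀ x, A *ᵥ x = 0 → vnorm (W *ᵥ x) ≤ ψ * vnorm x)
    (hW : ‖W‖ ^ 2 ≤ 9 / 4 * y) :
    η * ‖adj 𝒜 (𝒜 (resid Y W))‖ ≤ δ ^ 2 / (T * y) / 25 := by
  have h1 := hs.gradient_le hψ hψΨ hker
  have h2 := norm_resid_le hs.norm_eq hW
  have h3 := hs.gamma_Psi_le
  have h4 := hs.eta_le'
  have h5 : ‖adj 𝒜 (𝒜 (resid Y W))‖ ≤ 16 / 5 * y := by linarith [hs.pos_y]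
  have h6 := mul_le_mul_of_nonneg_left h5 hs.pos_eta.le
  linarith

/-- The perturbation is small compared with the last residual seen by the algorithm: the three
contributions are the measurement error, the error of the logarithm, and the motion of the residual
within a time step. -/
theorem Scales.perturbation_le (hs : Scales 𝒜 Y r y T δ ρ η γ Ψ k)
    {U₀ : Matrix (Fin m) (Fin h) ℝ} {V₀ : Matrix (Fin n) (Fin h) ℝ}
    {W : ℝ → Matrix (Fin m ⊕ Fin n) (Fin h) ℝ} (hflow : IsPerturbedGradientFlow 𝒜 Y η U₀ V₀ W)
    {t : ℝ} (ht : 0 ≤ t) (hW : ∀ s ∈ Icc 0 t, ‖W s‖ ^ 2 ≤ 9 / 4 * y)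
    {A : Matrix (Fin r) (Fin h) ℝ} {ψ : ℝ} (hψ : 0 ≤ ψ) (hψΨ : ψ ^ 2 ≤ Ψ)
    (hker : ∀ x, A *ᵥ x = 0 → vnorm (W (⌊t / η⌋₊ * η) *ᵥ x) ≤ ψ * vnorm x) :
    ‖perturbation 𝒜 Y η W t‖ ≤
      δ ^ 2 / (T * y) / 4 * (‖resid Y (W (⌊t / η⌋₊ * η))‖ + γ * Ψ) := by
  have hη := hs.pos_eta
  have hy := hs.pos_y
  set τ := ⌊t / η⌋₊ * η with hτ
  have hτ0 : 0 ≤ τ := by positivity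
  have hτt : τ ≤ t := floor_div_mul_le hη ht
  have htτ : t - τ ≤ η := by
    have := lt_floor_div_add_one_mul hη t
    rw [add_mul, one_mul, ← hτ] at this
    linarith
  have hWτ := hW τ ⟨hτ0, hτt⟩
  set g := δ ^ 2 / (T * y) with hg
  obtain ⟨hg0, hg1⟩ := hs.ratio_le
  rw [← hg] at hg0 hg1
  set X := adj 𝒜 (𝒜 (resid Y (W τ))) with hX
  set M := generator 𝒜 Y η (W τ) with hM
  set q := ‖resid Y (W τ)‖ + γ * Ψ with hq
  have hq0 : 0 ≤ q := add_nonneg (norm_nonneg _) (mul_nonneg hs.pos_gamma.le hs.Psi_nonneg)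
  have hXq : ‖X‖ ≤ 101 / 100 * q := hs.gradient_le hψ hψΨ hker
  have hηX : η * ‖X‖ ≤ g / 25 := hs.eta_mul_gradient_le hψ hψΨ hker hWτ
  have hηy : η * (80 * y) ≤ g := hs.eta_le'
  have h1 : ‖M - dilation X‖ ≤ g * q / 24 := by
    refine (norm_generator_sub_le hs.pos_m hη (hηX.trans (by linarith))).trans ?_
    calc η * ‖X‖ ^ 2 = (η * ‖X‖) * ‖X‖ := by ring
      _ ≤ g / 25 * (101 / 100 * q) := by gcongr
      _ ≤ g * q / 24 := by nlinarith [mul_nonneg hg0.le hq0]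
  have h2 : ‖dilation (measError 𝒜 Y (W τ))‖ ≤ g * q / 8 := by
    rw [opNorm_dilation]
    exact (hs.measError_le hψ hψΨ hker).trans_eq (by ring)
  have hMn : ‖M‖ ≤ 51 / 50 * q := by
    have h3 := norm_le_norm_add_norm_sub' M (dilation X)
    rw [opNorm_dilation] at h3
    nlinarith [mul_nonneg (sub_nonneg.2 hg1) hq0]
  obtain ⟨b, hb0, hb⟩ : ∃ b : ℝ, 0 ≤ b ∧ b ^ 2 = 9 / 4 * y :=
    ⟨Real.sqrt (9 / 4 * y), Real.sqrt_nonneg _, Real.sq_sqrt (by positivity)⟩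
  have hWb : ∀ s ∈ Icc 0 t, ‖W s‖ ≤ b := fun s hs' =>
    (sq_le_sq₀ (norm_nonneg _) hb0).1 ((hW s hs').trans_eq hb.symm)
  -- Motion of the weights since the last grid point, where the generator has been constant.
  have hΔ : ‖W t - W τ‖ ≤ ‖M‖ * b * (t - τ) := by
    refine norm_image_sub_le_of_norm_deriv_right_le_segment (f := W) (a := τ) (b := t)
      (hflow.cont.mono fun s hs' => hτ0.trans hs'.1)
      (fun s hs' => hflow.deriv s (hτ0.trans hs'.1)) (fun s hs' => ?_) t ⟨hτt, le_rfl⟩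
    have hk : ⌊s / η⌋₊ = ⌊t / η⌋₊ := floor_div_eq hη hs'.1
      (hs'.2.trans (lt_floor_div_add_one_mul hη t))
    rw [perturbation, add_sub_cancel, hk]
    refine (opNorm_mul_le _ _).trans ?_
    have := hWb s ⟨hτ0.trans hs'.1, hs'.2.le⟩
    exact mul_le_mul_of_nonneg_left this (norm_nonneg _)
  have h3 : ‖dilation (resid Y (W τ) - resid Y (W t))‖ ≤ g * q / 16 := by
    rw [opNorm_dilation]
    refine (resid_sub_resid _ _).trans ?_
    have e1 := hWb t ⟨ht, le_rfl⟩
    have e2 := hWb τ ⟨hτ0, hτt⟩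
    calc ‖W t - W τ‖ * (‖W t‖ + ‖W τ‖) ≤ (‖M‖ * b * (t - τ)) * (b + b) := by gcongr
      _ = 2 * ‖M‖ * b ^ 2 * (t - τ) := by ring
      _ ≤ 2 * (51 / 50 * q) * (9 / 4 * y) * η := by
        rw [hb]
        have := sub_nonneg.2 hτt
        gcongr
      _ = (459 / 100 / 80) * q * (η * (80 * y)) := by ring
      _ ≤ (459 / 100 / 80) * q * g := by gcongr
      _ ≤ g * q / 16 := by nlinarith [mul_nonneg hg0.le hq0]
  -- Logarithm, measurement error, motion of the residual: `1/24 + 1/8 + 1/16 < 1/4`.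
  have hE : perturbation 𝒜 Y η W t = (M - dilation X) + dilation (measError 𝒜 Y (W τ)) +
      dilation (resid Y (W τ) - resid Y (W t)) := by
    rw [dilation_sub, hX, ← resid_add_measError, dilation_add, perturbation, hM, generator]
    abel
  rw [hE]
  refine (norm_add₃_le).trans ?_
  nlinarith [mul_nonneg hg0.le hq0]

end Perturbation

/-! ### The flow in the eigenbasis of the dilation -/

section Frame

variable {ι κ h : Type*} [Fintype ι] [Fintype κ] [Fintype h] [DecidableEq ι] [DecidableEq κ]
  [DecidableEq h]

/-- A symmetric matrix `S = p diag(s) pᵀ - q diag(s) qᵀ` in terms of orthonormal eigenvectors, with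
an orthogonal involution `J` that exchanges `p` and `q`. -/
structure Frame (S J : Matrix ι ι ℝ) (p q : Matrix ι κ ℝ) (s : κ → ℝ) : Prop where
  pp : pᵀ * p = 1
  qq : qᵀ * q = 1
  pq : pᵀ * q = 0
  Jp : J * p = q
  Jq : J * q = p
  JJ : J * J = 1
  Jt : Jᵀ = J
  eq : S = p * Matrix.diagonal s * pᵀ - q * Matrix.diagonal s * qᵀ

/-- The imbalance `Wᵀ J W = Uᵀ U - Vᵀ V`, which gradient flow conserves. -/
def imbalance (J : Matrix ι ι ℝ) (W : Matrix ι h ℝ) : Matrix h h ℝ := Wᵀ * J * W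

/-- The velocity of the perturbed flow, with the quadratic terms written through the Gram matrix and
the imbalance. -/
def velocity (S J E : Matrix ι ι ℝ) (W : Matrix ι h ℝ) : Matrix ι h ℝ :=
  S * W - (1 / 2 : ℝ) • (W * (Wᵀ * W)) + (1 / 2 : ℝ) • (J * W * imbalance J W) + E * W

/-- The part of `W` in the kernel of `S`. -/
def kerPart (p q : Matrix ι κ ℝ) (W : Matrix ι h ℝ) : Matrix ι h ℝ :=
  W - p * (pᵀ * W) - q * (qᵀ * W)

/-- Reassociation puts the Gram matrix and the imbalance to the right of `W`, so that the damping
acts alike on all parts of the weights. -/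
theorem velocity_eq {S J E : Matrix ι ι ℝ} {W : Matrix ι h ℝ} :
    (S - (1 / 2 : ℝ) • (W * Wᵀ) + (1 / 2 : ℝ) • (J * (W * Wᵀ) * J) + E) * W =
      velocity S J E W := by
  simp only [velocity, imbalance, Matrix.add_mul, Matrix.sub_mul, Matrix.smul_mul,
    Matrix.mul_assoc]

namespace Frame

variable {S J E : Matrix ι ι ℝ} {p q : Matrix ι κ ℝ} {s : κ → ℝ} (F : Frame S J p q s)
include F

theorem qp : qᵀ * p = 0 := by
  rw [← Matrix.transpose_inj, Matrix.transpose_mul, Matrix.transpose_transpose, F.pq,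
    Matrix.transpose_zero]

theorem pJ : pᵀ * J = qᵀ := by
  rw [← F.Jp, Matrix.transpose_mul, F.Jt]

theorem qJ : qᵀ * J = pᵀ := by
  rw [← F.Jq, Matrix.transpose_mul, F.Jt]

theorem pS : pᵀ * S = Matrix.diagonal s * pᵀ := by
  rw [F.eq, Matrix.mul_sub]
  simp only [← Matrix.mul_assoc]
  rw [F.pp, F.pq]
  simp

theorem qS : qᵀ * S = -(Matrix.diagonal s * qᵀ) := by
  rw [F.eq, Matrix.mul_sub]
  simp only [← Matrix.mul_assoc]
  rw [F.qq, F.qp]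
  simp

theorem p_kerPart (W : Matrix ι h ℝ) : pᵀ * kerPart p q W = 0 := by
  rw [kerPart, Matrix.mul_sub, Matrix.mul_sub, ← Matrix.mul_assoc pᵀ p, ← Matrix.mul_assoc pᵀ q,
    F.pp, F.pq]
  simp

theorem q_kerPart (W : Matrix ι h ℝ) : qᵀ * kerPart p q W = 0 := by
  rw [kerPart, Matrix.mul_sub, Matrix.mul_sub, ← Matrix.mul_assoc qᵀ p, ← Matrix.mul_assoc qᵀ q,
    F.qq, F.qp]
  simp

theorem p_velocity (W : Matrix ι h ℝ) : pᵀ * velocity S J E W =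
    Matrix.diagonal s * (pᵀ * W) - (1 / 2 : ℝ) • ((pᵀ * W) * (Wᵀ * W)) +
      (1 / 2 : ℝ) • ((qᵀ * W) * imbalance J W) + pᵀ * (E * W) := by
  simp only [velocity, Matrix.mul_add, Matrix.mul_sub, Matrix.mul_smul, ← Matrix.mul_assoc, F.pS,
    F.pJ]

theorem q_velocity (W : Matrix ι h ℝ) : qᵀ * velocity S J E W =
    -(Matrix.diagonal s * (qᵀ * W)) - (1 / 2 : ℝ) • ((qᵀ * W) * (Wᵀ * W)) +
      (1 / 2 : ℝ) • ((pᵀ * W) * imbalance J W) + qᵀ * (E * W) := by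
  simp only [velocity, Matrix.mul_add, Matrix.mul_sub, Matrix.mul_smul, ← Matrix.mul_assoc, F.qS,
    F.qJ, Matrix.neg_mul]

/-- In the kernel of `S` there is no linear term: the damping, the imbalance and the perturbation
remain. -/
theorem kerPart_velocity (W : Matrix ι h ℝ) : kerPart p q (velocity S J E W) =
    -((1 / 2 : ℝ) • (kerPart p q W * (Wᵀ * W))) +
      (1 / 2 : ℝ) • (J * kerPart p q W * imbalance J W) + kerPart p q (E * W) := by
  have hJ : J * kerPart p q W = J * W - q * (pᵀ * W) - p * (qᵀ * W) := by
    rw [kerPart, Matrix.mul_sub, Matrix.mul_sub, ← Matrix.mul_assoc J p, ← Matrix.mul_assoc J q,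
      F.Jp, F.Jq]
  rw [hJ]
  conv_lhs => rw [kerPart, F.p_velocity, F.q_velocity, velocity, F.eq]
  simp only [kerPart, Matrix.mul_add, Matrix.mul_sub, Matrix.sub_mul, Matrix.mul_smul,
    Matrix.mul_neg, Matrix.mul_assoc, smul_sub]
  abel

theorem vnorm_sq_split (W : Matrix ι h ℝ) (x : h → ℝ) : vnorm (W *ᵥ x) ^ 2 =
    vnorm ((pᵀ * W) *ᵥ x) ^ 2 + vnorm ((qᵀ * W) *ᵥ x) ^ 2 + vnorm (kerPart p q W *ᵥ x) ^ 2 := by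
  have h1 : W *ᵥ x = p *ᵥ ((pᵀ * W) *ᵥ x) + q *ᵥ ((qᵀ * W) *ᵥ x) + kerPart p q W *ᵥ x := by
    rw [Matrix.mulVec_mulVec, Matrix.mulVec_mulVec, ← Matrix.add_mulVec, ← Matrix.add_mulVec,
      kerPart]
    congr 1
    abel
  have h2 : ∀ (z : κ → ℝ), (p *ᵥ z) ⬝ᵥ (kerPart p q W *ᵥ x) = 0 := fun z => by
    rw [← dotProduct_transpose_mulVec, Matrix.mulVec_mulVec, F.p_kerPart]; simp
  have h3 : ∀ (z : κ → ℝ), (q *ᵥ z) ⬝ᵥ (kerPart p q W *ᵥ x) = 0 := fun z => by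
    rw [← dotProduct_transpose_mulVec, Matrix.mulVec_mulVec, F.q_kerPart]; simp
  have h4 : ∀ (z w : κ → ℝ), (p *ᵥ z) ⬝ᵥ (q *ᵥ w) = 0 := fun z w => by
    rw [← dotProduct_transpose_mulVec, Matrix.mulVec_mulVec, F.pq]; simp
  rw [← vnorm_mulVec_of_orthonormal F.pp ((pᵀ * W) *ᵥ x),
    ← vnorm_mulVec_of_orthonormal F.qq ((qᵀ * W) *ᵥ x)]
  conv_lhs => rw [h1]
  simp only [vnorm_sq, add_dotProduct, dotProduct_add, h2, h3, h4]
  rw [dotProduct_comm (q *ᵥ _) (p *ᵥ _), h4, dotProduct_comm (kerPart p q W *ᵥ x) (p *ᵥ _), h2,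
    dotProduct_comm (kerPart p q W *ᵥ x) (q *ᵥ _), h3]
  ring

/-- Since `J` exchanges `p` and `q`, each product in the imbalance has a `q`-part or two kernel
parts as factors. Hence these parts control it, even when the `p`-part is large. -/
theorem imbalance_eq (W : Matrix ι h ℝ) : imbalance J W = (pᵀ * W)ᵀ * (qᵀ * W) +
    (qᵀ * W)ᵀ * (pᵀ * W) + (kerPart p q W)ᵀ * J * kerPart p q W := by
  have hJ : J * kerPart p q W = J * W - q * (pᵀ * W) - p * (qᵀ * W) := by
    rw [kerPart, Matrix.mul_sub, Matrix.mul_sub, ← Matrix.mul_assoc J p, ← Matrix.mul_assoc J q,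
      F.Jp, F.Jq]
  have hp : (kerPart p q W)ᵀ * p = 0 := by
    rw [← Matrix.transpose_inj, Matrix.transpose_mul, Matrix.transpose_transpose, F.p_kerPart,
      Matrix.transpose_zero]
  have hq : (kerPart p q W)ᵀ * q = 0 := by
    rw [← Matrix.transpose_inj, Matrix.transpose_mul, Matrix.transpose_transpose, F.q_kerPart,
      Matrix.transpose_zero]
  rw [Matrix.mul_assoc, hJ, Matrix.mul_sub, Matrix.mul_sub, ← Matrix.mul_assoc _ q,
    ← Matrix.mul_assoc _ p, hp, hq, kerPart]
  simp only [Matrix.transpose_sub, Matrix.transpose_mul, Matrix.transpose_transpose, Matrix.sub_mul,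
    Matrix.mul_assoc, Matrix.zero_mul, sub_zero]
  rw [← Matrix.mul_assoc pᵀ J, ← Matrix.mul_assoc qᵀ J, F.pJ, F.qJ, imbalance, Matrix.mul_assoc]
  abel

theorem vnorm_J (w : ι → ℝ) : vnorm (J *ᵥ w) = vnorm w :=
  vnorm_mulVec_of_orthonormal (by rw [F.Jt, F.JJ]) w

theorem vnorm_p_le (W : Matrix ι h ℝ) (x : h → ℝ) :
    vnorm ((pᵀ * W) *ᵥ x) ≤ vnorm (W *ᵥ x) := by
  rw [← Matrix.mulVec_mulVec]
  exact vnorm_transpose_mulVec_le F.pp _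

theorem vnorm_q_le (W : Matrix ι h ℝ) (x : h → ℝ) :
    vnorm ((qᵀ * W) *ᵥ x) ≤ vnorm (W *ᵥ x) := by
  rw [← Matrix.mulVec_mulVec]
  exact vnorm_transpose_mulVec_le F.qq _

theorem vnorm_ker_le (W : Matrix ι h ℝ) (x : h → ℝ) :
    vnorm (kerPart p q W *ᵥ x) ≤ vnorm (W *ᵥ x) := by
  rw [← sq_le_sq₀ (vnorm_nonneg _) (vnorm_nonneg _), F.vnorm_sq_split W x]
  nlinarith [sq_nonneg (vnorm ((pᵀ * W) *ᵥ x)), sq_nonneg (vnorm ((qᵀ * W) *ᵥ x))]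

theorem opNorm_p_le (W : Matrix ι h ℝ) : ‖pᵀ * W‖ ≤ ‖W‖ :=
  opNorm_le (norm_nonneg _) fun x => (F.vnorm_p_le W x).trans (vnorm_mulVec_le W x)

theorem vnorm_imbalance_le (W : Matrix ι h ℝ) (x : h → ℝ) :
    vnorm (imbalance J W *ᵥ x) ≤ ‖W‖ * vnorm (W *ᵥ x) := by
  rw [imbalance, ← Matrix.mulVec_mulVec, ← Matrix.mulVec_mulVec]
  refine (vnorm_mulVec_le _ _).trans_eq ?_
  rw [opNorm_transpose, F.vnorm_J]

/-! ### Rates of change at the barriers -/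

variable {W : Matrix ι h ℝ} {x : h → ℝ} {b e ν σ : ℝ}

omit F in
theorem vnorm_E_le (he : ‖E‖ ≤ e) (y : h → ℝ) :
    vnorm (E *ᵥ (W *ᵥ y)) ≤ e * vnorm (W *ᵥ y) :=
  (vnorm_mulVec_le _ _).trans (mul_le_mul_of_nonneg_right he (vnorm_nonneg _))

omit F in
theorem diagonal_bounds (hσ : ∀ i, σ ≤ s i) (z : κ → ℝ) :
    σ * vnorm z ^ 2 ≤ z ⬝ᵥ (Matrix.diagonal s *ᵥ z) := by
  rw [vnorm_sq, dotProduct, dotProduct, Finset.mul_sum]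
  refine Finset.sum_le_sum fun i _ => ?_
  rw [Matrix.mulVec_diagonal]
  nlinarith [hσ i, mul_self_nonneg (z i)]

/-- The `q`-part decays at rate `σ`, up to forcing by the imbalance and the perturbation. -/
theorem q_contact (hσ : ∀ i, σ ≤ s i) (hb : ‖W‖ ≤ b) (hν : ‖imbalance J W‖ ≤ ν) (he : ‖E‖ ≤ e)
    {c : ℝ} (hc : 0 < c) (hlt : b * (ν / 2 + e) < c * σ) (hx : vnorm x = 1)
    (hcon : (qᵀ * W)ᵀ *ᵥ ((qᵀ * W) *ᵥ x) = c ^ 2 • x) :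
    ((qᵀ * W) *ᵥ x) ⬝ᵥ ((qᵀ * velocity S J E W) *ᵥ x) < 0 := by
  set C := qᵀ * W with hC
  have hb0 : 0 ≤ b := (norm_nonneg _).trans hb
  have hcx : vnorm (C *ᵥ x) = c := by
    rw [← sq_eq_sq₀ (vnorm_nonneg _) hc.le, vnorm_sq, ← dotProduct_transpose_mulVec, hcon,
      dotProduct_smul, ← vnorm_sq, hx]
    simp
  have hG : (C *ᵥ x) ⬝ᵥ (C *ᵥ ((Wᵀ * W) *ᵥ x)) = c ^ 2 * vnorm (W *ᵥ x) ^ 2 := by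
    rw [dotProduct_mulVec_eq, hcon, smul_dotProduct, dotProduct_gram, smul_eq_mul]
  have hWx : vnorm (W *ᵥ x) ≤ b := by
    have := vnorm_mulVec_le W x
    rw [hx, mul_one] at this
    exact this.trans hb
  have h1 := diagonal_bounds hσ (C *ᵥ x)
  have h2 : (C *ᵥ x) ⬝ᵥ ((pᵀ * W) *ᵥ (imbalance J W *ᵥ x)) ≤ c * (b * ν) := by
    refine (dotProduct_le _ _).trans ?_
    rw [hcx]
    have h3 := vnorm_mulVec_le (pᵀ * W) (imbalance J W *ᵥ x)
    have h4 := vnorm_mulVec_le (imbalance J W) x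
    rw [hx, mul_one] at h4
    have h5 : ‖pᵀ * W‖ ≤ b := (F.opNorm_p_le W).trans hb
    have h6 := mul_le_mul h5 (h4.trans hν) (vnorm_nonneg _) hb0
    exact mul_le_mul_of_nonneg_left (h3.trans h6) hc.le
  have h3 : (C *ᵥ x) ⬝ᵥ (qᵀ *ᵥ (E *ᵥ (W *ᵥ x))) ≤ c * (e * b) := by
    refine (dotProduct_le _ _).trans ?_
    rw [hcx]
    have h4 := (vnorm_transpose_mulVec_le F.qq (E *ᵥ (W *ᵥ x))).trans (vnorm_E_le he x)
    have := (norm_nonneg _).trans he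
    exact mul_le_mul_of_nonneg_left (h4.trans (by gcongr)) hc.le
  rw [F.q_velocity]
  simp only [Matrix.add_mulVec, Matrix.sub_mulVec, Matrix.neg_mulVec, Matrix.smul_mulVec,
    dotProduct_add, dotProduct_sub, dotProduct_neg, dotProduct_smul, smul_eq_mul,
    ← Matrix.mulVec_mulVec x (qᵀ), ← Matrix.mulVec_mulVec x E W]
  rw [← Matrix.mulVec_mulVec x (Matrix.diagonal s), ← hC, ← Matrix.mulVec_mulVec x C,
    ← Matrix.mulVec_mulVec x (pᵀ * W), hG]
  rw [hcx] at h1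
  have h4 := mul_lt_mul_of_pos_left hlt hc
  nlinarith [mul_nonneg (sq_nonneg c) (sq_nonneg (vnorm (W *ᵥ x)))]

end Frame
end Frame

section Frame

variable {ι κ h : Type*} [Fintype ι] [Fintype κ] [Fintype h] [DecidableEq ι] [DecidableEq κ]
  [DecidableEq h]

namespace Frame

variable {S J E : Matrix ι ι ℝ} {p q : Matrix ι κ ℝ} {s : κ → ℝ} (F : Frame S J p q s)
include F

variable {W : Matrix ι h ℝ} {x : h → ℝ} {b e ν σ : ℝ}

theorem dotProduct_kerPart (Z W : Matrix ι h ℝ) (x y : h → ℝ) :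
    (kerPart p q W *ᵥ x) ⬝ᵥ (kerPart p q Z *ᵥ y) = (kerPart p q W *ᵥ x) ⬝ᵥ (Z *ᵥ y) := by
  have h2 : ∀ (z : κ → ℝ), (kerPart p q W *ᵥ x) ⬝ᵥ (p *ᵥ z) = 0 := fun z => by
    rw [dotProduct_comm, ← dotProduct_transpose_mulVec, Matrix.mulVec_mulVec, F.p_kerPart]; simp
  have h3 : ∀ (z : κ → ℝ), (kerPart p q W *ᵥ x) ⬝ᵥ (q *ᵥ z) = 0 := fun z => by
    rw [dotProduct_comm, ← dotProduct_transpose_mulVec, Matrix.mulVec_mulVec, F.q_kerPart]; simp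
  conv_lhs => rw [kerPart.eq_1 p q Z]
  rw [Matrix.sub_mulVec, Matrix.sub_mulVec, dotProduct_sub, dotProduct_sub,
    ← Matrix.mulVec_mulVec y p, ← Matrix.mulVec_mulVec y q, h2, h3]
  ring

/-- The part in the kernel of `S` cannot exceed the square root of the imbalance: beyond that, the
damping `-½ W Wᵀ W` wins. -/
theorem ker_contact (hν : ‖imbalance J W‖ ≤ ν) (he : ‖E‖ ≤ e)
    {c : ℝ} (hc : 0 < c) (hlt : ν + 2 * e < c ^ 2) (hx : vnorm x = 1)
    (hD : ‖kerPart p q W‖ ≤ c)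
    (hcon : (kerPart p q W)ᵀ *ᵥ (kerPart p q W *ᵥ x) = c ^ 2 • x) :
    (kerPart p q W *ᵥ x) ⬝ᵥ (kerPart p q (velocity S J E W) *ᵥ x) < 0 := by
  set D := kerPart p q W with hDdef
  have hcx : vnorm (D *ᵥ x) = c := by
    rw [← sq_eq_sq₀ (vnorm_nonneg _) hc.le, vnorm_sq, ← dotProduct_transpose_mulVec, hcon,
      dotProduct_smul, ← vnorm_sq, hx]
    simp
  have hG : (D *ᵥ x) ⬝ᵥ (D *ᵥ ((Wᵀ * W) *ᵥ x)) = c ^ 2 * vnorm (W *ᵥ x) ^ 2 := by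
    rw [dotProduct_mulVec_eq, hcon, smul_dotProduct, dotProduct_gram, smul_eq_mul]
  have hν0 : 0 ≤ ν := (norm_nonneg _).trans hν
  have he0 : 0 ≤ e := (norm_nonneg _).trans he
  have hw : c ≤ vnorm (W *ᵥ x) := hcx.symm.trans_le (F.vnorm_ker_le W x)
  have h2 : (D *ᵥ x) ⬝ᵥ (J *ᵥ (D *ᵥ (imbalance J W *ᵥ x))) ≤ c * (c * ν) := by
    refine (dotProduct_le _ _).trans ?_
    rw [hcx, F.vnorm_J]
    have h4 := vnorm_mulVec_le (imbalance J W) x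
    rw [hx, mul_one] at h4
    exact mul_le_mul_of_nonneg_left ((vnorm_mulVec_le _ _).trans
      (mul_le_mul hD (h4.trans hν) (vnorm_nonneg _) hc.le)) hc.le
  have h3 : (D *ᵥ x) ⬝ᵥ (E *ᵥ (W *ᵥ x)) ≤ c * (e * vnorm (W *ᵥ x)) := by
    refine (dotProduct_le _ _).trans ?_
    rw [hcx]
    exact mul_le_mul_of_nonneg_left (vnorm_E_le he x) hc.le
  rw [F.kerPart_velocity, Matrix.add_mulVec, Matrix.add_mulVec, dotProduct_add, dotProduct_add,
    F.dotProduct_kerPart, Matrix.neg_mulVec, dotProduct_neg, ← hDdef]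
  simp only [Matrix.smul_mulVec, dotProduct_smul, smul_eq_mul]
  rw [← Matrix.mulVec_mulVec x E, ← Matrix.mulVec_mulVec x D, hG, ← Matrix.mulVec_mulVec x (J * D),
    ← Matrix.mulVec_mulVec _ J D]
  set w := vnorm (W *ᵥ x)
  -- As `w ≥ c` and `c² > 2 e`, the damping net of the perturbation, `½ (c² - 2 e) w²`, is at least
  -- `½ (c² - 2 e) c²`, which exceeds the contribution `½ c² ν` of the imbalance.
  have h4 : c * (e * w) ≤ e * w ^ 2 := by
    have := mul_le_mul_of_nonneg_left hw (mul_nonneg he0 (hc.le.trans hw))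
    nlinarith
  have h5 : 0 ≤ (c ^ 2 - 2 * e) * (w ^ 2 - c ^ 2) :=
    mul_nonneg (by linarith) (sub_nonneg.2 (pow_le_pow_left₀ hc.le hw 2))
  have h6 := mul_lt_mul_of_pos_left hlt (pow_pos hc 2)
  nlinarith

/-- The rate of change of `A Aᵀ`, where `A = pᵀ W`, in a direction `u` with `v = Aᵀ u`. -/
theorem p_rate (W : Matrix ι h ℝ) (u : κ → ℝ) :
    ((pᵀ * W)ᵀ *ᵥ u) ⬝ᵥ ((pᵀ * velocity S J E W)ᵀ *ᵥ u) =
      (Matrix.diagonal s *ᵥ u) ⬝ᵥ ((pᵀ * W) *ᵥ ((pᵀ * W)ᵀ *ᵥ u)) -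
        1 / 2 * vnorm (W *ᵥ ((pᵀ * W)ᵀ *ᵥ u)) ^ 2 +
        1 / 2 * (u ⬝ᵥ ((qᵀ * W) *ᵥ (imbalance J W *ᵥ ((pᵀ * W)ᵀ *ᵥ u)))) +
        (p *ᵥ u) ⬝ᵥ (E *ᵥ (W *ᵥ ((pᵀ * W)ᵀ *ᵥ u))) := by
  set v := (pᵀ * W)ᵀ *ᵥ u with hv
  rw [dotProduct_transpose_mulVec, dotProduct_comm, F.p_velocity]
  simp only [Matrix.add_mulVec, Matrix.sub_mulVec, Matrix.smul_mulVec, dotProduct_add,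
    dotProduct_sub, dotProduct_smul, smul_eq_mul]
  rw [← Matrix.mulVec_mulVec v pᵀ (E * W), ← Matrix.mulVec_mulVec v E W,
    ← Matrix.mulVec_mulVec v (Matrix.diagonal s) (pᵀ * W),
    ← Matrix.mulVec_mulVec v (pᵀ * W) (Wᵀ * W),
    ← Matrix.mulVec_mulVec v (qᵀ * W) (imbalance J W), dotProduct_mulVec_eq (Matrix.diagonal s),
    dotProduct_mulVec_eq (pᵀ * W) u, ← hv,
    dotProduct_gram, dotProduct_mulVec_eq pᵀ, Matrix.diagonal_transpose,
    Matrix.transpose_transpose]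

/-- `A Aᵀ ≤ 2 diag(s) + ω` is preserved: without perturbation this is the comparison principle for
the Riccati equation. -/
theorem p_upper_contact (hσ : ∀ i, σ ≤ s i) (hb : ‖W‖ ≤ b) (hν : ‖imbalance J W‖ ≤ ν)
    (he : ‖E‖ ≤ e) {c ω : ℝ} (hC : ‖qᵀ * W‖ ≤ c) (hω : 0 < ω)
    (hlt : b * (c * ν) + 2 * (e * b ^ 2) < 2 * ω * σ) {u : κ → ℝ} (hu : vnorm u = 1)
    (hcon : (pᵀ * W) *ᵥ ((pᵀ * W)ᵀ *ᵥ u) = (2 : ℝ) • (Matrix.diagonal s *ᵥ u) + ω • u) :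
    ((pᵀ * W)ᵀ *ᵥ u) ⬝ᵥ ((pᵀ * velocity S J E W)ᵀ *ᵥ u) < 0 := by
  have hb0 : 0 ≤ b := (norm_nonneg _).trans hb
  have hc0 : 0 ≤ c := (norm_nonneg _).trans hC
  have hν0 : 0 ≤ ν := (norm_nonneg _).trans hν
  have he0 : 0 ≤ e := (norm_nonneg _).trans he
  rw [F.p_rate]
  have hvb : vnorm ((pᵀ * W)ᵀ *ᵥ u) ≤ b := by
    have := vnorm_mulVec_le (pᵀ * W)ᵀ u
    rw [hu, mul_one, opNorm_transpose] at this
    exact this.trans ((F.opNorm_p_le W).trans hb)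
  set v := (pᵀ * W)ᵀ *ᵥ u
  have h1 : u ⬝ᵥ ((qᵀ * W) *ᵥ (imbalance J W *ᵥ v)) ≤ b * (c * ν) := by
    refine (dotProduct_le _ _).trans ?_
    rw [hu, one_mul]
    calc vnorm ((qᵀ * W) *ᵥ (imbalance J W *ᵥ v)) ≤ c * (ν * b) :=
          (vnorm_mulVec_le _ _).trans (mul_le_mul hC ((vnorm_mulVec_le _ _).trans
            (mul_le_mul hν hvb (vnorm_nonneg _) hν0)) (vnorm_nonneg _) hc0)
      _ = b * (c * ν) := by ring
  have hWv : vnorm (W *ᵥ v) ≤ b * b :=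
    (vnorm_mulVec_le _ _).trans (mul_le_mul hb hvb (vnorm_nonneg _) hb0)
  have h2 : (p *ᵥ u) ⬝ᵥ (E *ᵥ (W *ᵥ v)) ≤ e * b ^ 2 := by
    refine (dotProduct_le _ _).trans ?_
    rw [vnorm_mulVec_of_orthonormal F.pp, hu, one_mul, sq]
    exact (vnorm_E_le he v).trans (mul_le_mul_of_nonneg_left hWv he0)
  have h3 := pow_le_pow_left₀ (vnorm_nonneg _) (F.vnorm_p_le W v) 2
  have h4 := diagonal_bounds hσ u
  rw [hu, one_pow, mul_one, dotProduct_comm] at h4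
  have huu : u ⬝ᵥ u = 1 := by rw [← vnorm_sq, hu, one_pow]
  rw [vnorm_sq, hcon] at h3
  rw [hcon]
  simp only [add_dotProduct, dotProduct_add, smul_dotProduct, dotProduct_smul, smul_eq_mul,
    huu] at h3 ⊢
  rw [dotProduct_comm u] at h3
  nlinarith

/-- Growth of the smallest singular value of `A = pᵀ W` from below, as long as it is not too small
compared with the size `ψ` of the weights on the kernel of `A`. -/
theorem p_lower_contact (hσ : ∀ i, σ ≤ s i) (hb : ‖W‖ ≤ b) (he : ‖E‖ ≤ e) {c d ψ α f : ℝ}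
    (hC : ‖qᵀ * W‖ ≤ c) (hD : ‖kerPart p q W‖ ≤ d) (hα : 1 ≤ α) (hf : 0 < f)
    (hψ : ψ ^ 2 ≤ 2 * α ^ 4 * f)
    (hcone : ∀ y, vnorm ((qᵀ * W) *ᵥ y) ^ 2 + vnorm (kerPart p q W *ᵥ y) ^ 2 ≤
      1 / 4 * vnorm ((pᵀ * W) *ᵥ y) ^ 2 + ψ ^ 2 * vnorm y ^ 2)
    {μ : ℝ} (hlt : c ^ 2 + d ^ 2 + 2 * α ^ 2 * (c * b + 2 * e) < 2 * σ - μ) {u : κ → ℝ}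
    (hu : vnorm u = 1) (hcon : (pᵀ * W) *ᵥ ((pᵀ * W)ᵀ *ᵥ u) = f • u) :
    μ * f - f ^ 2 < 2 * (((pᵀ * W)ᵀ *ᵥ u) ⬝ᵥ ((pᵀ * velocity S J E W)ᵀ *ᵥ u)) := by
  have hb0 : 0 ≤ b := (norm_nonneg _).trans hb
  have hc0 : 0 ≤ c := (norm_nonneg _).trans hC
  have hd0 : 0 ≤ d := (norm_nonneg _).trans hD
  have he0 : 0 ≤ e := (norm_nonneg _).trans he
  rw [F.p_rate]
  have huu : u ⬝ᵥ u = 1 := by rw [← vnorm_sq, hu, one_pow]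
  have hv : vnorm ((pᵀ * W)ᵀ *ᵥ u) ^ 2 = f := by
    rw [vnorm_sq, ← dotProduct_mulVec_eq, hcon, dotProduct_smul, huu, smul_eq_mul, mul_one]
  set v := (pᵀ * W)ᵀ *ᵥ u
  have hAv : vnorm ((pᵀ * W) *ᵥ v) ^ 2 = f ^ 2 := by
    rw [hcon, vnorm_smul, hu, mul_one, sq_abs]
  have hCv := pow_le_pow_left₀ (vnorm_nonneg _)
    ((vnorm_mulVec_le (qᵀ * W) v).trans (mul_le_mul_of_nonneg_right hC (vnorm_nonneg v))) 2
  have hDv := pow_le_pow_left₀ (vnorm_nonneg _)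
    ((vnorm_mulVec_le (kerPart p q W) v).trans (mul_le_mul_of_nonneg_right hD (vnorm_nonneg v))) 2
  rw [mul_pow, hv] at hCv hDv
  have hsplit := F.vnorm_sq_split W v
  have hWv : vnorm (W *ᵥ v) ≤ 2 * α ^ 2 * f := by
    rw [← sq_le_sq₀ (vnorm_nonneg _) (by positivity), hsplit, hAv]
    have := hcone v
    rw [hAv, hv] at this
    have h1 : 1 ≤ α ^ 4 := one_le_pow₀ hα
    have h2 := mul_le_mul_of_nonneg_right hψ hf.le
    have h3 := mul_le_mul_of_nonneg_right h1 (sq_nonneg f)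
    nlinarith
  have h1 : -(c * b * (2 * α ^ 2 * f)) ≤ u ⬝ᵥ ((qᵀ * W) *ᵥ (imbalance J W *ᵥ v)) := by
    refine le_trans (neg_le_neg ?_) (neg_le_dotProduct _ _)
    rw [hu, one_mul, mul_assoc]
    exact (vnorm_mulVec_le _ _).trans (mul_le_mul hC ((F.vnorm_imbalance_le W v).trans
      (mul_le_mul hb hWv (vnorm_nonneg _) hb0)) (vnorm_nonneg _) hc0)
  have h2 : -(e * (2 * α ^ 2 * f)) ≤ (p *ᵥ u) ⬝ᵥ (E *ᵥ (W *ᵥ v)) := by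
    refine le_trans (neg_le_neg ?_) (neg_le_dotProduct _ _)
    rw [vnorm_mulVec_of_orthonormal F.pp, hu, one_mul]
    exact (vnorm_E_le he v).trans (mul_le_mul_of_nonneg_left hWv he0)
  have h4 := diagonal_bounds hσ u
  rw [hu, one_pow, mul_one, dotProduct_comm] at h4
  have h5 : (Matrix.diagonal s *ᵥ u) ⬝ᵥ ((pᵀ * W) *ᵥ v) =
      f * ((Matrix.diagonal s *ᵥ u) ⬝ᵥ u) := by rw [hcon, dotProduct_smul, smul_eq_mul]
  rw [h5, hsplit, hAv]
  have h6 := mul_le_mul_of_nonneg_left h4 hf.le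
  have h7 := mul_lt_mul_of_pos_right hlt hf
  nlinarith

omit F in
/-- The quadratic form inequality behind `cone_contact`. -/
theorem cone_scalar {a c d g σ ψ2 bc bd cc cd dd ω e : ℝ} (ha : 0 ≤ a) (hc : 0 ≤ c) (hd : 0 ≤ d)
    (hg : 0 < g) (hψ2 : 0 < ψ2) (hcon : c ^ 2 + d ^ 2 = 1 / 4 * a ^ 2 + ψ2) (hσ : 64 * g ≤ σ)
    (hbc : bc ≤ 1 / 2 * g) (hbd : bd ≤ 27 / 8 * g) (hcc : cc ≤ 1 / 100 * g)
    (hcd : cd ≤ 1 / 80 * g) (hdd : dd ≤ 1 / 12 * g) (hω : ω ≤ 1 / 100 * g)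
    (he : e ≤ 1 / 100 * g) :
    0 < 32 / 5 * g * ψ2 + 1 / 2 * σ * a ^ 2 - ω * c ^ 2 - bc * (c * a) - bd * (c * d) -
      (bd * (c * d) + cd * (d * a) + dd * d ^ 2) -
      1 / 4 * (bc * (a * c) + cc * a ^ 2 + cd * (a * d)) -
      e * ((1 / 2 * a + 2 * c + 2 * d) * (a + c + d)) := by
  have hpos : 0 < c ^ 2 + d ^ 2 := by nlinarith [sq_nonneg a]
  have ha2 := sq_nonneg a
  have h1 := mul_le_mul_of_nonneg_right hσ ha2
  have h2 := mul_le_mul_of_nonneg_right hω (sq_nonneg c)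
  have h3 := mul_le_mul_of_nonneg_right hbc (mul_nonneg hc ha)
  have h4 := mul_le_mul_of_nonneg_right hbd (mul_nonneg hc hd)
  have h5 := mul_le_mul_of_nonneg_right hcd (mul_nonneg hd ha)
  have h6 := mul_le_mul_of_nonneg_right hdd (sq_nonneg d)
  have h7 := mul_le_mul_of_nonneg_right hcc ha2
  have h8 := mul_le_mul_of_nonneg_right he
    (show 0 ≤ (1 / 2 * a + 2 * c + 2 * d) * (a + c + d) by positivity)
  have hψeq : ψ2 = c ^ 2 + d ^ 2 - 1 / 4 * a ^ 2 := by linarith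
  have key : 0 < g * (32 / 5 * (c ^ 2 + d ^ 2 - 1 / 4 * a ^ 2) + 32 * a ^ 2 - 1 / 100 * c ^ 2 -
      1 / 2 * (c * a) - 27 / 8 * (c * d) - (27 / 8 * (c * d) + 1 / 80 * (d * a) + 1 / 12 * d ^ 2) -
      1 / 4 * (1 / 2 * (c * a) + 1 / 100 * a ^ 2 + 1 / 80 * (d * a)) -
      1 / 100 * ((1 / 2 * a + 2 * c + 2 * d) * (a + c + d))) := by
    refine mul_pos hg ?_
    linarith [sq_nonneg (c - d), sq_nonneg (c - a), sq_nonneg (d - a), sq_nonneg c, sq_nonneg d]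
  rw [hψeq]
  linarith

/-- The cone condition `‖C y‖² + ‖D y‖² ≤ ¼ ‖A y‖² + ψ² ‖y‖²` is preserved when `ψ²` grows at rate
`6.4 g`. The damping `-½ W Wᵀ W` acts from the right on all parts alike and drops out; the gap
between the eigenvalues `s` and `0` of `S` beats the terms in `A y`. -/
theorem cone_contact (hσ : ∀ i, σ ≤ s i) (he : ‖E‖ ≤ e) {c d ω g ψ : ℝ}
    (hA : ‖pᵀ * W‖ ≤ b) (hC : ‖qᵀ * W‖ ≤ c) (hD : ‖kerPart p q W‖ ≤ d)
    (hX : ∀ u, vnorm ((pᵀ * W)ᵀ *ᵥ u) ^ 2 ≤ 2 * (u ⬝ᵥ (Matrix.diagonal s *ᵥ u)) +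
      ω * vnorm u ^ 2)
    (hg : 0 < g) (hgσ : 64 * g ≤ σ) (hbc : b * c ≤ 1 / 2 * g) (hbd : b * d ≤ 27 / 8 * g)
    (hcc : c * c ≤ 1 / 100 * g) (hcd : c * d ≤ 1 / 80 * g) (hdd : d * d ≤ 1 / 12 * g)
    (hω : ω ≤ 1 / 100 * g) (heg : e ≤ 1 / 100 * g) (hψ : ψ ≠ 0) (hx : vnorm x = 1)
    (hcon : ψ ^ 2 • x + (1 / 4 : ℝ) • ((pᵀ * W)ᵀ *ᵥ ((pᵀ * W) *ᵥ x)) -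
      (qᵀ * W)ᵀ *ᵥ ((qᵀ * W) *ᵥ x) - (kerPart p q W)ᵀ *ᵥ (kerPart p q W *ᵥ x) = 0) :
    0 < 32 / 5 * g * ψ ^ 2 + 1 / 2 * (((pᵀ * W) *ᵥ x) ⬝ᵥ ((pᵀ * velocity S J E W) *ᵥ x)) -
      2 * (((qᵀ * W) *ᵥ x) ⬝ᵥ ((qᵀ * velocity S J E W) *ᵥ x)) -
      2 * ((kerPart p q W *ᵥ x) ⬝ᵥ (kerPart p q (velocity S J E W) *ᵥ x)) := by
  set A := pᵀ * W with hAdef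
  set C := qᵀ * W with hCdef
  set D := kerPart p q W with hDdef
  set N := imbalance J W with hNdef
  have hb0 : 0 ≤ b := (norm_nonneg _).trans hA
  have hc0 : 0 ≤ c := (norm_nonneg _).trans hC
  have hd0 : 0 ≤ d := (norm_nonneg _).trans hD
  have he0 : 0 ≤ e := (norm_nonneg _).trans he
  have hψ2 : 0 < ψ ^ 2 := by positivity
  set va := vnorm (A *ᵥ x) with hva
  set vc := vnorm (C *ᵥ x) with hvc
  set vd := vnorm (D *ᵥ x) with hvd
  have ha : 0 ≤ va := vnorm_nonneg _
  have hc : 0 ≤ vc := vnorm_nonneg _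
  have hd : 0 ≤ vd := vnorm_nonneg _
  have hxx : x ⬝ᵥ x = 1 := by rw [← vnorm_sq, hx, one_pow]
  have hquad : vc ^ 2 + vd ^ 2 = 1 / 4 * va ^ 2 + ψ ^ 2 := by
    have := congrArg (fun z => x ⬝ᵥ z) hcon
    simp only [dotProduct_sub, dotProduct_add, dotProduct_smul, smul_eq_mul, dotProduct_zero,
      dotProduct_transpose_mulVec, ← vnorm_sq, hx] at this
    linarith
  -- Pairing the contact relation `hcon` with `Wᵀ W x` turns the damping of all three parts into a
  -- single term of favourable sign.
  have hdamp : -(1 / 4) * ((A *ᵥ x) ⬝ᵥ (A *ᵥ ((Wᵀ * W) *ᵥ x))) +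
      (C *ᵥ x) ⬝ᵥ (C *ᵥ ((Wᵀ * W) *ᵥ x)) + (D *ᵥ x) ⬝ᵥ (D *ᵥ ((Wᵀ * W) *ᵥ x)) =
      ψ ^ 2 * vnorm (W *ᵥ x) ^ 2 := by
    have := congrArg (fun z => z ⬝ᵥ ((Wᵀ * W) *ᵥ x)) hcon
    simp only [sub_dotProduct, add_dotProduct, smul_dotProduct, smul_eq_mul, zero_dotProduct,
      ← dotProduct_mulVec_eq, dotProduct_gram] at this
    linarith
  have hw : vnorm (W *ᵥ x) ≤ va + vc + vd := by
    rw [← sq_le_sq₀ (vnorm_nonneg _) (by positivity), F.vnorm_sq_split W x]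
    linarith [mul_nonneg ha hc, mul_nonneg ha hd, mul_nonneg hc hd]
  have hEw : vnorm (E *ᵥ (W *ᵥ x)) ≤ e * (va + vc + vd) :=
    (vnorm_E_le he x).trans (mul_le_mul_of_nonneg_left hw he0)
  have hN : N *ᵥ x = Aᵀ *ᵥ (C *ᵥ x) + Cᵀ *ᵥ (A *ᵥ x) + Dᵀ *ᵥ (J *ᵥ (D *ᵥ x)) := by
    rw [hNdef, F.imbalance_eq W]
    simp only [Matrix.add_mulVec, ← Matrix.mulVec_mulVec, ← hAdef, ← hCdef, ← hDdef]
  have tA : vnorm (Aᵀ *ᵥ (C *ᵥ x)) ≤ b * vc := by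
    refine (vnorm_mulVec_le _ _).trans ?_
    rw [opNorm_transpose]; exact mul_le_mul_of_nonneg_right hA hc
  have tC : vnorm (Cᵀ *ᵥ (A *ᵥ x)) ≤ c * va := by
    refine (vnorm_mulVec_le _ _).trans ?_
    rw [opNorm_transpose]; exact mul_le_mul_of_nonneg_right hC ha
  have tD : vnorm (Dᵀ *ᵥ (J *ᵥ (D *ᵥ x))) ≤ d * vd := by
    refine (vnorm_mulVec_le _ _).trans ?_
    rw [opNorm_transpose, F.vnorm_J]; exact mul_le_mul_of_nonneg_right hD hd
  have hNx : vnorm (N *ᵥ x) ≤ b * vc + c * va + d * vd := by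
    rw [hN]
    exact (vnorm_add_le _ _).trans (add_le_add ((vnorm_add_le _ _).trans (add_le_add tA tC)) tD)
  -- The imbalance contains `Aᵀ C`, which can amplify `C` by `‖Aᵀ C x‖² ≤ 2 ⟨C x, diag(s) C x⟩`, up
  -- to `ω`; this is exactly what the decay rate `s` of the `q`-part absorbs.
  have i1 : (C *ᵥ x) ⬝ᵥ (A *ᵥ (N *ᵥ x)) ≤ 2 * ((C *ᵥ x) ⬝ᵥ (Matrix.diagonal s *ᵥ (C *ᵥ x))) +
      ω * vc ^ 2 + b * c * (vc * va) + b * d * (vc * vd) := by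
    rw [dotProduct_mulVec_eq, hN, dotProduct_add, dotProduct_add, ← vnorm_sq]
    have j1 := hX (C *ᵥ x)
    have j2 := (dotProduct_le (Aᵀ *ᵥ (C *ᵥ x)) (Cᵀ *ᵥ (A *ᵥ x))).trans
      (mul_le_mul tA tC (vnorm_nonneg _) (by positivity))
    have j3 := (dotProduct_le (Aᵀ *ᵥ (C *ᵥ x)) (Dᵀ *ᵥ (J *ᵥ (D *ᵥ x)))).trans
      (mul_le_mul tA tD (vnorm_nonneg _) (by positivity))
    linarith
  have i2 : (D *ᵥ x) ⬝ᵥ (J *ᵥ (D *ᵥ (N *ᵥ x))) ≤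
      b * d * (vc * vd) + c * d * (vd * va) + d * d * vd ^ 2 := by
    refine (dotProduct_le _ _).trans ?_
    rw [F.vnorm_J]
    calc vd * vnorm (D *ᵥ (N *ᵥ x)) ≤ vd * (d * (b * vc + c * va + d * vd)) := by
          refine mul_le_mul_of_nonneg_left ((vnorm_mulVec_le _ _).trans ?_) hd
          exact mul_le_mul hD hNx (vnorm_nonneg _) hd0
      _ = _ := by ring
  have i3 : -(b * c * (va * vc) + c * c * va ^ 2 + c * d * (va * vd)) ≤
      (A *ᵥ x) ⬝ᵥ (C *ᵥ (N *ᵥ x)) := by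
    refine le_trans (neg_le_neg ?_) (neg_le_dotProduct _ _)
    calc va * vnorm (C *ᵥ (N *ᵥ x)) ≤ va * (c * (b * vc + c * va + d * vd)) := by
          refine mul_le_mul_of_nonneg_left ((vnorm_mulVec_le _ _).trans ?_) ha
          exact mul_le_mul hC hNx (vnorm_nonneg _) hc0
      _ = _ := by ring
  have k1 : -(va * (e * (va + vc + vd))) ≤ (A *ᵥ x) ⬝ᵥ (pᵀ *ᵥ (E *ᵥ (W *ᵥ x))) :=
    le_trans (neg_le_neg (mul_le_mul_of_nonneg_left
      ((vnorm_transpose_mulVec_le F.pp _).trans hEw) ha)) (neg_le_dotProduct _ _)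
  have k2 : (C *ᵥ x) ⬝ᵥ (qᵀ *ᵥ (E *ᵥ (W *ᵥ x))) ≤ vc * (e * (va + vc + vd)) :=
    (dotProduct_le _ _).trans (mul_le_mul_of_nonneg_left
      ((vnorm_transpose_mulVec_le F.qq _).trans hEw) hc)
  have k3 : (D *ᵥ x) ⬝ᵥ (E *ᵥ (W *ᵥ x)) ≤ vd * (e * (va + vc + vd)) :=
    (dotProduct_le _ _).trans (mul_le_mul_of_nonneg_left hEw hd)
  have hSA := diagonal_bounds hσ (A *ᵥ x)
  have key := cone_scalar ha hc hd hg hψ2 hquad hgσ hbc hbd hcc hcd hdd hω heg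
  have hdamp0 : 0 ≤ ψ ^ 2 * vnorm (W *ᵥ x) ^ 2 := by positivity
  rw [F.p_velocity, F.q_velocity, F.kerPart_velocity]
  simp only [Matrix.add_mulVec, Matrix.sub_mulVec, Matrix.neg_mulVec, Matrix.smul_mulVec,
    dotProduct_add, dotProduct_sub, dotProduct_neg, dotProduct_smul, smul_eq_mul,
    ← hAdef, ← hCdef, ← hDdef, ← hNdef]
  rw [hDdef, F.dotProduct_kerPart, ← hDdef]
  simp only [← Matrix.mulVec_mulVec x (Matrix.diagonal s), ← Matrix.mulVec_mulVec x A,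
    ← Matrix.mulVec_mulVec x C, ← Matrix.mulVec_mulVec x D, ← Matrix.mulVec_mulVec x pᵀ (E * W),
    ← Matrix.mulVec_mulVec x qᵀ (E * W), ← Matrix.mulVec_mulVec x E W,
    ← Matrix.mulVec_mulVec x (J * D), ← Matrix.mulVec_mulVec _ J D]
  linarith

end Frame
end Frame

/-! ### Barriers for the parts of the weights -/

section Barriers

variable {p q l : Type*} [Fintype p] [Fintype q] [Fintype l]
  [DecidableEq q] [DecidableEq p] [DecidableEq l]

theorem hasDerivWithinAt_const_mul (B : Matrix l p ℝ) {A : ℝ → Matrix p q ℝ} {A' : Matrix p q ℝ}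
    {s : Set ℝ} {t : ℝ} (hA : HasDerivWithinAt A A' s t) :
    HasDerivWithinAt (fun u => B * A u) (B * A') s t := by
  have h := hasDerivWithinAt_matrix_mul (hasDerivWithinAt_const t s B) hA
  rw [Matrix.zero_mul, zero_add] at h
  exact h

/-- `posSemidef_eventually` in terms of quadratic forms. -/
theorem form_nonneg_eventually {M : ℝ → Matrix p p ℝ} {M' : Matrix p p ℝ} {t : ℝ}
    (hsym : ∀ s, (M s)ᵀ = M s) (hderiv : HasDerivWithinAt M M' (Ici t) t)
    (hpsd : ∀ x, 0 ≤ x ⬝ᵥ (M t *ᵥ x))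
    (hpos : ∀ x : p → ℝ, vnorm x = 1 → M t *ᵥ x = 0 → 0 < x ⬝ᵥ (M' *ᵥ x)) :
    ∀ᶠ s in 𝓝[>] t, ∀ x, 0 ≤ x ⬝ᵥ (M s *ᵥ x) := by
  have hherm : ∀ s, (M s).IsHermitian := fun s => by
    rw [Matrix.IsHermitian, Matrix.conjTranspose_eq_transpose_of_trivial, hsym]
  have h := posSemidef_eventually hherm hderiv
    (Matrix.PosSemidef.of_dotProduct_mulVec_nonneg (hherm t) fun x => by simpa using hpsd x) hpos
  filter_upwards [h] with s hs x
  simpa using hs.dotProduct_mulVec_nonneg x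

/-- A bound on the operator norm persists if `‖C x‖` strictly decreases in every direction `x` in
which it is attained. The bound is allowed to depend on time. -/
theorem opNorm_le_eventually {C : ℝ → Matrix p q ℝ} {C' : Matrix p q ℝ} {c : ℝ → ℝ} {c' t : ℝ}
    (hC : HasDerivWithinAt C C' (Ici t) t) (hc' : HasDerivWithinAt c c' (Ici t) t)
    (hc : ∀ s, 0 ≤ c s) (hle : ‖C t‖ ≤ c t)
    (hcontact : ∀ x, vnorm x = 1 → (C t)ᵀ *ᵥ (C t *ᵥ x) = c t ^ 2 • x →
      (C t *ᵥ x) ⬝ᵥ (C' *ᵥ x) < c t * c') :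
    ∀ᶠ s in 𝓝[>] t, ‖C s‖ ≤ c s := by
  have hform : ∀ s x, x ⬝ᵥ ((c s ^ 2 • (1 : Matrix q q ℝ) - (C s)ᵀ * C s) *ᵥ x) =
      c s ^ 2 * vnorm x ^ 2 - vnorm (C s *ᵥ x) ^ 2 := fun s x => by
    rw [Matrix.sub_mulVec, dotProduct_sub, dotProduct_gram, Matrix.smul_mulVec, Matrix.one_mulVec,
      dotProduct_smul, ← vnorm_sq, smul_eq_mul]
  have h := form_nonneg_eventually (M := fun s => c s ^ 2 • (1 : Matrix q q ℝ) - (C s)ᵀ * C s)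
    (t := t) (fun s => by simp)
    (((hc'.pow 2).smul_const (1 : Matrix q q ℝ)).sub (hasDerivWithinAt_gram hC)) ?_ ?_
  · filter_upwards [h] with s hs
    refine opNorm_le (hc s) fun x => ?_
    have := hs x
    rw [hform] at this
    rw [← sq_le_sq₀ (vnorm_nonneg _) (mul_nonneg (hc s) (vnorm_nonneg _)), mul_pow]
    linarith
  · intro x
    rw [hform, sub_nonneg, ← mul_pow]
    exact pow_le_pow_left₀ (vnorm_nonneg _) ((vnorm_mulVec_le _ _).trans
      (mul_le_mul_of_nonneg_right hle (vnorm_nonneg _))) 2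
  · intro x hx hM
    rw [Matrix.sub_mulVec, ← Matrix.mulVec_mulVec, Matrix.smul_mulVec, Matrix.one_mulVec,
      sub_eq_zero] at hM
    have := hcontact x hx hM.symm
    rw [Matrix.sub_mulVec, dotProduct_sub, dotProduct_deriv_gram, Matrix.smul_mulVec,
      Matrix.one_mulVec, dotProduct_smul, ← vnorm_sq, hx, smul_eq_mul]
    simp only [Nat.cast_ofNat, Nat.add_one_sub_one, pow_one]
    linarith

/-- Closedness of the set of times that satisfy a family of inequalities, as continuous induction
needs. -/
theorem isClosed_setOf_forall_le {X : Type*} {K : Set ℝ} (hK : IsClosed K) {f g : X → ℝ → ℝ}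
    (hf : ∀ x, ContinuousOn (f x) K) (hg : ∀ x, ContinuousOn (g x) K) :
    IsClosed {t | t ∈ K ∧ ∀ x, f x t ≤ g x t} := by
  rcases isEmpty_or_nonempty X with hX | hX
  · simpa using hK
  · have : {t | t ∈ K ∧ ∀ x, f x t ≤ g x t} = ⋂ x, {t | t ∈ K ∧ f x t ≤ g x t} := by
      ext t; simp [forall_and]
    rw [this]
    exact isClosed_iInter fun x => hK.isClosed_le (hf x) (hg x)

end Barriers

/-! ### Scalar relations -/

/-- The scalars of the problem: `y = ‖Y‖`, the smallest singular value `σ` of `Y`, and the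
parameters of the initialization. -/
structure Params (y σ δ α ε T : ℝ) : Prop where
  pos_sigma : 0 < σ
  sigma_le : σ ≤ y
  pos_delta : 0 < δ
  one_le_alpha : 1 ≤ α
  delta_le : 64 * (α * δ * y) ≤ σ
  pos_eps : 0 < ε
  eps_le : 3 * α * ε ≤ δ * Real.sqrt y
  T_eq : T * σ = 5 * Real.log (σ / ε ^ 2)

/-- The growing bound for the weights that do not take part in fitting `Y`. -/
def psi (ε g t : ℝ) : ℝ := ε * Real.exp (16 / 5 * g * t)

theorem psi_sq (ε g t : ℝ) : psi ε g t ^ 2 = ε ^ 2 * Real.exp (32 / 5 * g * t) := by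
  rw [psi, mul_pow, ← Real.exp_nat_mul]
  congr 2
  push_cast
  ring

theorem psi_zero (ε g : ℝ) : psi ε g 0 = ε := by simp [psi]

theorem hasDerivAt_psi_sq (ε g t : ℝ) :
    HasDerivAt (fun t => psi ε g t ^ 2) (32 / 5 * g * psi ε g t ^ 2) t := by
  simp only [psi_sq]
  have h := (((hasDerivAt_id t).const_mul (32 / 5 * g)).exp).const_mul (ε ^ 2)
  exact h.congr_deriv (by simp only [id]; ring)

theorem psi_le {ε g t T : ℝ} (hε : 0 < ε) (hg : 0 ≤ g) (ht : t ≤ T) : psi ε g t ≤ psi ε g T := by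
  unfold psi
  gcongr

namespace Params

variable {y σ δ α ε T : ℝ} (H : Params y σ δ α ε T)
include H

theorem pos_alpha : 0 < α := by linarith [H.one_le_alpha]

theorem pos_y : 0 < y := H.pos_sigma.trans_le H.sigma_le

theorem sqrt_pos : 0 < Real.sqrt y := Real.sqrt_pos.2 H.pos_y

theorem sq_sqrt : Real.sqrt y ^ 2 = y := Real.sq_sqrt H.pos_y.le

theorem delta_y_le : 64 * (δ * y) ≤ σ := by
  have h1 := mul_le_mul_of_nonneg_right H.one_le_alpha (mul_pos H.pos_delta H.pos_y).le
  linarith [H.delta_le]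

theorem delta_le' : δ ≤ 1 / 64 := by
  have h1 := H.delta_y_le
  have h2 := H.sigma_le
  have h3 := H.pos_y
  by_contra! h
  nlinarith

theorem delta_sq_le : δ ^ 2 * y ≤ σ / 4096 := by
  have h := mul_le_mul H.delta_le' H.delta_y_le
    (by have := H.pos_delta; have := H.pos_y; positivity) (by norm_num)
  linarith

/-- The scale `δ √y` of the parts that do not fit `Y` is small compared with `√σ`, the scale of the
aligned part after it has grown. -/
theorem delta_sqrt_le : δ * Real.sqrt y ≤ Real.sqrt σ / 64 := by
  rw [← sq_le_sq₀ (mul_nonneg H.pos_delta.le (Real.sqrt_nonneg y)) (by positivity), mul_pow, div_pow,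
    H.sq_sqrt, Real.sq_sqrt H.pos_sigma.le]
  have := H.delta_sq_le
  norm_num
  linarith

theorem eps_sq_le : 9 * α ^ 2 * ε ^ 2 ≤ δ ^ 2 * y := by
  have h := pow_le_pow_left₀ (by have := H.pos_alpha; have := H.pos_eps; positivity) H.eps_le 2
  rw [mul_pow, mul_pow, mul_pow, H.sq_sqrt] at h
  linarith

theorem eps_sq_le' : 9 * ε ^ 2 ≤ δ ^ 2 * y := by
  have h1 : 1 ≤ α ^ 2 := one_le_pow₀ H.one_le_alpha
  nlinarith [H.eps_sq_le, sq_nonneg ε]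

/-- The bounds on `ε` and `δ` combine to `ε² ≤ δ² y / (9 α²)` and `δ y ≤ σ / (64 α)`; note
`36864 = 9 * 64 ^ 2`. -/
theorem eps_sq_mul_le : 36864 * α ^ 4 * y * ε ^ 2 ≤ σ ^ 2 := by
  have hα := H.pos_alpha
  have hy := H.pos_y
  have h1 := pow_le_pow_left₀ (by have := H.pos_delta; positivity) H.delta_le 2
  have h2 := mul_le_mul_of_nonneg_left H.eps_sq_le (show 0 ≤ α ^ 2 * y by positivity)
  nlinarith

theorem ratio_ge : 36864 * α ^ 4 * (y / σ) ≤ σ / ε ^ 2 := by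
  have hσ := H.pos_sigma
  have hε := H.pos_eps
  rw [← mul_div_assoc, div_le_div_iff₀ hσ (by positivity), ← sq]
  exact H.eps_sq_mul_le

theorem ratio_pos : 0 < σ / ε ^ 2 := by
  have := H.pos_sigma
  have := H.pos_eps
  positivity

theorem exp_log : Real.exp (Real.log (σ / ε ^ 2)) = σ / ε ^ 2 := Real.exp_log H.ratio_pos

/-- The logarithm of `σ / ε²` is at least `10`, since `σ / ε² ≥ 36864 > e ^ 10`. -/
theorem le_log : 10 ≤ Real.log (σ / ε ^ 2) := by
  rw [Real.le_log_iff_exp_le H.ratio_pos]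
  refine le_trans ?_ H.ratio_ge
  have h1 : 1 ≤ α ^ 4 := one_le_pow₀ H.one_le_alpha
  have h2 : 1 ≤ y / σ := (one_le_div H.pos_sigma).2 H.sigma_le
  have h3 : Real.exp 10 ≤ 36864 := by
    have h4 : Real.exp 10 = Real.exp 1 ^ 10 := by rw [← Real.exp_nat_mul]; norm_num
    rw [h4]
    calc Real.exp 1 ^ 10 ≤ 2.72 ^ 10 :=
          pow_le_pow_left₀ (Real.exp_pos 1).le (Real.exp_one_lt_d9.le.trans (by norm_num)) 10
      _ ≤ 36864 := by norm_num
  nlinarith [mul_le_mul h1 h2 zero_le_one (by positivity)]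

theorem le_T : 50 ≤ T * σ := by
  rw [H.T_eq]; linarith [H.le_log]

theorem pos_T : 0 < T := by
  by_contra! h
  nlinarith [H.le_T, H.pos_sigma]

theorem psi_pos (t : ℝ) : 0 < psi ε (δ * y) t := mul_pos H.pos_eps (Real.exp_pos _)

/-- Over the whole time interval, `ψ²` grows by a factor of at most `√(σ / ε²)`. -/
theorem psi_T_sq_le : psi ε (δ * y) T ^ 2 ≤ ε * Real.sqrt σ := by
  have h1 : 32 / 5 * (δ * y) * T ≤ Real.log (σ / ε ^ 2) / 2 := by
    have h2 := mul_le_mul_of_nonneg_right H.delta_y_le H.pos_T.le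
    have h3 := H.T_eq
    linarith
  have h4 : Real.exp (Real.log (σ / ε ^ 2) / 2) = Real.sqrt σ / ε := by
    rw [Real.exp_half, H.exp_log, Real.sqrt_div H.pos_sigma.le, Real.sqrt_sq H.pos_eps.le]
  rw [psi_sq]
  calc ε ^ 2 * Real.exp (32 / 5 * (δ * y) * T) ≤ ε ^ 2 * (Real.sqrt σ / ε) := by
        rw [← h4]; gcongr
    _ = ε * Real.sqrt σ := by have := H.pos_eps; field_simp

theorem eps_le_sqrt : ε ≤ Real.sqrt σ := by
  rw [Real.le_sqrt H.pos_eps.le H.pos_sigma.le]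
  have := H.eps_sq_le'
  have := H.delta_sq_le
  nlinarith [H.pos_sigma]

theorem psi_T_sq_le_sigma : psi ε (δ * y) T ^ 2 ≤ σ := by
  refine H.psi_T_sq_le.trans ?_
  have := mul_le_mul_of_nonneg_right H.eps_le_sqrt (Real.sqrt_nonneg σ)
  rwa [Real.mul_self_sqrt H.pos_sigma.le] at this

end Params

/-! ### The trapping region -/

section Trapped

variable {ι κ h : Type*} [Fintype ι] [Fintype κ] [Fintype h] [DecidableEq ι] [DecidableEq κ]
  [DecidableEq h]

/-- The region in which the weights stay at time `t`: the imbalance, the `q`-part and the part in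
the kernel of `S` are small, the `p`-part does not overshoot, and the `q`-part and the kernel part
are controlled by the `p`-part up to `psi`. -/
structure Trapped (J : Matrix ι ι ℝ) (p q : Matrix ι κ ℝ) (s : κ → ℝ) (y δ α ε T t : ℝ)
    (W : Matrix ι h ℝ) : Prop where
  imbalance_le : ‖imbalance J W‖ ≤ ε ^ 2 + 15 / 4 * (δ ^ 2 * y / T) * t
  q_le : ‖qᵀ * W‖ ≤ δ * Real.sqrt y / (3 * α)
  ker_le : ‖kerPart p q W‖ ≤ 9 / 4 * (δ * Real.sqrt y)
  p_le : ∀ u, vnorm ((pᵀ * W)ᵀ *ᵥ u) ^ 2 ≤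
    2 * (u ⬝ᵥ (Matrix.diagonal s *ᵥ u)) + δ ^ 2 * y / 10 * vnorm u ^ 2
  cone : ∀ x, vnorm ((qᵀ * W) *ᵥ x) ^ 2 + vnorm (kerPart p q W *ᵥ x) ^ 2 ≤
    1 / 4 * vnorm ((pᵀ * W) *ᵥ x) ^ 2 + psi ε (δ * y) t ^ 2 * vnorm x ^ 2

variable {S J E : Matrix ι ι ℝ} {p q : Matrix ι κ ℝ} {s : κ → ℝ} {y σ δ α ε T t : ℝ}
  {W : Matrix ι h ℝ}

theorem le_diagonal_bounds (hs : ∀ i, s i ≤ y) (z : κ → ℝ) :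
    z ⬝ᵥ (Matrix.diagonal s *ᵥ z) ≤ y * vnorm z ^ 2 := by
  rw [vnorm_sq, dotProduct, dotProduct, Finset.mul_sum]
  refine Finset.sum_le_sum fun i _ => ?_
  rw [Matrix.mulVec_diagonal]
  nlinarith [hs i, mul_self_nonneg (z i)]

theorem vnorm_mulVec_sq_le {A : Matrix ι κ ℝ} {c : ℝ} (hc : ‖A‖ ^ 2 ≤ c) (x : κ → ℝ) :
    vnorm (A *ᵥ x) ^ 2 ≤ c * vnorm x ^ 2 := by
  refine (pow_le_pow_left₀ (vnorm_nonneg _) (vnorm_mulVec_le A x) 2).trans ?_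
  rw [mul_pow]
  exact mul_le_mul_of_nonneg_right hc (sq_nonneg _)

theorem continuousOn_vnorm_mulVec_sq {K : Set ℝ} {A : ℝ → Matrix ι κ ℝ} (hA : ContinuousOn A K)
    (x : κ → ℝ) : ContinuousOn (fun u => vnorm (A u *ᵥ x) ^ 2) K := by
  have hc : Continuous fun B : Matrix ι κ ℝ => (B *ᵥ x) ⬝ᵥ (B *ᵥ x) := by fun_prop
  refine (hc.comp_continuousOn hA).congr fun u _ => ?_
  rw [vnorm_sq]; rfl

namespace Trapped

variable (hW : Trapped J p q s y δ α ε T t W) (H : Params y σ δ α ε T)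
include hW H

/-- Up to time `T` the drift of the imbalance and its initial size stay of order `δ² y`. -/
theorem imbalance_le' (ht : t ≤ T) : ‖imbalance J W‖ ≤ 4 * (δ ^ 2 * y) := by
  have h1 : 15 / 4 * (δ ^ 2 * y / T) * t ≤ 15 / 4 * (δ ^ 2 * y) := by
    have h2 : 0 ≤ δ ^ 2 * y / T := by have := H.pos_T; have := H.pos_y; positivity
    have h3 := mul_le_mul_of_nonneg_left ht h2
    rw [div_mul_cancel₀ _ H.pos_T.ne'] at h3
    linarith
  have h4 := H.eps_sq_le'
  have h5 : 0 ≤ δ ^ 2 * y := by have := H.pos_y; positivity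
  linarith [hW.imbalance_le]

theorem q_le' : ‖qᵀ * W‖ ≤ δ * Real.sqrt y / 3 := by
  refine hW.q_le.trans (div_le_div_of_nonneg_left ?_ (by norm_num) ?_)
  · have := H.pos_delta; positivity
  · linarith [H.one_le_alpha]

theorem opNorm_p_sq_le (hs : ∀ i, s i ≤ y) : ‖pᵀ * W‖ ^ 2 ≤ 2 * y + δ ^ 2 * y / 10 := by
  have h0 : 0 ≤ 2 * y + δ ^ 2 * y / 10 := by have := H.pos_y; positivity
  rw [← Real.le_sqrt (norm_nonneg _) h0, ← opNorm_transpose]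
  refine opNorm_le (Real.sqrt_nonneg _) fun u => ?_
  rw [← sq_le_sq₀ (vnorm_nonneg _) (mul_nonneg (Real.sqrt_nonneg _) (vnorm_nonneg _)), mul_pow,
    Real.sq_sqrt h0]
  have h1 := hW.p_le u
  have h2 := le_diagonal_bounds hs u
  linarith

theorem opNorm_sq_le (F : Frame S J p q s) (hs : ∀ i, s i ≤ y) : ‖W‖ ^ 2 ≤ 9 / 4 * y := by
  have hy := H.pos_y
  rw [← Real.le_sqrt (norm_nonneg _) (by positivity)]
  refine opNorm_le (Real.sqrt_nonneg _) fun x => ?_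
  rw [← sq_le_sq₀ (vnorm_nonneg _) (mul_nonneg (Real.sqrt_nonneg _) (vnorm_nonneg _)), mul_pow,
    Real.sq_sqrt (by positivity), F.vnorm_sq_split W x]
  have h1 := vnorm_mulVec_sq_le (hW.opNorm_p_sq_le H hs) x
  have h2 := vnorm_mulVec_sq_le (pow_le_pow_left₀ (norm_nonneg _) (hW.q_le' H) 2) x
  have h3 := vnorm_mulVec_sq_le (pow_le_pow_left₀ (norm_nonneg _) hW.ker_le 2) x
  rw [mul_pow, mul_pow, H.sq_sqrt] at h3
  rw [div_pow, mul_pow, H.sq_sqrt] at h2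
  have h4 := mul_le_mul_of_nonneg_right (mul_le_mul_of_nonneg_right
    (pow_le_pow_left₀ H.pos_delta.le H.delta_le' 2) hy.le) (sq_nonneg (vnorm x))
  have h5 : 0 ≤ y * vnorm x ^ 2 := by positivity
  linarith

theorem opNorm_le (F : Frame S J p q s) (hs : ∀ i, s i ≤ y) : ‖W‖ ≤ 3 / 2 * Real.sqrt y := by
  rw [← sq_le_sq₀ (norm_nonneg _) (by positivity), mul_pow, H.sq_sqrt]
  linarith [hW.opNorm_sq_le H F hs]

/-- On the kernel of the `p`-part the weights have size at most `psi`. -/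
theorem vnorm_le_of_ker (F : Frame S J p q s) {x : h → ℝ} (hx : (pᵀ * W) *ᵥ x = 0) :
    vnorm (W *ᵥ x) ≤ psi ε (δ * y) t * vnorm x := by
  rw [← sq_le_sq₀ (vnorm_nonneg _) (mul_nonneg (H.psi_pos t).le (vnorm_nonneg _)), mul_pow,
    F.vnorm_sq_split W x]
  have := hW.cone x
  rw [hx, vnorm_zero] at this ⊢
  linarith

end Trapped

theorem Frame.norm_imbalance_le (F : Frame S J p q s) (W : Matrix ι h ℝ) :
    ‖imbalance J W‖ ≤ ‖W‖ ^ 2 :=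
  MatrixSensing.opNorm_le (sq_nonneg _) fun x => (F.vnorm_imbalance_le W x).trans (by
    rw [sq, mul_assoc]
    exact mul_le_mul_of_nonneg_left (vnorm_mulVec_le W x) (norm_nonneg _))

/-- At time `0` every part of the weights is at most `ε`, and `ε ≤ δ √y / (3 α)`. -/
theorem trapped_init (F : Frame S J p q s) (H : Params y σ δ α ε T) (hσ : ∀ i, σ ≤ s i)
    (hW : ‖W‖ ≤ ε) : Trapped J p q s y δ α ε T 0 W := by
  have hε := H.pos_eps
  have hε2 : ε ≤ δ * Real.sqrt y / (3 * α) := by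
    rw [le_div_iff₀ (by have := H.pos_alpha; positivity)]
    linarith [H.eps_le]
  have hq : ‖qᵀ * W‖ ≤ ‖W‖ := MatrixSensing.opNorm_le (norm_nonneg _) fun x =>
    (F.vnorm_q_le W x).trans (vnorm_mulVec_le W x)
  have hk : ‖kerPart p q W‖ ≤ ‖W‖ := MatrixSensing.opNorm_le (norm_nonneg _) fun x =>
    (F.vnorm_ker_le W x).trans (vnorm_mulVec_le W x)
  refine ⟨?_, (hq.trans hW).trans hε2, ?_, fun u => ?_, fun x => ?_⟩
  · rw [mul_zero, add_zero]
    exact (F.norm_imbalance_le W).trans (pow_le_pow_left₀ (norm_nonneg _) hW 2)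
  · refine (hk.trans hW).trans ?_
    have h1 := H.eps_le
    have h2 := mul_le_mul_of_nonneg_right H.one_le_alpha hε.le
    linarith
  · have h1 := vnorm_mulVec_le (pᵀ * W)ᵀ u
    rw [opNorm_transpose] at h1
    have h2 := pow_le_pow_left₀ (vnorm_nonneg _) (h1.trans (mul_le_mul_of_nonneg_right
      ((F.opNorm_p_le W).trans hW) (vnorm_nonneg u))) 2
    have h3 := Frame.diagonal_bounds hσ u
    have h4 := pow_le_pow_left₀ hε.le H.eps_le_sqrt 2
    rw [Real.sq_sqrt H.pos_sigma.le] at h4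
    have h5 := mul_le_mul_of_nonneg_right h4 (sq_nonneg (vnorm u))
    have h6 : 0 ≤ δ ^ 2 * y / 10 * vnorm u ^ 2 := by have := H.pos_y; positivity
    have h7 : 0 ≤ σ * vnorm u ^ 2 := mul_nonneg H.pos_sigma.le (sq_nonneg _)
    rw [mul_pow] at h2
    linarith
  · rw [psi_zero]
    have h1 := F.vnorm_sq_split W x
    have h2 := pow_le_pow_left₀ (vnorm_nonneg _) ((vnorm_mulVec_le W x).trans
      (mul_le_mul_of_nonneg_right hW (vnorm_nonneg x))) 2
    rw [mul_pow] at h2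
    nlinarith [sq_nonneg (vnorm ((pᵀ * W) *ᵥ x))]

theorem hasDerivWithinAt_kerPart {W : ℝ → Matrix ι h ℝ} {W' : Matrix ι h ℝ} {K : Set ℝ}
    (hW : HasDerivWithinAt W W' K t) :
    HasDerivWithinAt (fun u => kerPart p q (W u)) (kerPart p q W') K t :=
  (hW.sub (hasDerivWithinAt_const_mul p (hasDerivWithinAt_const_mul pᵀ hW))).sub
    (hasDerivWithinAt_const_mul q (hasDerivWithinAt_const_mul qᵀ hW))

/-- The imbalance changes only through the perturbation. -/
theorem hasDerivWithinAt_imbalance (F : Frame S J p q s) {W : ℝ → Matrix ι h ℝ} {K : Set ℝ}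
    (hS : Sᵀ = S) (hSJ : S * J = -(J * S))
    (hW : HasDerivWithinAt W (velocity S J E (W t)) K t) :
    HasDerivWithinAt (fun u => imbalance J (W u))
      ((E * W t)ᵀ * J * W t + (W t)ᵀ * J * (E * W t)) K t := by
  have hd := hasDerivWithinAt_matrix_mul (hasDerivWithinAt_transpose hW)
    (hasDerivWithinAt_const_mul J hW)
  have hN : (imbalance J (W t))ᵀ = imbalance J (W t) := by
    simp only [imbalance, Matrix.transpose_mul, Matrix.transpose_transpose, F.Jt, Matrix.mul_assoc]
  have e1 : (velocity S J E (W t))ᵀ * (J * W t) + (W t)ᵀ * (J * velocity S J E (W t)) =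
      (E * W t)ᵀ * J * W t + (W t)ᵀ * J * (E * W t) := by
    have hJJ : ∀ Z : Matrix ι h ℝ, J * (J * Z) = Z := fun Z => by
      rw [← Matrix.mul_assoc, F.JJ, Matrix.one_mul]
    have hSJ' : ∀ Z : Matrix ι h ℝ, S * (J * Z) = -(J * (S * Z)) := fun Z => by
      rw [← Matrix.mul_assoc, hSJ, Matrix.neg_mul, Matrix.mul_assoc]
    rw [velocity]
    simp only [Matrix.transpose_add, Matrix.transpose_sub, Matrix.transpose_mul,
      Matrix.transpose_smul, hS, F.Jt, hN, Matrix.transpose_transpose, Matrix.add_mul,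
      Matrix.sub_mul, Matrix.mul_add, Matrix.mul_sub, Matrix.smul_mul, Matrix.mul_smul,
      Matrix.mul_assoc, hJJ, hSJ']
    simp only [imbalance, Matrix.mul_assoc, Matrix.mul_neg]
    abel
  rw [← e1]
  refine HasDerivWithinAt.congr_of_eventuallyEq (f := fun u => (W u)ᵀ * (J * W u)) hd ?_ ?_
  · exact Eventually.of_forall fun u => by simp only [imbalance, Matrix.mul_assoc]
  · simp only [imbalance, Matrix.mul_assoc]

theorem Frame.transpose_S (F : Frame S J p q s) : Sᵀ = S := by
  rw [F.eq]
  simp only [Matrix.transpose_sub, Matrix.transpose_mul, Matrix.transpose_transpose,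
    Matrix.diagonal_transpose, Matrix.mul_assoc]

theorem Frame.S_mul_J (F : Frame S J p q s) : S * J = -(J * S) := by
  rw [F.eq, Matrix.sub_mul, Matrix.mul_sub, Matrix.mul_assoc _ pᵀ, F.pJ, Matrix.mul_assoc _ qᵀ,
    F.qJ, ← Matrix.mul_assoc J, ← Matrix.mul_assoc J, ← Matrix.mul_assoc J, ← Matrix.mul_assoc J,
    F.Jp, F.Jq]
  abel

theorem norm_deriv_imbalance_le (F : Frame S J p q s) :
    ‖(E * W)ᵀ * J * W + Wᵀ * J * (E * W)‖ ≤ 2 * ‖E‖ * ‖W‖ ^ 2 := by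
  have hJ : ‖J‖ ≤ 1 := MatrixSensing.opNorm_le zero_le_one fun x => by rw [F.vnorm_J, one_mul]
  have h0 : ‖E * W‖ ≤ ‖E‖ * ‖W‖ := opNorm_mul_le E W
  have hJJ : ‖J‖ * (‖E‖ * ‖W‖) ≤ 1 * (‖E‖ * ‖W‖) :=
    mul_le_mul_of_nonneg_right hJ (by positivity)
  have h1 : ‖(E * W)ᵀ * J * W‖ ≤ ‖E‖ * ‖W‖ ^ 2 :=
    calc ‖(E * W)ᵀ * J * W‖ ≤ ‖E * W‖ * ‖J‖ * ‖W‖ :=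
          (opNorm_mul_le _ _).trans (mul_le_mul_of_nonneg_right
            ((opNorm_mul_le _ _).trans_eq (by rw [opNorm_transpose])) (norm_nonneg _))
      _ ≤ (‖E‖ * ‖W‖) * 1 * ‖W‖ := by gcongr
      _ = ‖E‖ * ‖W‖ ^ 2 := by ring
  have h2 : ‖Wᵀ * J * (E * W)‖ ≤ ‖E‖ * ‖W‖ ^ 2 :=
    calc ‖Wᵀ * J * (E * W)‖ ≤ ‖W‖ * ‖J‖ * ‖E * W‖ :=
          (opNorm_mul_le _ _).trans (mul_le_mul_of_nonneg_right
            ((opNorm_mul_le _ _).trans_eq (by rw [opNorm_transpose])) (norm_nonneg _))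
      _ ≤ ‖W‖ * 1 * (‖E‖ * ‖W‖) := by gcongr
      _ = ‖E‖ * ‖W‖ ^ 2 := by ring
  refine (norm_add_le _ _).trans ?_
  linarith

/-- A trapped curve stays trapped for a short time, if the perturbation is at most `0.8 δ² / T`. -/
theorem Trapped.eventually (F : Frame S J p q s) (H : Params y σ δ α ε T) (hσ : ∀ i, σ ≤ s i)
    (hs : ∀ i, s i ≤ y) {W : ℝ → Matrix ι h ℝ} (ht : t ≤ T)
    (hderiv : HasDerivWithinAt W (velocity S J E (W t)) (Ici t) t)
    (hE : ‖E‖ ≤ 4 / 5 * δ ^ 2 / T) (hW : Trapped J p q s y δ α ε T t (W t)) :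
    ∀ᶠ u in 𝓝[>] t, Trapped J p q s y δ α ε T u (W u) := by
  have hy := H.pos_y
  have hδ := H.pos_delta
  have hα := H.pos_alpha
  have hα1 := H.one_le_alpha
  have hσ0 := H.pos_sigma
  have hT := H.pos_T
  have hz := H.sqrt_pos
  have hzz : Real.sqrt y * Real.sqrt y = y := Real.mul_self_sqrt hy.le
  have hδ2 := H.delta_le'
  have hδy := H.delta_y_le
  have hbW := hW.opNorm_le H F hs
  have hbW2 := hW.opNorm_sq_le H F hs
  have hν := hW.imbalance_le' H ht
  have hC := hW.q_le
  have hC' := hW.q_le' H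
  have hD := hW.ker_le
  -- `1 / T ≤ σ / 50`
  have he : 4 / 5 * δ ^ 2 / T ≤ 2 / 125 * (δ ^ 2 * σ) := by
    rw [div_le_iff₀ hT]
    have := mul_le_mul_of_nonneg_left H.le_T (sq_nonneg δ)
    linarith
  have hE' := hE.trans he
  have hδδ : δ ^ 2 * σ ≤ δ ^ 2 * y := mul_le_mul_of_nonneg_left H.sigma_le (sq_nonneg δ)
  have hδ2y : 0 < δ ^ 2 * y := by positivity
  have hδ2σ : 0 < δ ^ 2 * σ := by positivity
  have hδ2y' : δ ^ 2 * y ≤ 1 / 64 * (δ * y) := by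
    have := mul_le_mul_of_nonneg_right hδ2 (show 0 ≤ δ * y by positivity)
    linarith
  have e1 : ∀ᶠ u in 𝓝[>] t, ‖imbalance J (W u)‖ ≤ ε ^ 2 + 15 / 4 * (δ ^ 2 * y / T) * u := by
    refine norm_le_eventually (hasDerivWithinAt_imbalance F F.transpose_S F.S_mul_J hderiv)
      hW.imbalance_le ((norm_deriv_imbalance_le F).trans_lt ?_)
    have h1 : 2 * ‖E‖ * ‖W t‖ ^ 2 ≤ 2 * (4 / 5 * δ ^ 2 / T) * (9 / 4 * y) := by gcongr
    have h2 : 2 * (4 / 5 * δ ^ 2 / T) * (9 / 4 * y) = 18 / 5 * (δ ^ 2 * y / T) := by ring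
    have h3 : 0 < δ ^ 2 * y / T := by positivity
    -- `18 / 5 < 15 / 4`
    linarith
  have e2 : ∀ᶠ u in 𝓝[>] t, ‖qᵀ * W u‖ ≤ δ * Real.sqrt y / (3 * α) := by
    refine opNorm_le_eventually (hasDerivWithinAt_const_mul qᵀ hderiv)
      (hasDerivWithinAt_const _ _ (δ * Real.sqrt y / (3 * α))) (fun _ => by positivity) hC
      fun x hx hcon => ?_
    rw [mul_zero]
    refine F.q_contact hσ hbW hν hE' (by positivity) ?_ hx hcon
    rw [div_mul_eq_mul_div (δ * Real.sqrt y), lt_div_iff₀ (by positivity)]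
    have h1 := mul_le_mul_of_nonneg_right H.delta_le (show 0 ≤ δ * Real.sqrt y by positivity)
    have h2 := mul_le_mul_of_nonneg_right hδδ (show 0 ≤ Real.sqrt y * α by positivity)
    have h3 : 0 < δ * Real.sqrt y * σ := by positivity
    linarith
  have e3 : ∀ᶠ u in 𝓝[>] t, ‖kerPart p q (W u)‖ ≤ 9 / 4 * (δ * Real.sqrt y) := by
    refine opNorm_le_eventually (hasDerivWithinAt_kerPart hderiv)
      (hasDerivWithinAt_const _ _ (9 / 4 * (δ * Real.sqrt y))) (fun _ => by positivity) hD
      fun x hx hcon => ?_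
    rw [mul_zero]
    refine F.ker_contact hν hE' (by positivity) ?_ hx hD hcon
    -- `4 δ² y + 2 e < (9 / 4)² δ² y`
    rw [mul_pow, mul_pow, H.sq_sqrt]
    linarith
  have e4 : ∀ᶠ v in 𝓝[>] t, ∀ u, vnorm ((pᵀ * W v)ᵀ *ᵥ u) ^ 2 ≤
      2 * (u ⬝ᵥ (Matrix.diagonal s *ᵥ u)) + δ ^ 2 * y / 10 * vnorm u ^ 2 := by
    have hA := hasDerivWithinAt_transpose (hasDerivWithinAt_const_mul pᵀ hderiv)
    have hform : ∀ v u, u ⬝ᵥ (((2 : ℝ) • Matrix.diagonal s + (δ ^ 2 * y / 10) • (1 : Matrix κ κ ℝ) -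
        ((pᵀ * W v)ᵀ)ᵀ * (pᵀ * W v)ᵀ) *ᵥ u) = 2 * (u ⬝ᵥ (Matrix.diagonal s *ᵥ u)) +
          δ ^ 2 * y / 10 * vnorm u ^ 2 - vnorm ((pᵀ * W v)ᵀ *ᵥ u) ^ 2 := fun v u => by
      rw [Matrix.sub_mulVec, dotProduct_sub, dotProduct_gram, Matrix.add_mulVec, Matrix.smul_mulVec,
        Matrix.smul_mulVec, Matrix.one_mulVec, dotProduct_add, dotProduct_smul, dotProduct_smul,
        ← vnorm_sq, smul_eq_mul, smul_eq_mul]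
    have h := form_nonneg_eventually (M := fun v => (2 : ℝ) • Matrix.diagonal s +
        (δ ^ 2 * y / 10) • (1 : Matrix κ κ ℝ) - ((pᵀ * W v)ᵀ)ᵀ * (pᵀ * W v)ᵀ)
      (t := t) (fun v => by simp) ((hasDerivWithinAt_const _ _ _).sub (hasDerivWithinAt_gram hA))
      (fun u => by rw [hform, sub_nonneg]; exact hW.p_le u) fun u hu hM => ?_
    · filter_upwards [h] with v hv u
      have := hv u
      rw [hform] at this
      linarith
    · rw [Matrix.sub_mulVec, ← Matrix.mulVec_mulVec, Matrix.add_mulVec, Matrix.smul_mulVec,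
        Matrix.smul_mulVec, Matrix.one_mulVec, sub_eq_zero, Matrix.transpose_transpose] at hM
      have h1 := F.p_upper_contact (ω := δ ^ 2 * y / 10) hσ hbW hν hE' hC' (by positivity) ?_ hu
        hM.symm
      · rw [zero_sub, Matrix.neg_mulVec, dotProduct_neg, dotProduct_deriv_gram]
        linarith
      -- With `64 δ y ≤ σ`, the forcing is at most `(2 / 64 + 9 / 125) δ² y σ`, below `δ² y σ / 5`.
      · have h2 : 3 / 2 * Real.sqrt y * (δ * Real.sqrt y / 3 * (4 * (δ ^ 2 * y))) =
            2 * (δ * y) * (δ ^ 2 * y) := by linear_combination 2 * δ * (δ ^ 2 * y) * hzz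
        have h3 : 2 * (2 / 125 * (δ ^ 2 * σ) * (3 / 2 * Real.sqrt y) ^ 2) =
            9 / 125 * (δ ^ 2 * y) * σ := by rw [mul_pow, H.sq_sqrt]; ring
        rw [h2, h3]
        have h4 := mul_le_mul_of_nonneg_right hδy hδ2y.le
        have h5 : 0 < δ ^ 2 * y * σ := by positivity
        linarith
  have e5 : ∀ᶠ v in 𝓝[>] t, ∀ x, vnorm ((qᵀ * W v) *ᵥ x) ^ 2 + vnorm (kerPart p q (W v) *ᵥ x) ^ 2 ≤
      1 / 4 * vnorm ((pᵀ * W v) *ᵥ x) ^ 2 + psi ε (δ * y) v ^ 2 * vnorm x ^ 2 := by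
    have hA := hasDerivWithinAt_gram (hasDerivWithinAt_const_mul pᵀ hderiv)
    have hCd := hasDerivWithinAt_gram (hasDerivWithinAt_const_mul qᵀ hderiv)
    have hDd := hasDerivWithinAt_gram (hasDerivWithinAt_kerPart (p := p) (q := q) hderiv)
    have hψ := (hasDerivAt_psi_sq ε (δ * y) t).hasDerivWithinAt (s := Ici t)
    have hform : ∀ v x, x ⬝ᵥ ((psi ε (δ * y) v ^ 2 • (1 : Matrix h h ℝ) +
        (1 / 4 : ℝ) • ((pᵀ * W v)ᵀ * (pᵀ * W v)) - (qᵀ * W v)ᵀ * (qᵀ * W v) -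
        (kerPart p q (W v))ᵀ * kerPart p q (W v)) *ᵥ x) =
          psi ε (δ * y) v ^ 2 * vnorm x ^ 2 + 1 / 4 * vnorm ((pᵀ * W v) *ᵥ x) ^ 2 -
          vnorm ((qᵀ * W v) *ᵥ x) ^ 2 - vnorm (kerPart p q (W v) *ᵥ x) ^ 2 := fun v x => by
      simp only [Matrix.sub_mulVec, dotProduct_sub, dotProduct_gram, Matrix.add_mulVec,
        Matrix.smul_mulVec, Matrix.one_mulVec, dotProduct_add, dotProduct_smul, ← vnorm_sq,
        smul_eq_mul]
    have h := form_nonneg_eventually (M := fun v => psi ε (δ * y) v ^ 2 • (1 : Matrix h h ℝ) +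
        (1 / 4 : ℝ) • ((pᵀ * W v)ᵀ * (pᵀ * W v)) - (qᵀ * W v)ᵀ * (qᵀ * W v) -
        (kerPart p q (W v))ᵀ * kerPart p q (W v)) (t := t)
      (fun v => by simp [Matrix.transpose_sub, Matrix.transpose_add, Matrix.transpose_mul])
      ((((hψ.smul_const (1 : Matrix h h ℝ)).add (hA.const_smul (1 / 4 : ℝ))).sub hCd).sub hDd)
      (fun x => by rw [hform]; linarith [hW.cone x]) fun x hx hM => ?_
    · filter_upwards [h] with v hv x
      have := hv x
      rw [hform] at this
      linarith
    · simp only [Matrix.sub_mulVec, Matrix.add_mulVec, Matrix.smul_mulVec, Matrix.one_mulVec,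
        ← Matrix.mulVec_mulVec x _ (pᵀ * W t), ← Matrix.mulVec_mulVec x _ (qᵀ * W t),
        ← Matrix.mulVec_mulVec x _ (kerPart p q (W t))] at hM
      have hαδ : δ * y * α ≤ σ / 64 := by linarith [H.delta_le]
      have h1 := F.cone_contact (g := δ * y) (ω := δ ^ 2 * y / 10) (b := 3 / 2 * Real.sqrt y)
        hσ hE' ((F.opNorm_p_le _).trans hbW) hC' hD hW.p_le (by positivity) hδy ?_ ?_ ?_ ?_ ?_ ?_ ?_
        (H.psi_pos t).ne' hx hM
      · rw [Matrix.sub_mulVec, Matrix.sub_mulVec, dotProduct_sub, dotProduct_sub,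
          dotProduct_deriv_gram (qᵀ * W t), dotProduct_deriv_gram (kerPart p q (W t)),
          Matrix.add_mulVec (_ • (1 : Matrix h h ℝ)), dotProduct_add, Matrix.smul_mulVec,
          Matrix.smul_mulVec, dotProduct_smul, dotProduct_smul, dotProduct_deriv_gram,
          Matrix.one_mulVec, ← vnorm_sq, hx, smul_eq_mul, smul_eq_mul]
        linarith
      · linarith [show 3 / 2 * Real.sqrt y * (δ * Real.sqrt y / 3) = 1 / 2 * (δ * y) by
          linear_combination 1 / 2 * δ * hzz]
      · linarith [show 3 / 2 * Real.sqrt y * (9 / 4 * (δ * Real.sqrt y)) = 27 / 8 * (δ * y) by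
          linear_combination 27 / 8 * δ * hzz]
      · linarith [show δ * Real.sqrt y / 3 * (δ * Real.sqrt y / 3) = 1 / 9 * (δ ^ 2 * y) by
          linear_combination 1 / 9 * δ ^ 2 * hzz]
      · linarith [show δ * Real.sqrt y / 3 * (9 / 4 * (δ * Real.sqrt y)) = 3 / 4 * (δ ^ 2 * y) by
          linear_combination 3 / 4 * δ ^ 2 * hzz]
      · linarith [show 9 / 4 * (δ * Real.sqrt y) * (9 / 4 * (δ * Real.sqrt y)) =
          81 / 16 * (δ ^ 2 * y) by linear_combination 81 / 16 * δ ^ 2 * hzz]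
      · linarith
      · linarith
  filter_upwards [e1, e2, e3, e4, e5] with u h1 h2 h3 h4 h5
  exact ⟨h1, h2, h3, h4, h5⟩

/-- The curve stays trapped up to time `T`, provided that the perturbation is small as long as the
weights are bounded and small on the kernel of the `p`-part. -/
theorem trapped_of_velocity (F : Frame S J p q s) (H : Params y σ δ α ε T) (hσ : ∀ i, σ ≤ s i)
    (hs : ∀ i, s i ≤ y) {W : ℝ → Matrix ι h ℝ} {E : ℝ → Matrix ι ι ℝ}
    (hcont : ContinuousOn W (Icc 0 T)) (h0 : ‖W 0‖ ≤ ε)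
    (hderiv : ∀ t ∈ Ico 0 T, HasDerivWithinAt W (velocity S J (E t) (W t)) (Ici t) t)
    (hE : ∀ t ∈ Ico 0 T, (∀ u ∈ Icc 0 t, ‖W u‖ ^ 2 ≤ 9 / 4 * y ∧ ∀ x, (pᵀ * W u) *ᵥ x = 0 →
      vnorm (W u *ᵥ x) ≤ psi ε (δ * y) T * vnorm x) → ‖E t‖ ≤ 4 / 5 * δ ^ 2 / T) :
    ∀ t ∈ Icc 0 T, Trapped J p q s y δ α ε T t (W t) := by
  refine forall_Icc_of_eventually ?_ (trapped_init F H hσ h0) fun t ht hprev => ?_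
  · have c1 : ContinuousOn (fun u => pᵀ * W u) (Icc 0 T) :=
      (mulCLM pᵀ).continuous.comp_continuousOn hcont
    have c2 : ContinuousOn (fun u => qᵀ * W u) (Icc 0 T) :=
      (mulCLM qᵀ).continuous.comp_continuousOn hcont
    have c3 : ContinuousOn (fun u => kerPart p q (W u)) (Icc 0 T) :=
      (hcont.sub ((mulCLM p).continuous.comp_continuousOn c1)).sub
        ((mulCLM q).continuous.comp_continuousOn c2)
    have c4 : ContinuousOn (fun u => (pᵀ * W u)ᵀ) (Icc 0 T) :=
      (transposeCLM (p := κ) (q := h)).continuous.comp_continuousOn c1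
    have c5 : ContinuousOn (fun u => imbalance J (W u)) (Icc 0 T) := by
      have ct : ContinuousOn (fun u => (W u)ᵀ) (Icc 0 T) :=
        (transposeCLM (p := ι) (q := h)).continuous.comp_continuousOn hcont
      have cJ : ContinuousOn (fun u => J * W u) (Icc 0 T) :=
        (mulCLM J).continuous.comp_continuousOn hcont
      have : ContinuousOn (fun u => mulCLM ((W u)ᵀ) (J * W u)) (Icc 0 T) :=
        (mulCLM.continuous.comp_continuousOn ct).clm_apply cJ
      refine this.congr fun u _ => ?_
      change imbalance J (W u) = (W u)ᵀ * (J * W u)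
      rw [imbalance, Matrix.mul_assoc]
    have cψ : Continuous fun u => psi ε (δ * y) u ^ 2 := by unfold psi; fun_prop
    have k1 := isClosed_Icc.isClosed_le c5.norm
      (show ContinuousOn (fun u => ε ^ 2 + 15 / 4 * (δ ^ 2 * y / T) * u) (Icc 0 T) by fun_prop)
    have k2 := isClosed_Icc.isClosed_le c2.norm
      (continuousOn_const (c := δ * Real.sqrt y / (3 * α)))
    have k3 := isClosed_Icc.isClosed_le c3.norm
      (continuousOn_const (c := 9 / 4 * (δ * Real.sqrt y)))
    have k4 := isClosed_setOf_forall_le isClosed_Icc (fun u => continuousOn_vnorm_mulVec_sq c4 u)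
      (fun u => continuousOn_const (c := 2 * (u ⬝ᵥ (Matrix.diagonal s *ᵥ u)) +
        δ ^ 2 * y / 10 * vnorm u ^ 2))
    have k5 := isClosed_setOf_forall_le isClosed_Icc
      (fun x => (continuousOn_vnorm_mulVec_sq c2 x).add (continuousOn_vnorm_mulVec_sq c3 x))
      (fun x => ((continuousOn_vnorm_mulVec_sq c1 x).const_smul (1 / 4 : ℝ)).add
        ((cψ.continuousOn (s := Icc 0 T)).mul (continuousOn_const (c := vnorm x ^ 2))))
    convert ((((k1.inter k2).inter k3).inter k4).inter k5) using 1
    ext t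
    constructor
    · rintro ⟨ht, hG⟩
      exact ⟨⟨⟨⟨⟨ht, hG.imbalance_le⟩, ht, hG.q_le⟩, ht, hG.ker_le⟩, ht, hG.p_le⟩, ht, hG.cone⟩
    · rintro ⟨⟨⟨⟨⟨ht, h1⟩, -, h2⟩, -, h3⟩, -, h4⟩, -, h5⟩
      exact ⟨ht, h1, h2, h3, h4, h5⟩
  · refine Trapped.eventually F H hσ hs ht.2.le (hderiv t ht) (hE t ht fun u hu => ?_)
      (hprev t ⟨ht.1, le_rfl⟩)
    have hu' := hprev u hu
    refine ⟨hu'.opNorm_sq_le H F hs, fun x hx => (hu'.vnorm_le_of_ker H F hx).trans ?_⟩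
    exact mul_le_mul_of_nonneg_right (psi_le H.pos_eps
      (mul_pos H.pos_delta H.pos_y).le (hu.2.trans ht.2.le)) (vnorm_nonneg _)

end Trapped

/-! ### Growth of the aligned part -/

section Growth

/-- A solution of the Riccati equation `f' = μ f - f²` with `f 0 ≤ ε² / α⁴` and `f → μ`, where
`μ = 1.9 σ`. The exact rate `2 σ` is lowered to leave room for the perturbation. -/
def growth (σ α ε t : ℝ) : ℝ :=
  (α ^ 4 / ε ^ 2 * Real.exp (-(19 / 10 * σ * t)) + (19 / 10 * σ)⁻¹)⁻¹

theorem hasDerivAt_growth {σ α ε : ℝ} (hσ : 0 < σ) (t : ℝ) :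
    HasDerivAt (growth σ α ε) (19 / 10 * σ * growth σ α ε t - growth σ α ε t ^ 2) t := by
  have hpos : 0 < α ^ 4 / ε ^ 2 * Real.exp (-(19 / 10 * σ * t)) + (19 / 10 * σ)⁻¹ := by positivity
  have h0 : HasDerivAt (fun t => -(19 / 10 * σ * t)) (-(19 / 10 * σ * 1)) t :=
    ((hasDerivAt_id' t).const_mul _).neg
  have h1 := ((h0.exp.const_mul (α ^ 4 / ε ^ 2)).add_const (19 / 10 * σ)⁻¹).inv hpos.ne'
  refine h1.congr_deriv ?_
  simp only [growth]
  set a := α ^ 4 / ε ^ 2 * Real.exp (-(19 / 10 * σ * t)) with ha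
  have e1 : -(α ^ 4 / ε ^ 2 * (Real.exp (-(19 / 10 * σ * t)) * -(19 / 10 * σ * 1))) =
      19 / 10 * σ * a := by rw [ha]; ring
  rw [e1]
  field_simp
  ring

namespace Params

variable {y σ δ α ε T t : ℝ} (H : Params y σ δ α ε T)
include H

theorem growth_pos : 0 < growth σ α ε t := by
  have := H.pos_sigma
  unfold growth
  positivity

theorem growth_zero_le : growth σ α ε 0 ≤ (ε / α ^ 2) ^ 2 := by
  have hσ := H.pos_sigma
  have hα := H.pos_alpha
  have hε := H.pos_eps
  have h : (α ^ 4 / ε ^ 2)⁻¹ = (ε / α ^ 2) ^ 2 := by field_simp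
  rw [growth, mul_zero, neg_zero, Real.exp_zero, mul_one, ← h]
  apply inv_anti₀ (by positivity)
  have : 0 < (19 / 10 * σ)⁻¹ := by positivity
  linarith

/-- Growth of the aligned part outpaces `psi`. -/
theorem psi_sq_le_growth (ht0 : 0 ≤ t) (ht : t ≤ T) :
    psi ε (δ * y) t ^ 2 ≤ 2 * α ^ 4 * growth σ α ε t := by
  have hσ := H.pos_sigma
  have hα := H.pos_alpha
  have hε := H.pos_eps
  have h1 : psi ε (δ * y) t ^ 2 * (α ^ 4 / ε ^ 2 * Real.exp (-(19 / 10 * σ * t))) ≤ α ^ 4 := by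
    rw [psi_sq]
    calc ε ^ 2 * Real.exp (32 / 5 * (δ * y) * t) * (α ^ 4 / ε ^ 2 * Real.exp (-(19 / 10 * σ * t)))
        = α ^ 4 * Real.exp (32 / 5 * (δ * y) * t + -(19 / 10 * σ * t)) := by
          rw [Real.exp_add]; field_simp
      _ ≤ α ^ 4 * 1 := by
          gcongr
          rw [Real.exp_le_one_iff]
          have := mul_le_mul_of_nonneg_right H.delta_y_le ht0
          nlinarith [mul_nonneg hσ.le ht0]
      _ = α ^ 4 := mul_one _
  have h2 : psi ε (δ * y) t ^ 2 * (19 / 10 * σ)⁻¹ ≤ α ^ 4 := by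
    have h3 : psi ε (δ * y) t ^ 2 ≤ σ := (pow_le_pow_left₀ (H.psi_pos t).le (psi_le hε
      (mul_pos H.pos_delta H.pos_y).le ht) 2).trans H.psi_T_sq_le_sigma
    have h4 : 1 ≤ α ^ 4 := one_le_pow₀ H.one_le_alpha
    rw [← div_eq_mul_inv, div_le_iff₀ (by positivity)]
    nlinarith
  rw [growth, ← div_eq_mul_inv, le_div_iff₀ (by positivity), mul_add]
  linarith

/-- After time `1.5 L / σ`, where `L = ln (σ / ε²)`, the aligned part has almost reached its final
size. -/
theorem le_growth (ht : 3 / 10 * T ≤ t) : 9 / 5 * σ ≤ growth σ α ε t := by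
  have hσ := H.pos_sigma
  have hα := H.pos_alpha
  have hε := H.pos_eps
  set L := Real.log (σ / ε ^ 2) with hL
  have h1 : Real.exp (-(19 / 10 * σ * t)) ≤ Real.exp (-L) ^ 2 := by
    rw [← Real.exp_nat_mul]
    gcongr
    have h2 := mul_le_mul_of_nonneg_left ht hσ.le
    have h3 := H.T_eq
    have h4 := H.le_log
    rw [← hL] at h3 h4
    push_cast
    nlinarith
  have h5 : Real.exp (-L) = ε ^ 2 / σ := by rw [Real.exp_neg, hL, H.exp_log, inv_div]
  rw [h5] at h1
  have h6 : α ^ 4 / ε ^ 2 * Real.exp (-(19 / 10 * σ * t)) ≤ 1 / (36864 * σ) := by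
    calc α ^ 4 / ε ^ 2 * Real.exp (-(19 / 10 * σ * t)) ≤ α ^ 4 / ε ^ 2 * (ε ^ 2 / σ) ^ 2 := by gcongr
      _ = α ^ 4 * ε ^ 2 / σ ^ 2 := by field_simp
      _ ≤ 1 / (36864 * σ) := by
        rw [div_le_div_iff₀ (by positivity) (by positivity)]
        have h7 := H.eps_sq_mul_le
        have h8 := mul_le_mul_of_nonneg_left H.sigma_le
          (show 0 ≤ 36864 * α ^ 4 * ε ^ 2 by positivity)
        linarith
  have h9 : (9 / 5 * σ) * (1 / (36864 * σ)) = 9 / 5 / 36864 := by field_simp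
  have h10 : (9 / 5 * σ) * (19 / 10 * σ)⁻¹ = 18 / 19 := by field_simp; norm_num
  rw [growth, ← one_div, le_div_iff₀ (by positivity), mul_add, h10]
  have := mul_le_mul_of_nonneg_left h6 (show 0 ≤ 9 / 5 * σ by positivity)
  rw [h9] at this
  linarith

end Params

variable {ι κ h : Type*} [Fintype ι] [Fintype κ] [Fintype h] [DecidableEq ι] [DecidableEq κ]
  [DecidableEq h] {S J : Matrix ι ι ℝ} {p q : Matrix ι κ ℝ} {s : κ → ℝ} {y σ δ α ε T : ℝ}

/-- On a trapped curve the singular values of the aligned part grow at least like `growth`. -/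
theorem growth_le_of_trapped (F : Frame S J p q s) (H : Params y σ δ α ε T) (hσ : ∀ i, σ ≤ s i)
    (hs : ∀ i, s i ≤ y) {W : ℝ → Matrix ι h ℝ} {E : ℝ → Matrix ι ι ℝ}
    (hcont : ContinuousOn W (Icc 0 T))
    (hderiv : ∀ t ∈ Ico 0 T, HasDerivWithinAt W (velocity S J (E t) (W t)) (Ici t) t)
    (hE : ∀ t ∈ Ico 0 T, ‖E t‖ ≤ 4 / 5 * δ ^ 2 / T)
    (hW : ∀ t ∈ Icc 0 T, Trapped J p q s y δ α ε T t (W t))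
    (h0 : ∀ u, ε / α ^ 2 * vnorm u ≤ vnorm ((pᵀ * W 0)ᵀ *ᵥ u)) :
    ∀ t ∈ Icc 0 T, ∀ u, growth σ α ε t * vnorm u ^ 2 ≤ vnorm ((pᵀ * W t)ᵀ *ᵥ u) ^ 2 := by
  have hy := H.pos_y
  have hδ := H.pos_delta
  have hα := H.pos_alpha
  have hσ0 := H.pos_sigma
  have hε := H.pos_eps
  refine forall_Icc_of_eventually ?_ (fun u => ?_) fun t ht hprev => ?_
  · have c1 : ContinuousOn (fun u => pᵀ * W u) (Icc 0 T) :=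
      (mulCLM pᵀ).continuous.comp_continuousOn hcont
    have c4 : ContinuousOn (fun u => (pᵀ * W u)ᵀ) (Icc 0 T) :=
      (transposeCLM (p := κ) (q := h)).continuous.comp_continuousOn c1
    have cg : Continuous (growth σ α ε) :=
      continuous_iff_continuousAt.2 fun t => (hasDerivAt_growth hσ0 t).continuousAt
    exact isClosed_setOf_forall_le isClosed_Icc
      (fun u => cg.continuousOn.mul (continuousOn_const (c := vnorm u ^ 2)))
      (fun u => continuousOn_vnorm_mulVec_sq c4 u)
  · have h1 := pow_le_pow_left₀ (mul_nonneg (by positivity) (vnorm_nonneg _)) (h0 u) 2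
    rw [mul_pow] at h1
    exact (mul_le_mul_of_nonneg_right H.growth_zero_le (sq_nonneg _)).trans h1
  · have htI : t ∈ Icc 0 T := ⟨ht.1, ht.2.le⟩
    have hA := hasDerivWithinAt_transpose (hasDerivWithinAt_const_mul pᵀ (hderiv t ht))
    have hf := (hasDerivAt_growth (α := α) (ε := ε) hσ0 t).hasDerivWithinAt (s := Ici t)
    have hform : ∀ v u, u ⬝ᵥ ((((pᵀ * W v)ᵀ)ᵀ * (pᵀ * W v)ᵀ - growth σ α ε v •
        (1 : Matrix κ κ ℝ)) *ᵥ u) = vnorm ((pᵀ * W v)ᵀ *ᵥ u) ^ 2 - growth σ α ε v * vnorm u ^ 2 :=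
      fun v u => by
        rw [Matrix.sub_mulVec, dotProduct_sub, dotProduct_gram, Matrix.smul_mulVec,
          Matrix.one_mulVec, dotProduct_smul, ← vnorm_sq, smul_eq_mul]
    have hmain := form_nonneg_eventually (M := fun v => ((pᵀ * W v)ᵀ)ᵀ * (pᵀ * W v)ᵀ -
        growth σ α ε v • (1 : Matrix κ κ ℝ)) (t := t) (fun v => by simp)
      ((hasDerivWithinAt_gram hA).sub (hf.smul_const (1 : Matrix κ κ ℝ)))
      (fun u => by rw [hform, sub_nonneg]; exact hprev t ⟨ht.1, le_rfl⟩ u) fun u hu hM => ?_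
    · filter_upwards [hmain] with v hv u
      have := hv u
      rw [hform] at this
      linarith
    · rw [Matrix.sub_mulVec, ← Matrix.mulVec_mulVec, Matrix.smul_mulVec, Matrix.one_mulVec,
        sub_eq_zero, Matrix.transpose_transpose] at hM
      have hWt := hW t htI
      have h1 := F.p_lower_contact (μ := 19 / 10 * σ) hσ (hWt.opNorm_le H F hs) (hE t ht)
        hWt.q_le hWt.ker_le H.one_le_alpha H.growth_pos (H.psi_sq_le_growth ht.1 ht.2.le)
        (fun x => hWt.cone x) ?_ hu hM
      · rw [Matrix.sub_mulVec, dotProduct_sub, dotProduct_deriv_gram, Matrix.smul_mulVec,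
          Matrix.one_mulVec, dotProduct_smul, ← vnorm_sq, hu, smul_eq_mul]
        linarith
      · have he : 4 / 5 * δ ^ 2 / T ≤ 2 / 125 * (δ ^ 2 * σ) := by
          rw [div_le_iff₀ H.pos_T]
          have := mul_le_mul_of_nonneg_left H.le_T (sq_nonneg δ)
          linarith
        have hzz := H.sq_sqrt
        have hα1 : 1 ≤ α ^ 2 := one_le_pow₀ H.one_le_alpha
        have e1 : (δ * Real.sqrt y / (3 * α)) ^ 2 ≤ δ ^ 2 * y := by
          rw [div_pow, mul_pow, hzz]
          exact div_le_self (by positivity) (by nlinarith)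
        have e2 : (9 / 4 * (δ * Real.sqrt y)) ^ 2 = 81 / 16 * (δ ^ 2 * y) := by
          rw [mul_pow, mul_pow, hzz]; ring
        have e3 : α ^ 2 * (δ * Real.sqrt y / (3 * α) * (3 / 2 * Real.sqrt y)) =
            1 / 2 * (α * δ * y) := by
          field_simp
          linear_combination hzz
        have e4 : α ^ 2 * (δ ^ 2 * σ) ≤ σ / 4096 := by
          have h2 : α * δ ≤ 1 / 64 := by
            have h3 := mul_le_mul_of_nonneg_left H.sigma_le (show 0 ≤ α * δ by positivity)
            have h4 := H.delta_le
            by_contra! h5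
            nlinarith
          have h6 := pow_le_pow_left₀ (by positivity) h2 2
          nlinarith
        have e5 := mul_le_mul_of_nonneg_left he (sq_nonneg α)
        rw [e2]
        have := H.delta_sq_le
        have := H.delta_le
        linarith

end Growth

/-! ### The eigenbasis given by a singular value decomposition -/

section SVDFrame

variable {m n r h : ℕ} {Y : Matrix (Fin m) (Fin n) ℝ} {P : Matrix (Fin m) (Fin r) ℝ}
  {Q : Matrix (Fin n) (Fin r) ℝ} {s : Fin r → ℝ}

/-- The orthonormal eigenvectors of `dilation Y` with positive eigenvalues. -/
def eigPos (P : Matrix (Fin m) (Fin r) ℝ) (Q : Matrix (Fin n) (Fin r) ℝ) :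
    Matrix (Fin m ⊕ Fin n) (Fin r) ℝ := (1 / Real.sqrt 2) • Matrix.fromRows P Q

theorem half_eq : 1 / Real.sqrt 2 * (1 / Real.sqrt 2) = 1 / 2 := by
  rw [div_mul_div_comm, Real.mul_self_sqrt zero_le_two, one_mul]

theorem transpose_eigPos_mul (W : Matrix (Fin m ⊕ Fin n) (Fin h) ℝ) :
    (eigPos P Q)ᵀ * W = aligned P Q W.toRows₁ W.toRows₂ := by
  conv_lhs => rw [← Matrix.fromRows_toRows W]
  rw [eigPos, Matrix.transpose_smul, Matrix.smul_mul, Matrix.transpose_fromRows,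
    Matrix.fromCols_mul_fromRows, aligned]

theorem transpose_eigPos_mul_eigPos (P' : Matrix (Fin m) (Fin r) ℝ)
    (Q' : Matrix (Fin n) (Fin r) ℝ) :
    (eigPos P Q)ᵀ * eigPos P' Q' = (1 / 2 : ℝ) • (Pᵀ * P' + Qᵀ * Q') := by
  rw [eigPos, eigPos, Matrix.transpose_smul, Matrix.smul_mul, Matrix.mul_smul, smul_smul, half_eq,
    Matrix.transpose_fromRows, Matrix.fromCols_mul_fromRows]

theorem refl_mul_eigPos : refl m n * eigPos P Q = eigPos P (-Q) := by
  rw [eigPos, eigPos, refl, Matrix.mul_smul, Matrix.fromBlocks_mul_fromRows]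
  simp

theorem eigPos_mul_diagonal : eigPos P Q * Matrix.diagonal s * (eigPos P Q)ᵀ = (1 / 2 : ℝ) •
    Matrix.fromBlocks (P * Matrix.diagonal s * Pᵀ) (P * Matrix.diagonal s * Qᵀ)
      (Q * Matrix.diagonal s * Pᵀ) (Q * Matrix.diagonal s * Qᵀ) := by
  rw [eigPos, Matrix.transpose_smul, Matrix.smul_mul, Matrix.smul_mul, Matrix.mul_smul, smul_smul,
    half_eq, Matrix.transpose_fromRows, Matrix.fromRows_mul, Matrix.fromRows_mul_fromCols]

theorem IsCompactSVD.frame (hY : IsCompactSVD Y P s Q) :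
    Frame (dilation Y) (refl m n) (eigPos P Q) (eigPos P (-Q)) s where
  pp := by
    rw [transpose_eigPos_mul_eigPos, hY.left, hY.right, ← two_smul ℝ (1 : Matrix (Fin r) (Fin r) ℝ),
      smul_smul]
    norm_num
  qq := by
    rw [transpose_eigPos_mul_eigPos, Matrix.transpose_neg, Matrix.neg_mul, Matrix.mul_neg, neg_neg,
      hY.left, hY.right, ← two_smul ℝ (1 : Matrix (Fin r) (Fin r) ℝ), smul_smul]
    norm_num
  pq := by
    rw [transpose_eigPos_mul_eigPos, Matrix.mul_neg, hY.left, hY.right]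
    simp
  Jp := refl_mul_eigPos
  Jq := by rw [refl_mul_eigPos, neg_neg]
  JJ := refl_mul_self
  Jt := refl_transpose
  eq := by
    have hYt : Yᵀ = Q * Matrix.diagonal s * Pᵀ := by
      rw [hY.eq]
      simp only [Matrix.transpose_mul, Matrix.transpose_transpose, Matrix.diagonal_transpose,
        Matrix.mul_assoc]
    rw [eigPos_mul_diagonal, eigPos_mul_diagonal, dilation, hYt, hY.eq]
    ext (i | i) (j | j) <;> simp <;> ring

variable (P Q) in
/-- The `p`-part and the `q`-part determine `Qᵀ V`. -/
theorem sqrt_two_smul_right (W : Matrix (Fin m ⊕ Fin n) (Fin h) ℝ) :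
    Real.sqrt 2 • (Qᵀ * W.toRows₂) = (eigPos P Q)ᵀ * W - (eigPos P (-Q))ᵀ * W := by
  rw [transpose_eigPos_mul, transpose_eigPos_mul, aligned, aligned, ← smul_sub,
    Matrix.transpose_neg, Matrix.neg_mul, add_sub_add_left_eq_sub, sub_neg_eq_add, ← two_smul ℝ,
    smul_smul]
  congr 1
  field_simp
  exact Real.sq_sqrt zero_le_two

variable (P Q) in
theorem sqrt_two_smul_left (W : Matrix (Fin m ⊕ Fin n) (Fin h) ℝ) :
    Real.sqrt 2 • (Pᵀ * W.toRows₁) = (eigPos P Q)ᵀ * W + (eigPos P (-Q))ᵀ * W := by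
  rw [transpose_eigPos_mul, transpose_eigPos_mul, aligned, aligned, ← smul_add,
    Matrix.transpose_neg, Matrix.neg_mul, add_add_add_comm, add_neg_cancel, add_zero, ← two_smul ℝ,
    smul_smul]
  congr 1
  field_simp
  exact Real.sq_sqrt zero_le_two

theorem eigPos_mul (Z : Matrix (Fin r) (Fin h) ℝ) :
    eigPos P Q * Z = (1 / Real.sqrt 2) • Matrix.fromRows (P * Z) (Q * Z) := by
  rw [eigPos, Matrix.smul_mul, Matrix.fromRows_mul]

/-- The kernel part of the weights removes the columns of `P` from `U` and those of `Q` from `V`. -/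
theorem kerPart_eq (W : Matrix (Fin m ⊕ Fin n) (Fin h) ℝ) :
    kerPart (eigPos P Q) (eigPos P (-Q)) W =
      Matrix.fromRows (W.toRows₁ - P * (Pᵀ * W.toRows₁)) (W.toRows₂ - Q * (Qᵀ * W.toRows₂)) := by
  have h2 : (1 / Real.sqrt 2) * Real.sqrt 2 = 1 := by field_simp
  have e1 : P * (Pᵀ * W.toRows₁) = (1 / Real.sqrt 2) • (P * ((eigPos P Q)ᵀ * W) +
      P * ((eigPos P (-Q))ᵀ * W)) := by
    rw [← Matrix.mul_add, ← sqrt_two_smul_left P Q, Matrix.mul_smul, smul_smul, h2, one_smul]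
  have e2 : Q * (Qᵀ * W.toRows₂) = (1 / Real.sqrt 2) • (Q * ((eigPos P Q)ᵀ * W) -
      Q * ((eigPos P (-Q))ᵀ * W)) := by
    rw [← Matrix.mul_sub, ← sqrt_two_smul_right P Q, Matrix.mul_smul, smul_smul, h2, one_smul]
  rw [kerPart, eigPos_mul, eigPos_mul, e1, e2]
  ext (i | i) j <;>
    simp only [Matrix.sub_apply, Matrix.smul_apply, Matrix.fromRows_apply_inl,
      Matrix.fromRows_apply_inr, Matrix.add_apply, Matrix.toRows₁_apply, Matrix.toRows₂_apply,
      Matrix.neg_mul, Matrix.neg_apply, smul_eq_mul] <;> ring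

end SVDFrame

/-! ### Contraction of the residual -/

section Residual

variable {m n r h : ℕ} {Y : Matrix (Fin m) (Fin n) ℝ} {P : Matrix (Fin m) (Fin r) ℝ}
  {Q : Matrix (Fin n) (Fin r) ℝ} {s : Fin r → ℝ}

/-- Pythagoras for the orthogonal projection onto the columns of `P`. -/
theorem vnorm_sq_eq_of_orthonormal (hP : Pᵀ * P = 1) (v : Fin m → ℝ) :
    vnorm v ^ 2 = vnorm (Pᵀ *ᵥ v) ^ 2 + vnorm (v - P *ᵥ (Pᵀ *ᵥ v)) ^ 2 := by
  have h1 : vnorm (P *ᵥ (Pᵀ *ᵥ v)) ^ 2 = vnorm (Pᵀ *ᵥ v) ^ 2 := by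
    rw [vnorm_mulVec_of_orthonormal hP]
  have h2 : v ⬝ᵥ (P *ᵥ (Pᵀ *ᵥ v)) = vnorm (Pᵀ *ᵥ v) ^ 2 := by
    rw [dotProduct_mulVec_eq, vnorm_sq]
  rw [vnorm_sq (v - _), sub_dotProduct, dotProduct_sub, dotProduct_sub, ← vnorm_sq, ← vnorm_sq, h1,
    dotProduct_comm _ v, h2]
  ring

theorem vnorm_sub_proj_le (hP : Pᵀ * P = 1) (v : Fin m → ℝ) :
    vnorm (v - P *ᵥ (Pᵀ *ᵥ v)) ≤ vnorm v := by
  rw [← sq_le_sq₀ (vnorm_nonneg _) (vnorm_nonneg _), vnorm_sq_eq_of_orthonormal hP v]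
  linarith [sq_nonneg (vnorm (Pᵀ *ᵥ v))]

/-- Solvability of the normal equations. -/
theorem exists_normal_solution {G : Matrix (Fin r) (Fin h) ℝ}
    (hG : ∀ z, Gᵀ *ᵥ z = 0 → z = 0) (w : Fin h → ℝ) : ∃ z, G *ᵥ (Gᵀ *ᵥ z) = G *ᵥ w := by
  have hinj : Function.Injective (G * Gᵀ).mulVec := by
    rw [← Matrix.coe_mulVecLin, ← LinearMap.ker_eq_bot, LinearMap.ker_eq_bot']
    intro z hz
    apply hG
    apply vnorm_eq_zero
    rw [← sq_eq_zero_iff, ← dotProduct_gram, Matrix.transpose_transpose]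
    rw [Matrix.mulVecLin_apply] at hz
    rw [hz, dotProduct_zero]
  obtain ⟨z, hz⟩ := (Matrix.mulVec_surjective_iff_isUnit.2
    (Matrix.mulVec_injective_iff_isUnit.1 hinj)) (G *ᵥ w)
  exact ⟨z, by rw [Matrix.mulVec_mulVec]; exact hz⟩

/-- The estimate that closes `resid_contact`. There `a` and `b` are the lengths of the parts of the
unit vector `u` inside and outside of the range of `Y`, `a₁ = ‖Uᵀ u‖`, `a₂ = ‖Vᵀ x‖`, and `z` is the
length of the coefficients of `Vᵀ x` in the row space of `Qᵀ V`. The constant `47 / 50` bounds the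
singular values of `Pᵀ U` and `Qᵀ V` from below, `9 / 256` the kernel part, and `1 / 9` the ratio
`ψ² / q`. -/
theorem contact_scalar {a b a₁ a₂ z ρ : ℝ} (hρ : 0 < ρ) (ha : 0 ≤ a) (hb : 0 ≤ b)
    (hab : a ^ 2 + b ^ 2 = 1) (h1 : 47 / 50 * ρ * a ≤ a₁ + 9 / 256 * ρ) (h2 : b < z + 1 / 9)
    (h3 : 47 / 50 * ρ * z ≤ a₂) : ρ ^ 2 / 2 < a₁ ^ 2 + a₂ ^ 2 := by
  by_contra! hcon
  have h4 : 47 / 50 * ρ * b ≤ a₂ + 47 / 450 * ρ := by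
    have := mul_lt_mul_of_pos_left h2 (show 0 < 47 / 50 * ρ by positivity)
    linarith
  have h5 := pow_le_pow_left₀ (by positivity) h1 2
  have h6 := pow_le_pow_left₀ (by positivity) h4 2
  have h7 : 0 < ρ ^ 2 := by positivity
  have h8 := congrArg (fun t => (47 / 50 * ρ) ^ 2 * t) hab
  nlinarith [sq_nonneg (a₁ / 2 - 2 * (9 / 256 * ρ)), sq_nonneg (a₂ / 2 - 2 * (47 / 450 * ρ))]

/-- Once the aligned part has grown, the weights act with strength at least `σ / 2` on the leading
singular directions `u`, `x` of the residual. These directions lie almost entirely in the range of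
`Y`: outside of it the residual is `-U Vᵀ`, and it is small there because its restriction to the
range of `Vᵀ Q` is again a residual, divided by the large singular values of `Qᵀ V`, and the weights
are at most `ψ` on the kernel of `Qᵀ V`. -/
theorem resid_contact (hY : IsCompactSVD Y P s Q) {W : Matrix (Fin m ⊕ Fin n) (Fin h) ℝ}
    {ρ ψ q : ℝ} (hρ : 0 < ρ) (hψ : 0 ≤ ψ)
    (hA : ∀ z, 67 / 50 * ρ * vnorm z ≤ vnorm (((eigPos P Q)ᵀ * W)ᵀ *ᵥ z))
    (hC : ‖(eigPos P (-Q))ᵀ * W‖ ≤ ρ / 192)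
    (hD : ‖kerPart (eigPos P Q) (eigPos P (-Q)) W‖ ≤ 9 / 256 * ρ)
    (hcone : ∀ x, vnorm (((eigPos P (-Q))ᵀ * W) *ᵥ x) ^ 2 +
      vnorm (kerPart (eigPos P Q) (eigPos P (-Q)) W *ᵥ x) ^ 2 ≤
        1 / 4 * vnorm (((eigPos P Q)ᵀ * W) *ᵥ x) ^ 2 + ψ ^ 2 * vnorm x ^ 2)
    (hq : 9 * ψ ^ 2 < q) (hR : ‖resid Y W‖ ≤ q) {u : Fin m → ℝ} {x : Fin n → ℝ}
    (hu : vnorm u = 1) (hx : vnorm x = 1) (hRx : resid Y W *ᵥ x = q • u) :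
    ρ ^ 2 / 2 < vnorm (W.toRows₁ᵀ *ᵥ u) ^ 2 + vnorm (W.toRows₂ᵀ *ᵥ x) ^ 2 := by
  have hq0 : 0 < q := lt_of_le_of_lt (by positivity) hq
  set U := W.toRows₁ with hU
  set V := W.toRows₂ with hV
  set A := (eigPos P Q)ᵀ * W with hAdef
  set C := (eigPos P (-Q))ᵀ * W with hCdef
  set D := kerPart (eigPos P Q) (eigPos P (-Q)) W with hDdef
  have hD1 : D.toRows₁ = U - P * (Pᵀ * U) := by
    rw [hDdef, kerPart_eq, Matrix.toRows₁_fromRows]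
  have hD2 : D.toRows₂ = V - Q * (Qᵀ * V) := by
    rw [hDdef, kerPart_eq, Matrix.toRows₂_fromRows]
  have hs2 : Real.sqrt 2 ≤ 1415 / 1000 := by
    rw [Real.sqrt_le_left (by norm_num)]; norm_num
  have hs0 : 0 < Real.sqrt 2 := by positivity
  have hCz : ∀ z, vnorm (Cᵀ *ᵥ z) ≤ ρ / 192 * vnorm z := fun z => by
    refine (vnorm_mulVec_le _ _).trans ?_
    rw [opNorm_transpose]
    exact mul_le_mul_of_nonneg_right hC (vnorm_nonneg _)
  -- singular values of `Qᵀ V` and `Pᵀ U`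
  have hlow : ∀ (G : Matrix (Fin r) (Fin h) ℝ) (z : Fin r → ℝ),
      67 / 50 * ρ * vnorm z - ρ / 192 * vnorm z ≤ vnorm ((Real.sqrt 2 • G)ᵀ *ᵥ z) →
      47 / 50 * ρ * vnorm z ≤ vnorm (Gᵀ *ᵥ z) := fun G z hGz => by
    rw [Matrix.transpose_smul, Matrix.smul_mulVec, vnorm_smul, abs_of_pos hs0] at hGz
    have h1 := mul_le_mul_of_nonneg_right hs2 (vnorm_nonneg (Gᵀ *ᵥ z))
    have h2 : 0 ≤ ρ * vnorm z := mul_nonneg hρ.le (vnorm_nonneg _)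
    linarith
  have hG : ∀ z, 47 / 50 * ρ * vnorm z ≤ vnorm ((Qᵀ * V)ᵀ *ᵥ z) := fun z => by
    refine hlow _ z ?_
    rw [sqrt_two_smul_right P Q, Matrix.transpose_sub, Matrix.sub_mulVec]
    have h1 := vnorm_add_le (Aᵀ *ᵥ z - Cᵀ *ᵥ z) (Cᵀ *ᵥ z)
    rw [sub_add_cancel] at h1
    linarith [hA z, hCz z]
  have hH : ∀ z, 47 / 50 * ρ * vnorm z ≤ vnorm ((Pᵀ * U)ᵀ *ᵥ z) := fun z => by
    refine hlow _ z ?_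
    rw [sqrt_two_smul_left P Q, Matrix.transpose_add, Matrix.add_mulVec]
    have h1 := vnorm_sub_le (Aᵀ *ᵥ z + Cᵀ *ᵥ z) (Cᵀ *ᵥ z)
    rw [add_sub_cancel_right] at h1
    linarith [hA z, hCz z]
  -- Split `w = Vᵀ x` into a part in the row space of `Qᵀ V`, with coefficients `z`, and a part `w'`
  -- in the kernel of `Qᵀ V`.
  set w := Vᵀ *ᵥ x with hw
  obtain ⟨z, hz⟩ := exists_normal_solution (G := Qᵀ * V) (fun z hz => by
    have h1 := hG z
    rw [hz, vnorm_zero] at h1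
    refine vnorm_eq_zero (le_antisymm ?_ (vnorm_nonneg z))
    by_contra! h2
    have : 0 < 47 / 50 * ρ * vnorm z := by positivity
    linarith) w
  set w' := w - (Qᵀ * V)ᵀ *ᵥ z with hw'
  have hGw' : (Qᵀ * V) *ᵥ w' = 0 := by rw [hw', Matrix.mulVec_sub, hz, sub_self]
  have hzw : 47 / 50 * ρ * vnorm z ≤ vnorm w := by
    refine (hG z).trans ?_
    have h1 : vnorm ((Qᵀ * V)ᵀ *ᵥ z) ^ 2 ≤ vnorm ((Qᵀ * V)ᵀ *ᵥ z) * vnorm w := by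
      rw [vnorm_sq]
      refine le_trans (le_of_eq ?_) (dotProduct_le _ _)
      rw [dotProduct_transpose_mulVec, dotProduct_comm, hz, dotProduct_mulVec_eq]
    rcases (vnorm_nonneg ((Qᵀ * V)ᵀ *ᵥ z)).eq_or_lt with h2 | h2
    · rw [← h2]; exact vnorm_nonneg _
    · rw [sq] at h1
      exact le_of_mul_le_mul_left h1 h2
  -- the component of `w` in the kernel of `Qᵀ V`
  have hDw' : vnorm (D *ᵥ w') ≤ ψ * vnorm w' := by
    have h1 : A *ᵥ w' = C *ᵥ w' := by
      rw [← sub_eq_zero, ← Matrix.sub_mulVec, hAdef, hCdef, ← sqrt_two_smul_right P Q,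
        Matrix.smul_mulVec, hGw', smul_zero]
    have h2 := hcone w'
    rw [h1] at h2
    rw [← sq_le_sq₀ (vnorm_nonneg _) (mul_nonneg hψ (vnorm_nonneg _)), mul_pow]
    linarith [sq_nonneg (vnorm (C *ᵥ w'))]
  have hsplit := vnorm_mulVec_sq_toRows D w'
  have hD1w' : vnorm (D.toRows₁ *ᵥ w') ≤ ψ * vnorm w' := by
    refine le_trans ?_ hDw'
    rw [← sq_le_sq₀ (vnorm_nonneg _) (vnorm_nonneg _)]
    linarith [sq_nonneg (vnorm (D.toRows₂ *ᵥ w'))]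
  have hVw' : vnorm (V *ᵥ w') ≤ ψ * vnorm w' := by
    have h1 : V *ᵥ w' = D.toRows₂ *ᵥ w' := by
      rw [hD2, Matrix.sub_mulVec, ← Matrix.mulVec_mulVec, hGw', Matrix.mulVec_zero, sub_zero]
    rw [h1]
    refine le_trans ?_ hDw'
    rw [← sq_le_sq₀ (vnorm_nonneg _) (vnorm_nonneg _)]
    linarith [sq_nonneg (vnorm (D.toRows₁ *ᵥ w'))]
  have hw'ψ : vnorm w' ≤ ψ := by
    have h1 : vnorm w' ^ 2 ≤ ψ * vnorm w' := by
      have h2 : vnorm w' ^ 2 = (V *ᵥ w') ⬝ᵥ x := by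
        have h3 : w' ⬝ᵥ ((Qᵀ * V)ᵀ *ᵥ z) = 0 := by
          rw [dotProduct_transpose_mulVec, hGw', zero_dotProduct]
        rw [vnorm_sq]
        conv_lhs => rw [hw', dotProduct_sub, ← hw', h3, sub_zero, hw, dotProduct_transpose_mulVec]
      rw [h2]
      refine (dotProduct_le _ _).trans ?_
      rw [hx, mul_one]
      exact hVw'
    rcases (vnorm_nonneg w').eq_or_lt with h2 | h2
    · rw [← h2]; exact hψ
    · rw [sq] at h1
      exact le_of_mul_le_mul_right h1 h2
  -- outside of the range of `P` the residual is `-D₁ Vᵀ`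
  have hres : ∀ v, resid Y W *ᵥ v - P *ᵥ (Pᵀ *ᵥ (resid Y W *ᵥ v)) =
      -(D.toRows₁ *ᵥ (Vᵀ *ᵥ v)) := fun v => by
    have h1 : resid Y W *ᵥ v = Y *ᵥ v - U *ᵥ (Vᵀ *ᵥ v) := by
      rw [resid, Matrix.sub_mulVec, ← Matrix.mulVec_mulVec]
    have h2 : P *ᵥ (Pᵀ *ᵥ (Y *ᵥ v)) = Y *ᵥ v := by
      rw [hY.mulVec, Matrix.mulVec_mulVec _ Pᵀ P, hY.left, Matrix.one_mulVec]
    rw [h1, Matrix.mulVec_sub, Matrix.mulVec_sub, h2, hD1, Matrix.sub_mulVec,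
      ← Matrix.mulVec_mulVec, ← Matrix.mulVec_mulVec]
    abel
  -- On the row space of `Qᵀ V` this is again a residual.
  have hD1z : vnorm (D.toRows₁ *ᵥ ((Qᵀ * V)ᵀ *ᵥ z)) ≤ q * vnorm z := by
    rw [Matrix.transpose_mul, Matrix.transpose_transpose, ← Matrix.mulVec_mulVec, ← vnorm_neg,
      ← hres]
    refine (vnorm_sub_proj_le hY.left _).trans ((vnorm_mulVec_le _ _).trans ?_)
    rw [vnorm_mulVec_of_orthonormal hY.right]
    exact mul_le_mul_of_nonneg_right hR (vnorm_nonneg _)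
  have hPu := vnorm_sq_eq_of_orthonormal hY.left u
  rw [hu, one_pow] at hPu
  have hb : q * vnorm (u - P *ᵥ (Pᵀ *ᵥ u)) ≤ q * vnorm z + ψ ^ 2 := by
    have h1 : q • (u - P *ᵥ (Pᵀ *ᵥ u)) = -(D.toRows₁ *ᵥ w) := by
      rw [hw, ← hres, hRx, Matrix.mulVec_smul, Matrix.mulVec_smul, smul_sub]
    have h2 : q * vnorm (u - P *ᵥ (Pᵀ *ᵥ u)) = vnorm (D.toRows₁ *ᵥ w) := by
      rw [← vnorm_neg (D.toRows₁ *ᵥ w), ← h1, vnorm_smul, abs_of_pos hq0]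
    have h3 : w = (Qᵀ * V)ᵀ *ᵥ z + w' := by rw [hw']; abel
    rw [h2, h3, Matrix.mulVec_add]
    refine (vnorm_add_le _ _).trans (add_le_add hD1z (hD1w'.trans ?_))
    rw [sq]
    exact mul_le_mul_of_nonneg_left hw'ψ hψ
  -- The component of `u` in the range of `P` is seen by `U`, up to the kernel part.
  have ha : 47 / 50 * ρ * vnorm (Pᵀ *ᵥ u) ≤ vnorm (Uᵀ *ᵥ u) + 9 / 256 * ρ := by
    refine (hH _).trans ?_
    have h1 : (Pᵀ * U)ᵀ *ᵥ (Pᵀ *ᵥ u) = Uᵀ *ᵥ u - D.toRows₁ᵀ *ᵥ u := by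
      rw [hD1, Matrix.transpose_sub, Matrix.transpose_mul, Matrix.transpose_mul,
        Matrix.transpose_transpose, Matrix.sub_mulVec, sub_sub_cancel, Matrix.mulVec_mulVec,
        Matrix.transpose_mul, Matrix.transpose_transpose]
    rw [h1]
    refine (vnorm_sub_le _ _).trans (add_le_add le_rfl ((vnorm_mulVec_le _ _).trans ?_))
    rw [hu, mul_one, opNorm_transpose]
    exact (opNorm_toRows₁_le D).trans hD
  refine contact_scalar hρ (vnorm_nonneg _) (vnorm_nonneg _) hPu.symm ha ?_ hzw
  have h1 : q * vnorm (u - P *ᵥ (Pᵀ *ᵥ u)) < q * (vnorm z + 1 / 9) := by linarith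
  exact lt_of_mul_lt_mul_left h1 hq0.le

end Residual

section ResidualFlow

variable {m n r h : ℕ} {Y : Matrix (Fin m) (Fin n) ℝ} {P : Matrix (Fin m) (Fin r) ℝ}
  {Q : Matrix (Fin n) (Fin r) ℝ} {s : Fin r → ℝ}

/-- The upper half as a product, so that derivatives and continuity follow from those of products.
-/
theorem toRows₁_eq_mul (W : Matrix (Fin m ⊕ Fin n) (Fin h) ℝ) :
    W.toRows₁ = Matrix.fromCols (1 : Matrix (Fin m) (Fin m) ℝ) (0 : Matrix (Fin m) (Fin n) ℝ) * W := by
  conv_rhs => rw [← Matrix.fromRows_toRows W]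
  rw [Matrix.fromCols_mul_fromRows, Matrix.one_mul, Matrix.zero_mul, add_zero]

theorem toRows₂_eq_mul (W : Matrix (Fin m ⊕ Fin n) (Fin h) ℝ) :
    W.toRows₂ = Matrix.fromCols (0 : Matrix (Fin n) (Fin m) ℝ) (1 : Matrix (Fin n) (Fin n) ℝ) * W := by
  conv_rhs => rw [← Matrix.fromRows_toRows W]
  rw [Matrix.fromCols_mul_fromRows, Matrix.one_mul, Matrix.zero_mul, zero_add]

theorem hasDerivWithinAt_resid {W : ℝ → Matrix (Fin m ⊕ Fin n) (Fin h) ℝ}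
    {W' : Matrix (Fin m ⊕ Fin n) (Fin h) ℝ} {K : Set ℝ} {t : ℝ} (hW : HasDerivWithinAt W W' K t) :
    HasDerivWithinAt (fun u => resid Y (W u))
      (-(W'.toRows₁ * (W t).toRows₂ᵀ + (W t).toRows₁ * W'.toRows₂ᵀ)) K t := by
  have h1 : HasDerivWithinAt (fun u => (W u).toRows₁) W'.toRows₁ K t := by
    simp only [toRows₁_eq_mul]
    exact hasDerivWithinAt_const_mul _ hW
  have h2 : HasDerivWithinAt (fun u => (W u).toRows₂) W'.toRows₂ K t := by
    simp only [toRows₂_eq_mul]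
    exact hasDerivWithinAt_const_mul _ hW
  exact (hasDerivWithinAt_matrix_mul h1 (hasDerivWithinAt_transpose h2)).const_sub Y

/-- The rate of change of the residual in its singular directions `u`, `x`. -/
theorem resid_rate {W E : Matrix (Fin m ⊕ Fin n) (Fin h) ℝ} {W' : Matrix (Fin m ⊕ Fin n) (Fin h) ℝ}
    {q e b : ℝ} (hb : ‖W‖ ≤ b) (he : ‖E‖ ≤ e) (hW' : W' = dilation (resid Y W) * W + E)
    {u : Fin m → ℝ} {x : Fin n → ℝ} (hu : vnorm u = 1) (hx : vnorm x = 1)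
    (hRx : resid Y W *ᵥ x = q • u) (hRu : (resid Y W)ᵀ *ᵥ u = q • x) :
    u ⬝ᵥ ((-(W'.toRows₁ * W.toRows₂ᵀ + W.toRows₁ * W'.toRows₂ᵀ)) *ᵥ x) ≤
      -(q * (vnorm (W.toRows₁ᵀ *ᵥ u) ^ 2 + vnorm (W.toRows₂ᵀ *ᵥ x) ^ 2)) + 2 * (e * b) := by
  have e1 : W'.toRows₁ = resid Y W * W.toRows₂ + E.toRows₁ := by
    rw [hW']
    conv_lhs => rw [← Matrix.fromRows_toRows W, dilation, Matrix.fromBlocks_mul_fromRows]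
    simp only [Matrix.fromRows_toRows]
    ext i j; simp
  have e2 : W'.toRows₂ = (resid Y W)ᵀ * W.toRows₁ + E.toRows₂ := by
    rw [hW']
    conv_lhs => rw [← Matrix.fromRows_toRows W, dilation, Matrix.fromBlocks_mul_fromRows]
    simp only [Matrix.fromRows_toRows]
    ext i j; simp
  have he0 := (norm_nonneg _).trans he
  have hU : vnorm (W.toRows₁ᵀ *ᵥ u) ≤ b := by
    refine (vnorm_mulVec_le _ _).trans ?_
    rw [hu, mul_one, opNorm_transpose]
    exact (opNorm_toRows₁_le W).trans hb
  have hV : vnorm (W.toRows₂ᵀ *ᵥ x) ≤ b := by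
    refine (vnorm_mulVec_le _ _).trans ?_
    rw [hx, mul_one, opNorm_transpose]
    exact (opNorm_toRows₂_le W).trans hb
  have hE1 : vnorm (E.toRows₁ᵀ *ᵥ u) ≤ e := by
    refine (vnorm_mulVec_le _ _).trans ?_
    rw [hu, mul_one, opNorm_transpose]
    exact (opNorm_toRows₁_le E).trans he
  have hE2 : vnorm (E.toRows₂ᵀ *ᵥ x) ≤ e := by
    refine (vnorm_mulVec_le _ _).trans ?_
    rw [hx, mul_one, opNorm_transpose]
    exact (opNorm_toRows₂_le E).trans he
  have f1 : W'.toRows₁ᵀ *ᵥ u = q • (W.toRows₂ᵀ *ᵥ x) + E.toRows₁ᵀ *ᵥ u := by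
    rw [e1, Matrix.transpose_add, Matrix.transpose_mul, Matrix.add_mulVec, ← Matrix.mulVec_mulVec,
      hRu, Matrix.mulVec_smul]
  have f2 : W'.toRows₂ᵀ *ᵥ x = q • (W.toRows₁ᵀ *ᵥ u) + E.toRows₂ᵀ *ᵥ x := by
    rw [e2, Matrix.transpose_add, Matrix.transpose_mul, Matrix.transpose_transpose,
      Matrix.add_mulVec, ← Matrix.mulVec_mulVec, hRx, Matrix.mulVec_smul]
  have g1 := (neg_le_dotProduct (E.toRows₁ᵀ *ᵥ u) (W.toRows₂ᵀ *ᵥ x))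
  have g2 := (neg_le_dotProduct (W.toRows₁ᵀ *ᵥ u) (E.toRows₂ᵀ *ᵥ x))
  have g3 := mul_le_mul hE1 hV (vnorm_nonneg _) he0
  have g4 := mul_le_mul hU hE2 (vnorm_nonneg _) ((norm_nonneg _).trans hb)
  rw [Matrix.neg_mulVec, dotProduct_neg, Matrix.add_mulVec, dotProduct_add,
    ← Matrix.mulVec_mulVec, ← Matrix.mulVec_mulVec, dotProduct_mulVec_eq W'.toRows₁,
    dotProduct_mulVec_eq W.toRows₁, f1, f2, add_dotProduct, dotProduct_add, smul_dotProduct,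
    dotProduct_smul, ← vnorm_sq, ← vnorm_sq, smul_eq_mul, smul_eq_mul]
  linarith

/-- The bound for the residual: after the time `t₁` it decays at rate `0.45 σ` to a level set by the
unfitted weights `Ψ` and the measurement error `ν = δ² γ Ψ`. -/
def residBound (y σ Ψ ν t₁ t : ℝ) : ℝ :=
  11 / 5 * y * Real.exp (-(9 / 20 * σ * (t - t₁))) + (9 * Ψ + 1 / 5 * ν)

theorem hasDerivAt_residBound (y σ Ψ ν t₁ t : ℝ) : HasDerivAt (residBound y σ Ψ ν t₁)
    (-(9 / 20 * σ * (11 / 5 * y * Real.exp (-(9 / 20 * σ * (t - t₁)))))) t := by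
  have h0 : HasDerivAt (fun t => -(9 / 20 * σ * (t - t₁))) (-(9 / 20 * σ * 1)) t :=
    (((hasDerivAt_id' t).sub_const t₁).const_mul _).neg
  exact ((h0.exp.const_mul (11 / 5 * y)).add_const _).congr_deriv (by ring)

variable {d k : ℕ} {𝒜 : Matrix (Fin m) (Fin n) ℝ →ₗ[ℝ] EuclideanSpace ℝ (Fin d)}
  {y σ δ α ε T ρ η γ : ℝ}

/-- Within one time step the bound for the residual changes by at most a factor of `2`. -/
theorem residBound_le_two_mul {Ψ ν t₁ t τ : ℝ} (hy : 0 < y) (hΨ : 0 ≤ Ψ) (hν : 0 ≤ ν)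
    (hτ : σ * (t - τ) ≤ 1) : residBound y σ Ψ ν t₁ τ ≤ 2 * residBound y σ Ψ ν t₁ t := by
  have h1 : Real.exp (-(9 / 20 * σ * (τ - t₁))) =
      Real.exp (9 / 20 * (σ * (t - τ))) * Real.exp (-(9 / 20 * σ * (t - t₁))) := by
    rw [← Real.exp_add]; congr 1; ring
  have h2 : Real.exp (9 / 20 * (σ * (t - τ))) ≤ 2 := by
    rw [← Real.le_log_iff_exp_le two_pos]
    linarith [Real.log_two_gt_d9]
  have h3 := mul_le_mul_of_nonneg_right h2 (Real.exp_pos (-(9 / 20 * σ * (t - t₁)))).le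
  rw [← h1] at h3
  have h4 := mul_le_mul_of_nonneg_left h3 (show 0 ≤ 11 / 5 * y by positivity)
  unfold residBound
  linarith

/-- Contraction of the residual along a trapped flow whose aligned part has grown. -/
theorem norm_resid_le_residBound (hY : IsCompactSVD Y P s Q) (H : Params y σ δ α ε T)
    (hs : Scales 𝒜 Y r y T δ ρ η γ (psi ε (δ * y) T ^ 2) k) (hsy : ∀ i, s i ≤ y)
    {U₀ : Matrix (Fin m) (Fin h) ℝ} {V₀ : Matrix (Fin n) (Fin h) ℝ}
    {W : ℝ → Matrix (Fin m ⊕ Fin n) (Fin h) ℝ} (hflow : IsPerturbedGradientFlow 𝒜 Y η U₀ V₀ W)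
    (hE : ∀ t ∈ Ico 0 T, ‖perturbation 𝒜 Y η W t‖ ≤ δ ^ 2 / (T * y) / 4 *
      (‖resid Y (W (⌊t / η⌋₊ * η))‖ + γ * psi ε (δ * y) T ^ 2))
    (hW : ∀ t ∈ Icc 0 T,
      Trapped (refl m n) (eigPos P Q) (eigPos P (-Q)) s y δ α ε T t (W t))
    (hA : ∀ t ∈ Icc 0 T, ∀ u, growth σ α ε t * vnorm u ^ 2 ≤
      vnorm (((eigPos P Q)ᵀ * W t)ᵀ *ᵥ u) ^ 2) :
    ∀ t ∈ Icc (3 / 10 * T) T, ‖resid Y (W t)‖ ≤ residBound y σ (psi ε (δ * y) T ^ 2)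
      (δ ^ 2 * (γ * psi ε (δ * y) T ^ 2)) (3 / 10 * T) t := by
  have F := hY.frame
  have hy := H.pos_y
  have hδ := H.pos_delta
  have hα := H.pos_alpha
  have hσ := H.pos_sigma
  have hε := H.pos_eps
  have hT := H.pos_T
  have hγ := hs.pos_gamma
  have hη := hs.pos_eta
  have hψT := H.psi_pos T
  have hψ0 := H.psi_pos
  set Ψ := psi ε (δ * y) T ^ 2 with hΨ
  have hΨ0 : 0 < Ψ := by positivity
  set ν := δ ^ 2 * (γ * Ψ) with hν
  have hν0 : 0 < ν := by positivity
  set t₁ := 3 / 10 * T with ht₁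
  have ht₁0 : 0 ≤ t₁ := by positivity
  have hnorm : ∀ t ∈ Icc 0 T, ‖resid Y (W t)‖ ≤ 17 / 8 * y := fun t ht =>
    norm_resid_le hs.norm_eq ((hW t ht).opNorm_sq_le H F hsy)
  have hpos : ∀ t, 0 ≤ residBound y σ Ψ ν t₁ t := fun t => by unfold residBound; positivity
  -- Up to `t₁` the a priori bound suffices, as `17 / 8 ≤ 11 / 5`. Times before `t₁` matter since
  -- the grid point preceding `t` may lie there.
  have hbefore : ∀ t ∈ Icc 0 t₁, ‖resid Y (W t)‖ ≤ residBound y σ Ψ ν t₁ t := fun t ht => by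
    have h1 := hnorm t ⟨ht.1, ht.2.trans (by rw [ht₁]; linarith)⟩
    have h2 : 1 ≤ Real.exp (-(9 / 20 * σ * (t - t₁))) := by
      rw [Real.one_le_exp_iff]
      have := mul_nonneg hσ.le (sub_nonneg.2 ht.2)
      linarith
    have h3 := mul_le_mul_of_nonneg_left h2 hy.le
    unfold residBound
    linarith
  refine forall_Icc_of_eventually ?_ (hbefore t₁ ⟨ht₁0, le_rfl⟩) fun t ht hprev => ?_
  · have c1 : ContinuousOn (fun u => resid Y (W u)) (Icc t₁ T) := fun u hu => by
      have hc : ContinuousWithinAt W (Icc t₁ T) u :=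
        (hflow.cont u (ht₁0.trans hu.1)).mono fun v hv => ht₁0.trans hv.1
      have hcr : Continuous fun B : Matrix (Fin m ⊕ Fin n) (Fin h) ℝ => resid Y B := by
        simp only [resid, toRows₁_eq_mul, toRows₂_eq_mul]
        fun_prop
      exact hcr.continuousAt.comp_continuousWithinAt hc
    have c2 : Continuous (residBound y σ Ψ ν t₁) := continuous_iff_continuousAt.2 fun t =>
      (hasDerivAt_residBound y σ Ψ ν t₁ t).continuousAt
    exact isClosed_Icc.isClosed_le c1.norm c2.continuousOn
  · have ht0 : 0 ≤ t := ht₁0.trans ht.1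
    have htI : t ∈ Icc 0 T := ⟨ht0, ht.2.le⟩
    have hWt := hW t htI
    refine opNorm_le_eventually (hasDerivWithinAt_resid (hflow.deriv t ht0))
      (hasDerivAt_residBound y σ Ψ ν t₁ t).hasDerivWithinAt hpos (hprev t ⟨ht.1, le_rfl⟩)
      fun x hx hcon => ?_
    set q := residBound y σ Ψ ν t₁ t with hq
    set R := resid Y (W t) with hR
    set w := 11 / 5 * y * Real.exp (-(9 / 20 * σ * (t - t₁))) with hw
    have hw0 : 0 < w := by positivity
    have hqw : q = w + (9 * Ψ + 1 / 5 * ν) := rfl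
    have hq0 : 0 < q := by rw [hqw]; positivity
    -- the singular directions at contact
    set u := q⁻¹ • (R *ᵥ x) with hu
    have hRx : R *ᵥ x = q • u := by rw [hu, smul_smul, mul_inv_cancel₀ hq0.ne', one_smul]
    have hRu : Rᵀ *ᵥ u = q • x := by
      rw [hu, Matrix.mulVec_smul, hcon, smul_smul]
      congr 1
      field_simp
    have hu1 : vnorm u = 1 := by
      have h1 : vnorm (R *ᵥ x) ^ 2 = q ^ 2 := by
        rw [vnorm_sq, ← dotProduct_transpose_mulVec, hcon, dotProduct_smul, ← vnorm_sq, hx]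
        simp
      rw [sq_eq_sq₀ (vnorm_nonneg _) hq0.le] at h1
      rw [hu, vnorm_smul, h1, abs_of_pos (inv_pos.2 hq0), inv_mul_cancel₀ hq0.ne']
    have hb := hWt.opNorm_le H F hsy
    have hEW : ‖perturbation 𝒜 Y η W t * W t‖ ≤
        ‖perturbation 𝒜 Y η W t‖ * (3 / 2 * Real.sqrt y) :=
      (opNorm_mul_le _ _).trans (mul_le_mul_of_nonneg_left hb (norm_nonneg _))
    have hrate := resid_rate (W' := (dilation R + perturbation 𝒜 Y η W t) * W t) hb hEW
      (Matrix.add_mul _ _ _) hu1 hx hRx hRu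
    -- strength of the weights
    have hρσ : Real.sqrt σ ^ 2 = σ := Real.sq_sqrt hσ.le
    have hδρ := H.delta_sqrt_le
    have hact := resid_contact hY (ρ := Real.sqrt σ) (ψ := psi ε (δ * y) t) (q := q)
      (Real.sqrt_pos.2 hσ) (hψ0 t).le ?_ ?_ ?_ hWt.cone ?_ (hprev t ⟨ht.1, le_rfl⟩) hu1 hx hRx
    rotate_left
    · intro z
      have h1 := hA t htI z
      have h2 := mul_le_mul_of_nonneg_right (H.le_growth ht.1) (sq_nonneg (vnorm z))
      rw [← sq_le_sq₀ (mul_nonneg (by positivity) (vnorm_nonneg _)) (vnorm_nonneg _), mul_pow,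
        mul_pow, hρσ]
      have h3 : 0 ≤ σ * vnorm z ^ 2 := by positivity
      linarith
    · refine (hWt.q_le' H).trans ?_
      linarith
    · refine hWt.ker_le.trans ?_
      linarith
    · have h1 : psi ε (δ * y) t ^ 2 ≤ Ψ :=
        pow_le_pow_left₀ (hψ0 t).le (psi_le hε (mul_pos hδ hy).le ht.2.le) 2
      rw [hqw]
      linarith
    rw [hρσ] at hact
    -- size of the perturbation
    have hEt : ‖perturbation 𝒜 Y η W t‖ ≤ δ ^ 2 / (T * y) / 4 * (2 * q + γ * Ψ) := by
      refine (hE t ⟨ht0, ht.2⟩).trans ?_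
      have hτ0 : (0 : ℝ) ≤ ⌊t / η⌋₊ * η := by positivity
      have hτt : ⌊t / η⌋₊ * η ≤ t := floor_div_mul_le hη ht0
      have hτ : ‖resid Y (W (⌊t / η⌋₊ * η))‖ ≤ residBound y σ Ψ ν t₁ (⌊t / η⌋₊ * η) := by
        rcases le_total (⌊t / η⌋₊ * η) t₁ with h | h
        · exact hbefore _ ⟨hτ0, h⟩
        · exact hprev _ ⟨h, hτt⟩
      have h2 : residBound y σ Ψ ν t₁ (⌊t / η⌋₊ * η) ≤ 2 * q := by
        refine residBound_le_two_mul hy hΨ0.le hν0.le ?_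
        have h3 : t - ⌊t / η⌋₊ * η ≤ η := by
          have := lt_floor_div_add_one_mul hη t
          rw [add_mul, one_mul] at this
          linarith
        have h4 := mul_le_mul_of_nonneg_left h3 hσ.le
        have h5 := mul_le_mul_of_nonneg_right H.sigma_le hη.le
        have h6 := hs.eta_le'
        have h7 := hs.ratio_le.2
        linarith
      have h8 : 0 ≤ δ ^ 2 / (T * y) / 4 := by positivity
      exact mul_le_mul_of_nonneg_left (by linarith) h8
    have hzz : Real.sqrt y * Real.sqrt y = y := Real.mul_self_sqrt hy.le
    -- With `T σ ≥ 50` the perturbation contributes a small fraction of `σ (δ² q + ν)`.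
    have hE4 : 2 * (‖perturbation 𝒜 Y η W t‖ * (3 / 2 * Real.sqrt y) * (3 / 2 * Real.sqrt y)) ≤
        9 / 400 * (σ * (2 * (δ ^ 2 * q) + ν)) := by
      have h1 : 2 * (‖perturbation 𝒜 Y η W t‖ * (3 / 2 * Real.sqrt y) * (3 / 2 * Real.sqrt y)) =
          9 / 2 * y * ‖perturbation 𝒜 Y η W t‖ := by
        linear_combination 9 / 2 * ‖perturbation 𝒜 Y η W t‖ * hzz
      have h2 := mul_le_mul_of_nonneg_left hEt (show 0 ≤ 9 / 2 * y by positivity)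
      have h3 : 9 / 2 * y * (δ ^ 2 / (T * y) / 4 * (2 * q + γ * Ψ)) =
          9 / 8 * (2 * (δ ^ 2 * q) + ν) / T := by rw [hν]; field_simp; ring
      rw [h1]
      refine h2.trans ?_
      rw [h3, div_le_iff₀ hT]
      have h4 := mul_le_mul_of_nonneg_left H.le_T (show 0 ≤ 2 * (δ ^ 2 * q) + ν by positivity)
      linarith
    have hδ2 : δ ^ 2 ≤ 1 / 4096 := by
      have := pow_le_pow_left₀ hδ.le H.delta_le' 2
      norm_num at this ⊢
      exact this
    have hδq : σ * (δ ^ 2 * q) ≤ σ * q / 4096 := by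
      have := mul_le_mul_of_nonneg_right hδ2 (show 0 ≤ σ * q by positivity)
      linarith
    have hqa := mul_lt_mul_of_pos_left hact hq0
    have hσw : σ * q = σ * w + σ * (9 * Ψ + 1 / 5 * ν) := by rw [hqw]; ring
    have hσΨ : 0 < σ * Ψ := by positivity
    have hσν : 0 < σ * ν := by positivity
    have hσw0 : 0 < σ * w := by positivity
    rw [hRx, smul_dotProduct, smul_eq_mul]
    -- The rate `-σ q / 2` beats the barrier's `-0.45 σ w`; the constants `9 Ψ` and `ν / 5` in the
    -- barrier absorb the contribution of the perturbation.
    refine mul_lt_mul_of_pos_left (hrate.trans_lt ?_) hq0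
    linarith

end ResidualFlow

/-! ### The flow under the assumptions on initialization and measurements -/

section Assembly

variable {m n h r d : ℕ} {Y : Matrix (Fin m) (Fin n) ℝ} {P : Matrix (Fin m) (Fin r) ℝ}
  {s : Fin r → ℝ} {Q : Matrix (Fin n) (Fin r) ℝ}
  {𝒜 : Matrix (Fin m) (Fin n) ℝ →ₗ[ℝ] EuclideanSpace ℝ (Fin d)}
  {U₀ : Matrix (Fin m) (Fin h) ℝ} {V₀ : Matrix (Fin n) (Fin h) ℝ} {α δ ε ρ η T : ℝ}

theorem IsCompactSVD.sv_le_opNorm (hY : IsCompactSVD Y P s Q) (hr : 1 ≤ r) : sv r Y ≤ ‖Y‖ :=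
  (hY.sv_le hr ⟨0, hr⟩).trans (hY.le_opNorm _)

theorem InitAssumption.params (hinit : InitAssumption Y P Q U₀ V₀ α δ ε) (hr : 1 ≤ r)
    (hY : IsCompactSVD Y P s Q) : Params ‖Y‖ (sv r Y) δ α ε (endTime r Y ε) := by
  have hσ := hY.sv_pos hr
  have hσy := hY.sv_le_opNorm hr
  have hy : 0 < ‖Y‖ := hσ.trans_le hσy
  have hα : 0 < α := by linarith [hinit.one_le_alpha]
  have hε := hinit.eps_pos
  have hsq : 0 < Real.sqrt ‖Y‖ := Real.sqrt_pos.2 hy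
  have hεδ : ε ≤ δ / (3 * α) * Real.sqrt ‖Y‖ := hinit.eps_le.trans
    (mul_le_mul_of_nonneg_right (min_le_right _ _) hsq.le)
  have hδ : 0 < δ := by
    have h1 := pos_of_mul_pos_left (hε.trans_le hεδ) hsq.le
    have h2 : δ = δ / (3 * α) * (3 * α) := by field_simp
    rw [h2]
    positivity
  refine ⟨hσ, hσy, hδ, hinit.one_le_alpha, ?_, hε, ?_, ?_⟩
  · have h1 := hinit.delta_le
    rw [kappa, le_div_iff₀ (by positivity)] at h1
    have h2 : δ * (64 * α * (‖Y‖ / sv r Y)) = 64 * (α * δ * ‖Y‖) / sv r Y := by ring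
    rwa [h2, div_le_one hσ] at h1
  · rw [div_mul_eq_mul_div, le_div_iff₀ (by positivity)] at hεδ
    linarith
  · rw [endTime]
    field_simp

/-- The part of the smallness assumption on `ε` that controls the unfitted weights against the
number of blocks of rank `r`. -/
theorem InitAssumption.gamma_mul_le (hinit : InitAssumption Y P Q U₀ V₀ α δ ε) (hr : 1 ≤ r)
    (hY : IsCompactSVD Y P s Q) (hγ : 0 < gamma m n r) :
    gamma m n r * (ε * Real.sqrt (sv r Y)) ≤ ‖Y‖ := by
  have hσ := hY.sv_pos hr
  have hα := hinit.one_le_alpha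
  have hε := hinit.eps_pos
  have hy : 0 < ‖Y‖ := hσ.trans_le (hY.sv_le_opNorm hr)
  have h1 : ε ≤ Real.sqrt (kappa r Y) / (α * gamma m n r) * Real.sqrt ‖Y‖ := hinit.eps_le.trans
    (mul_le_mul_of_nonneg_right (min_le_left _ _) (Real.sqrt_nonneg _))
  rw [div_mul_eq_mul_div, le_div_iff₀ (by positivity), kappa, ← Real.sqrt_mul (by positivity),
    div_mul_eq_mul_div, Real.sqrt_div (by positivity), Real.sqrt_mul_self hy.le,
    le_div_iff₀ (Real.sqrt_pos.2 hσ)] at h1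
  have h2 : 0 ≤ gamma m n r * (ε * Real.sqrt (sv r Y)) := by positivity
  have h3 := mul_le_mul_of_nonneg_right hα h2
  linarith

theorem one_le_gamma (hr : 1 ≤ r) (hY : IsCompactSVD Y P s Q) : 1 ≤ gamma m n r := by
  have hr0 : (0 : ℝ) < r := by exact_mod_cast hr
  rw [gamma, one_le_div hr0]
  exact_mod_cast le_min (card_le_of_orthonormal hY.left) (card_le_of_orthonormal hY.right)

theorem scales_of_assumptions (hr : 1 ≤ r) (hY : IsCompactSVD Y P s Q)
    (hinit : InitAssumption Y P Q U₀ V₀ α δ ε)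
    (hrip : RIPAssumption r Y 𝒜 δ ρ η (endTime r Y ε)) :
    Scales 𝒜 Y r ‖Y‖ (endTime r Y ε) δ ρ η (gamma m n r)
      (psi ε (δ * ‖Y‖) (endTime r Y ε) ^ 2) ⌈gamma m n r⌉₊ := by
  have H := hinit.params hr hY
  have hr0 : (0 : ℝ) < r := by exact_mod_cast hr
  have hrm : r ≤ m := card_le_of_orthonormal hY.left
  have hrn : r ≤ n := card_le_of_orthonormal hY.right
  have hγ1 := one_le_gamma hr hY
  have hγ : 0 < gamma m n r := by linarith
  have hT := H.pos_T
  have hy := H.pos_y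
  -- An `m × n` matrix is split into `⌈γ⌉` blocks of rank `r`.
  refine ⟨by omega, hy, rfl, hY.rank_le, hT, ?_, H.pos_delta, H.delta_le', hrip.eta_pos, hrip.eta_le,
    hrip.rip.nonneg (by omega) (by omega), ?_, hrip.rip, ?_, ?_, hγ, sq_nonneg _, ?_⟩
  · exact H.le_T.trans (mul_le_mul_of_nonneg_left H.sigma_le hT.le)
  -- the factor `√r` in the assumption on `ρ` cancels
  · have h1 := mul_le_mul_of_nonneg_right hrip.rho_le (Real.sqrt_nonneg r)
    refine h1.trans_eq ?_
    have : 0 < Real.sqrt r := Real.sqrt_pos.2 hr0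
    field_simp
  · have h1 : gamma m n r * r ≤ ⌈gamma m n r⌉₊ * r :=
      mul_le_mul_of_nonneg_right (Nat.le_ceil _) hr0.le
    have h2 : gamma m n r * r = (min m n : ℕ) := by rw [gamma, div_mul_cancel₀ _ hr0.ne']
    rw [h2] at h1
    exact_mod_cast h1
  · have := Nat.ceil_lt_add_one hγ.le
    linarith
  · exact (mul_le_mul_of_nonneg_left H.psi_T_sq_le hγ.le).trans (hinit.gamma_mul_le hr hY hγ)

/-- The generator of the perturbed flow is constant on each time step. -/
theorem dilation_add_perturbation (W : ℝ → Matrix (Fin m ⊕ Fin n) (Fin h) ℝ) (t : ℝ) :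
    dilation (resid Y (W t)) + perturbation 𝒜 Y η W t =
      generator 𝒜 Y η (W (⌊t / η⌋₊ * η)) := by
  rw [perturbation, add_sub_cancel, generator]

/-- A perturbed flow exists: concatenate the linear flows of the time steps. -/
theorem exists_isPerturbedGradientFlow (hη : 0 < η) (U₀ : Matrix (Fin m) (Fin h) ℝ)
    (V₀ : Matrix (Fin n) (Fin h) ℝ) : ∃ W, IsPerturbedGradientFlow 𝒜 Y η U₀ V₀ W := by
  refine ⟨stepFlow (generator 𝒜 Y η) η (Matrix.fromRows U₀ V₀), ?_, continuousOn_stepFlow hη,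
    fun t ht => ?_⟩
  · have := stepFlow_knot (F := generator 𝒜 Y η) (W₀ := Matrix.fromRows U₀ V₀) hη 0
    rwa [Nat.cast_zero, zero_mul] at this
  · rw [dilation_add_perturbation]
    exact hasDerivWithinAt_stepFlow hη ht

theorem flow_eq_velocity (W : ℝ → Matrix (Fin m ⊕ Fin n) (Fin h) ℝ) (t : ℝ) :
    (dilation (resid Y (W t)) + perturbation 𝒜 Y η W t) * W t =
      velocity (dilation Y) (refl m n) (perturbation 𝒜 Y η W t) (W t) := by
  rw [dilation_resid, velocity_eq]

/-- Under the assumptions, the flow stays trapped up to the end time. -/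
theorem IsPerturbedGradientFlow.trapped {W : ℝ → Matrix (Fin m ⊕ Fin n) (Fin h) ℝ}
    (hflow : IsPerturbedGradientFlow 𝒜 Y η U₀ V₀ W) (hr : 1 ≤ r) (hY : IsCompactSVD Y P s Q)
    (hinit : InitAssumption Y P Q U₀ V₀ α δ ε)
    (hrip : RIPAssumption r Y 𝒜 δ ρ η (endTime r Y ε)) :
    ∀ t ∈ Icc 0 (endTime r Y ε),
      Trapped (refl m n) (eigPos P Q) (eigPos P (-Q)) s ‖Y‖ δ α ε (endTime r Y ε) t (W t) := by
  have H := hinit.params hr hY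
  have hs := scales_of_assumptions hr hY hinit hrip
  refine trapped_of_velocity (E := perturbation 𝒜 Y η W) hY.frame H (hY.sv_le hr) hY.le_opNorm
    (hflow.cont.mono Icc_subset_Ici_self) (by rw [hflow.init]; exact hinit.norm_le)
    (fun t ht => by rw [← flow_eq_velocity]; exact hflow.deriv t ht.1) fun t ht hb => ?_
  have hτ : (⌊t / η⌋₊ * η : ℝ) ∈ Icc 0 t :=
    ⟨by have := hs.pos_eta; positivity, floor_div_mul_le hs.pos_eta ht.1⟩
  refine (hs.perturbation_le hflow ht.1 (fun u hu => (hb u hu).1) (H.psi_pos _).le le_rfl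
    (hb _ hτ).2).trans ?_
  have h1 := norm_resid_le (Y := Y) rfl (hb _ hτ).1
  have h2 := hs.gamma_Psi_le
  have hT := H.pos_T
  have hy := H.pos_y
  calc δ ^ 2 / (endTime r Y ε * ‖Y‖) / 4 * _
      ≤ δ ^ 2 / (endTime r Y ε * ‖Y‖) / 4 * (16 / 5 * ‖Y‖) :=
        mul_le_mul_of_nonneg_left (by linarith) (by positivity)
    _ = 4 / 5 * δ ^ 2 / endTime r Y ε := by field_simp; norm_num

/-- Once the flow is known to be trapped, the perturbation is bounded by the residual at the last
grid point, rather than only by a constant. -/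
theorem IsPerturbedGradientFlow.perturbation_le {W : ℝ → Matrix (Fin m ⊕ Fin n) (Fin h) ℝ}
    (hflow : IsPerturbedGradientFlow 𝒜 Y η U₀ V₀ W) (hr : 1 ≤ r) (hY : IsCompactSVD Y P s Q)
    (hinit : InitAssumption Y P Q U₀ V₀ α δ ε)
    (hrip : RIPAssumption r Y 𝒜 δ ρ η (endTime r Y ε)) {t : ℝ} (ht : t ∈ Ico 0 (endTime r Y ε)) :
    ‖perturbation 𝒜 Y η W t‖ ≤ δ ^ 2 / (endTime r Y ε * ‖Y‖) / 4 *
      (‖resid Y (W (⌊t / η⌋₊ * η))‖ +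
        gamma m n r * psi ε (δ * ‖Y‖) (endTime r Y ε) ^ 2) := by
  have H := hinit.params hr hY
  have hs := scales_of_assumptions hr hY hinit hrip
  have htrap := hflow.trapped hr hY hinit hrip
  have hτ : (⌊t / η⌋₊ * η : ℝ) ∈ Icc 0 t :=
    ⟨by have := hs.pos_eta; positivity, floor_div_mul_le hs.pos_eta ht.1⟩
  refine hs.perturbation_le hflow ht.1
    (fun u hu => (htrap u ⟨hu.1, hu.2.trans ht.2.le⟩).opNorm_sq_le H hY.frame hY.le_opNorm)
    (A := (eigPos P Q)ᵀ * W (⌊t / η⌋₊ * η)) (H.psi_pos _).le le_rfl fun x hx => ?_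
  refine ((htrap _ ⟨hτ.1, hτ.2.trans ht.2.le⟩).vnorm_le_of_ker H hY.frame hx).trans ?_
  exact mul_le_mul_of_nonneg_right (psi_le H.pos_eps (mul_pos H.pos_delta H.pos_y).le
    (hτ.2.trans ht.2.le)) (vnorm_nonneg _)

/-- A perturbed flow passes through the iterates of gradient descent, as long as the steps are so
short that the logarithm in the perturbation is the usual one. -/
theorem IsPerturbedGradientFlow.eq_gd {W : ℝ → Matrix (Fin m ⊕ Fin n) (Fin h) ℝ}
    (hflow : IsPerturbedGradientFlow 𝒜 Y η U₀ V₀ W) (hm : 0 < m) (hη : 0 < η)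
    (hsmall : ∀ t ∈ Icc 0 T, η * ‖adj 𝒜 (𝒜 (resid Y (W t)))‖ < 1) (k : ℕ) (hk : k * η ≤ T) :
    W (k * η) = Matrix.fromRows (gd 𝒜 Y η U₀ V₀ k).1 (gd 𝒜 Y η U₀ V₀ k).2 := by
  induction k with
  | zero => rw [Nat.cast_zero, zero_mul, hflow.init, gd]
  | succ k ih =>
    have hkη : (0 : ℝ) ≤ k * η := by positivity
    have hle : (k * η : ℝ) ≤ (k + 1) * η := by linarith
    push_cast at hk ⊢
    have ih := ih (hle.trans hk)
    have h1 := eq_exp_mul_of_hasDerivWithinAt (M := generator 𝒜 Y η (W (k * η))) (a := k * η)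
      (b := (k + 1) * η) (hflow.cont.mono fun t ht => hkη.trans ht.1) (fun t ht => by
        have := hflow.deriv t (hkη.trans ht.1)
        rwa [dilation_add_perturbation, floor_div_eq hη ht.1 ht.2] at this) _ ⟨hle, le_rfl⟩
    rw [h1, add_mul, one_mul, add_sub_cancel_left,
      exp_generator_mul hm hη (hsmall _ ⟨hkη, hle.trans hk⟩), ih, gd]
    simp

/-- The aligned part grows during the first `0.3 T`, and the residual decays during the rest. -/
theorem IsPerturbedGradientFlow.norm_resid_endTime_le
    {W : ℝ → Matrix (Fin m ⊕ Fin n) (Fin h) ℝ}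
    (hflow : IsPerturbedGradientFlow 𝒜 Y η U₀ V₀ W) (hr : 1 ≤ r) (hY : IsCompactSVD Y P s Q)
    (hinit : InitAssumption Y P Q U₀ V₀ α δ ε)
    (hrip : RIPAssumption r Y 𝒜 δ ρ η (endTime r Y ε)) :
    ‖resid Y (W (endTime r Y ε))‖ ≤ residBound ‖Y‖ (sv r Y)
      (psi ε (δ * ‖Y‖) (endTime r Y ε) ^ 2)
      (δ ^ 2 * (gamma m n r * psi ε (δ * ‖Y‖) (endTime r Y ε) ^ 2))
      (3 / 10 * endTime r Y ε) (endTime r Y ε) := by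
  have H := hinit.params hr hY
  have hs := scales_of_assumptions hr hY hinit hrip
  have htrap := hflow.trapped hr hY hinit hrip
  have hE : ∀ t ∈ Ico 0 (endTime r Y ε), ‖perturbation 𝒜 Y η W t‖ ≤ _ := fun t ht =>
    hflow.perturbation_le hr hY hinit hrip ht
  have hT := H.pos_T
  have hsv : 0 < sv r (aligned P Q U₀ V₀) :=
    lt_of_lt_of_le (by have := H.pos_eps; have := H.pos_alpha; positivity) hinit.le_sv
  have hA := growth_le_of_trapped (E := perturbation 𝒜 Y η W) hY.frame H (hY.sv_le hr)
    hY.le_opNorm (hflow.cont.mono Icc_subset_Ici_self)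
    (fun t ht => by rw [← flow_eq_velocity]; exact hflow.deriv t ht.1) (fun t ht => ?_) htrap
    fun u => ?_
  · exact norm_resid_le_residBound hY H hs hY.le_opNorm hflow hE htrap hA _
      ⟨by linarith, le_rfl⟩
  · refine (hE t ht).trans ?_
    have hτ : (⌊t / η⌋₊ * η : ℝ) ∈ Icc 0 (endTime r Y ε) :=
      ⟨by have := hs.pos_eta; positivity, (floor_div_mul_le hs.pos_eta ht.1).trans ht.2.le⟩
    have h1 := norm_resid_le (Y := Y) rfl ((htrap _ hτ).opNorm_sq_le H hY.frame hY.le_opNorm)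
    have h2 := hs.gamma_Psi_le
    have hy := H.pos_y
    calc δ ^ 2 / (endTime r Y ε * ‖Y‖) / 4 * _
        ≤ δ ^ 2 / (endTime r Y ε * ‖Y‖) / 4 * (16 / 5 * ‖Y‖) :=
          mul_le_mul_of_nonneg_left (by linarith) (by positivity)
      _ = 4 / 5 * δ ^ 2 / endTime r Y ε := by field_simp; norm_num
  · rw [hflow.init, transpose_eigPos_mul, Matrix.toRows₁_fromRows, Matrix.toRows₂_fromRows]
    exact (mul_le_mul_of_nonneg_right hinit.le_sv (vnorm_nonneg _)).trans
      (sv_mul_vnorm_le hr _ hsv u)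

/-! ### The error bound -/

/-- At the end time the decaying part of the bound for the residual is negligible. -/
theorem Params.residBound_le {y σ Ψ ν : ℝ} (H : Params y σ δ α ε T) :
    residBound y σ Ψ ν (3 / 10 * T) T ≤
      ε ^ 2 * (Real.sqrt y / Real.sqrt σ) + (9 * Ψ + 1 / 5 * ν) := by
  have hσ := H.pos_sigma
  have hε := H.pos_eps
  have hy := H.pos_y
  have hα := H.pos_alpha
  have hρ : 0 < Real.sqrt σ := Real.sqrt_pos.2 hσ
  have hz := H.sqrt_pos
  have hρρ : Real.sqrt σ ^ 2 = σ := Real.sq_sqrt hσ.le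
  have hzz := H.sq_sqrt
  unfold residBound
  refine add_le_add ?_ le_rfl
  have h1 : Real.exp (-(9 / 20 * σ * (T - 3 / 10 * T))) ≤ (ε / Real.sqrt σ) ^ 3 := by
    have h2 : Real.exp (-(Real.log (σ / ε ^ 2) / 2)) = ε / Real.sqrt σ := by
      rw [Real.exp_neg, Real.exp_half, H.exp_log, Real.sqrt_div hσ.le, Real.sqrt_sq hε.le, inv_div]
    rw [← h2, ← Real.exp_nat_mul]
    gcongr
    have h3 := H.T_eq
    have h4 := H.le_log
    push_cast
    linarith
  have h5 : Real.sqrt y * ε ≤ σ / 192 := by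
    rw [← sq_le_sq₀ (by positivity) (by positivity), mul_pow, hzz, div_pow]
    have h6 := H.eps_sq_mul_le
    have h7 : 1 ≤ α ^ 4 := one_le_pow₀ H.one_le_alpha
    have h8 := mul_le_mul_of_nonneg_right h7 (show 0 ≤ 36864 * y * ε ^ 2 by positivity)
    norm_num
    linarith
  calc 11 / 5 * y * Real.exp (-(9 / 20 * σ * (T - 3 / 10 * T)))
      ≤ 11 / 5 * y * (ε / Real.sqrt σ) ^ 3 := by gcongr
    _ = 11 / 5 * (ε ^ 2 * (Real.sqrt y / Real.sqrt σ)) * (Real.sqrt y * ε / σ) := by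
      field_simp
      rw [hρρ, hzz, mul_comm]
    _ ≤ 11 / 5 * (ε ^ 2 * (Real.sqrt y / Real.sqrt σ)) * (1 / 192) := by
      refine mul_le_mul_of_nonneg_left ?_ (by positivity)
      rw [div_le_iff₀ hσ]
      linarith
    _ ≤ ε ^ 2 * (Real.sqrt y / Real.sqrt σ) := by
      have : 0 ≤ ε ^ 2 * (Real.sqrt y / Real.sqrt σ) := by positivity
      linarith

theorem Params.one_le_ratio {y σ : ℝ} (H : Params y σ δ α ε T) : 1 ≤ σ / ε ^ 2 := by
  have h := Real.add_one_le_exp (Real.log (σ / ε ^ 2))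
  rw [H.exp_log] at h
  linarith [H.le_log]

/-- The growth factor of `ψ²` is `exp (6.4 δ y T) = (σ / ε²) ^ (32 κ δ)`. -/
theorem Params.psi_T_sq_le_rpow {y σ : ℝ} (H : Params y σ δ α ε T) :
    psi ε (δ * y) T ^ 2 ≤ ε ^ 2 * (σ / ε ^ 2) ^ (32 * α * (y / σ) * δ) := by
  have hσ := H.pos_sigma
  have hδ := H.pos_delta
  have hy := H.pos_y
  have hL := H.le_log
  rw [psi_sq, Real.rpow_def_of_pos H.ratio_pos]
  refine mul_le_mul_of_nonneg_left (Real.exp_le_exp.2 ?_) (sq_nonneg ε)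
  have h1 : 32 / 5 * (δ * y) * T = 32 * (δ * (y / σ)) * Real.log (σ / ε ^ 2) := by
    have : T = 5 * Real.log (σ / ε ^ 2) / σ := by rw [← H.T_eq, mul_div_cancel_right₀ _ hσ.ne']
    rw [this]
    field_simp
  rw [h1]
  have h2 := mul_le_mul_of_nonneg_right H.one_le_alpha
    (show 0 ≤ 32 * (δ * (y / σ)) * Real.log (σ / ε ^ 2) by positivity)
  linarith

/-- The exponent `32 α κ δ` is at most `1 / 2`. -/
theorem Params.rpow_le {y σ : ℝ} (H : Params y σ δ α ε T) :
    ε ^ 2 * (σ / ε ^ 2) ^ (32 * α * (y / σ) * δ) ≤ ε * Real.sqrt σ := by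
  have hσ := H.pos_sigma
  have hε := H.pos_eps
  have h1 : 32 * α * (y / σ) * δ ≤ 1 / 2 := by
    have h2 : 32 * α * (y / σ) * δ = 32 * (α * δ * y) / σ := by ring
    rw [h2, div_le_iff₀ hσ]
    linarith [H.delta_le]
  calc ε ^ 2 * (σ / ε ^ 2) ^ (32 * α * (y / σ) * δ) ≤ ε ^ 2 * (σ / ε ^ 2) ^ (1 / 2 : ℝ) := by
        gcongr
        exact H.one_le_ratio
    _ = ε * Real.sqrt σ := by
      rw [← Real.sqrt_eq_rpow, Real.sqrt_div hσ.le, Real.sqrt_sq hε.le]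
      field_simp

theorem errorBound_eq :
    errorBound r Y α δ ε = 64 * (ε ^ 2 * (sv r Y / ε ^ 2) ^ (32 * α * (‖Y‖ / sv r Y) * δ)) *
      (δ ^ 2 * gamma m n r * kappa r Y + Real.sqrt (kappa r Y)) := by
  rw [errorBound, kappa]; ring

theorem IsPerturbedGradientFlow.norm_resid_le_errorBound
    {W : ℝ → Matrix (Fin m ⊕ Fin n) (Fin h) ℝ}
    (hflow : IsPerturbedGradientFlow 𝒜 Y η U₀ V₀ W) (hr : 1 ≤ r) (hY : IsCompactSVD Y P s Q)
    (hinit : InitAssumption Y P Q U₀ V₀ α δ ε)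
    (hrip : RIPAssumption r Y 𝒜 δ ρ η (endTime r Y ε)) :
    ‖resid Y (W (endTime r Y ε))‖ ≤ errorBound r Y α δ ε := by
  have H := hinit.params hr hY
  have hγ : 0 < gamma m n r := by linarith [one_le_gamma hr hY]
  have hκ : 1 ≤ kappa r Y := (one_le_div H.pos_sigma).2 H.sigma_le
  have hκ' : 1 ≤ Real.sqrt (kappa r Y) := Real.one_le_sqrt.2 hκ
  refine (hflow.norm_resid_endTime_le hr hY hinit hrip).trans (H.residBound_le.trans ?_)
  have h1 := H.psi_T_sq_le_rpow
  have h2 : ε ^ 2 ≤ psi ε (δ * ‖Y‖) (endTime r Y ε) ^ 2 := by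
    have := psi_le H.pos_eps (mul_pos H.pos_delta H.pos_y).le H.pos_T.le
    rw [psi_zero] at this
    exact pow_le_pow_left₀ H.pos_eps.le this 2
  rw [← Real.sqrt_div H.pos_y.le, errorBound_eq]
  change ε ^ 2 * Real.sqrt (kappa r Y) + _ ≤ _
  set Ψ := psi ε (δ * ‖Y‖) (endTime r Y ε) ^ 2
  have hΨ : 0 ≤ Ψ := sq_nonneg _
  have h4 := mul_le_mul_of_nonneg_right h1
    (show 0 ≤ δ ^ 2 * gamma m n r * kappa r Y + Real.sqrt (kappa r Y) by positivity)
  have h5 := mul_le_mul_of_nonneg_right h2 (Real.sqrt_nonneg (kappa r Y))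
  have h6 := mul_le_mul_of_nonneg_left hκ' hΨ
  have h7 := mul_le_mul_of_nonneg_left hκ (show 0 ≤ δ ^ 2 * gamma m n r * Ψ by positivity)
  have h8 : 0 ≤ δ ^ 2 * gamma m n r * Ψ := by positivity
  linarith

theorem errorBound_le (hr : 1 ≤ r) (hY : IsCompactSVD Y P s Q)
    (hinit : InitAssumption Y P Q U₀ V₀ α δ ε) : errorBound r Y α δ ε ≤
      64 * (δ ^ 2 * gamma m n r * kappa r Y + Real.sqrt (kappa r Y)) * Real.sqrt (sv r Y) * ε := by
  have H := hinit.params hr hY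
  have hγ : 0 < gamma m n r := by linarith [one_le_gamma hr hY]
  have hκ : 1 ≤ kappa r Y := (one_le_div H.pos_sigma).2 H.sigma_le
  have h1 := mul_le_mul_of_nonneg_right H.rpow_le
    (show 0 ≤ δ ^ 2 * gamma m n r * kappa r Y + Real.sqrt (kappa r Y) by positivity)
  rw [errorBound_eq]
  linarith

/-- Under the assumptions the steps are far shorter than `eq_gd` needs. -/
theorem IsPerturbedGradientFlow.eta_mul_gradient_lt_one
    {W : ℝ → Matrix (Fin m ⊕ Fin n) (Fin h) ℝ}
    (hflow : IsPerturbedGradientFlow 𝒜 Y η U₀ V₀ W) (hr : 1 ≤ r) (hY : IsCompactSVD Y P s Q)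
    (hinit : InitAssumption Y P Q U₀ V₀ α δ ε)
    (hrip : RIPAssumption r Y 𝒜 δ ρ η (endTime r Y ε)) :
    ∀ t ∈ Icc 0 (endTime r Y ε), η * ‖adj 𝒜 (𝒜 (resid Y (W t)))‖ < 1 := fun t ht => by
  have H := hinit.params hr hY
  have hs := scales_of_assumptions hr hY hinit hrip
  have htrap := hflow.trapped hr hY hinit hrip t ht
  have h1 := hs.eta_mul_gradient_le (A := (eigPos P Q)ᵀ * W t) (H.psi_pos _).le le_rfl
    (fun x hx => (htrap.vnorm_le_of_ker H hY.frame hx).trans (mul_le_mul_of_nonneg_right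
      (psi_le H.pos_eps (mul_pos H.pos_delta H.pos_y).le ht.2) (vnorm_nonneg _)))
    (htrap.opNorm_sq_le H hY.frame hY.le_opNorm)
  linarith [hs.ratio_le.2]

end Assembly

end MatrixSensing

end

theorem mainTheorem1 {m n h r d : ℕ} (hr : 1 ≤ r)
    (Y : Matrix (Fin m) (Fin n) ℝ) (P : Matrix (Fin m) (Fin r) ℝ) (s : Fin r → ℝ)
    (Q : Matrix (Fin n) (Fin r) ℝ) (hY : MatrixSensing.IsCompactSVD Y P s Q)
    (𝒜 : Matrix (Fin m) (Fin n) ℝ →ₗ[ℝ] EuclideanSpace ℝ (Fin d))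
    (U₀ : Matrix (Fin m) (Fin h) ℝ) (V₀ : Matrix (Fin n) (Fin h) ℝ) (α δ ε ρ η : ℝ)
    (hinit : MatrixSensing.InitAssumption Y P Q U₀ V₀ α δ ε)
    (hrip : MatrixSensing.RIPAssumption r Y 𝒜 δ ρ η (MatrixSensing.endTime r Y ε)) :
    (∃ W, MatrixSensing.IsPerturbedGradientFlow 𝒜 Y η U₀ V₀ W) ∧
    (∀ W, MatrixSensing.IsPerturbedGradientFlow 𝒜 Y η U₀ V₀ W →
      (∀ k : ℕ, k * η ≤ MatrixSensing.endTime r Y ε →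
        W (k * η) = Matrix.fromRows (MatrixSensing.gd 𝒜 Y η U₀ V₀ k).1
          (MatrixSensing.gd 𝒜 Y η U₀ V₀ k).2) ∧
      ‖Y - (W (MatrixSensing.endTime r Y ε)).toRows₁ *
          (W (MatrixSensing.endTime r Y ε)).toRows₂ᵀ‖ ≤ MatrixSensing.errorBound r Y α δ ε) ∧
    MatrixSensing.errorBound r Y α δ ε ≤
      64 * (δ ^ 2 * MatrixSensing.gamma m n r * MatrixSensing.kappa r Y +
        Real.sqrt (MatrixSensing.kappa r Y)) * Real.sqrt (MatrixSensing.sv r Y) * ε := by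
  have hs := MatrixSensing.scales_of_assumptions hr hY hinit hrip
  exact ⟨MatrixSensing.exists_isPerturbedGradientFlow hs.pos_eta U₀ V₀, fun W hflow =>
    ⟨hflow.eq_gd hs.pos_m hs.pos_eta (hflow.eta_mul_gradient_lt_one hr hY hinit hrip),
      hflow.norm_resid_le_errorBound hr hY hinit hrip⟩, MatrixSensing.errorBound_le hr hY hinit⟩
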